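/- **Cuntz–Krieger uniqueness theorem.** Conventions. $k$ is an index set, $\mathbb N_0^k$ and $\mathbb Z^k$ are the finitely supported functions on $k$. A $*$-algebra is a complex algebra $X$ with a conjugate linear involution (a unit is not required); $\tilde X=X\oplus\mathbb C1$ is its unitization. A projection is an element $p=p^2=p^*$. *Semigraph algebras.* A $k$-semigraph is a set $S$ with a partially defined associative multiplication ($(st)u$ is defined iff $s(tu)$ is, and then they are equal) and a map $d:S\to\mathbb N_0^k$ such that $d(xy)=d(x)+d(y)$ whenever $xy$ is defined, and such that for all $x\in S$ and $d(x)=n_1+n_2$ there are unique $x_1,x_2\in S$ with $x=x_1x_2$, $d(x_i)=n_i$. For $x,y\in S$ let $S^{(\min)}(x,y)$ be the set of $(\alpha,\beta)\in S\times S$ such that $x\alpha$, $y\beta$ are defined, $x\alpha=y\beta$ and $d(x\alpha)=d(x)\vee d(y)$; $S$ is finitely aligned if all these sets are finite. A $k$-semigraph algebra is a $*$-algebra $X$ generated (as a $*$-algebra) by disjoint subsets $\mathcal P,\mathcal T$ with a degree map $d$ on $\mathcal T_1:=\mathcal T\sqcup\{1\}\subseteq\tilde X$ such that 1. $\mathcal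 P$ is a set of commuting projections closed under multiplication; 2. $\mathcal T$ is a set of nonzero elements $t$ with $tt^*t=t$, closed under nonzero products; 3. $\mathcal T_1$ is a finitely aligned $k$-semigraph, where a product of elements of $\mathcal T_1$ is defined iff it is nonzero in $\tilde X$; 4. for all $x\in\mathcal T$, $p\in\mathcal P$ there is $q\in\mathcal P$ with $px=xq$; 5. for all $x,y\in\mathcal T$ there are $q_{\alpha,\beta}\in\mathcal P$ with $x^*y=\sum_{(\alpha,\beta)\in\mathcal T_1^{(\min)}(x,y)}\alpha\, q_{\alpha,\beta}\,\beta^*$; 6. let $\mathbb F$ be the free non-unital $*$-algebra on the letters $\mathcal P\sqcup\mathcal T$; give a word in the letters and their adjoints the degree in $\mathbb Z^k$ that is the sum of the degrees of its letters, where $p,p^*$ have degree $0$, $t$ has degree $d(t)$ and $t^*$ has degree $-d(t)$. Then the kernel of the canonical map $\mathbb F\to X$ is generated, as a self-adjoint two-sided ideal, by elements each of which is a linear combination of words of one common degree. A nonzero element of $X$ is a word of degree $n$ if it is the image of a word of degree $n$ of $\mathbb F$. The core of $X$ is the linear span of the images of all words of degree $0$. Standard words are the elements $spt^*$ of $X$,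 half-standard words the elements $sp$, with $s,t\in\mathcal T_1$, $p\in\mathcal P$. Standard projections are the elements $xx^*(1-y_1y_1^*)\cdots(1-y_my_m^*)$ with $m\ge0$ and half-standard words $x,y_1,\dots,y_m$. $X$ is called cancelling if for every nonzero standard word $w$ of nonzero degree and every nonzero standard projection $p$ there is a nonzero standard projection $q\le p$ (that is, $qp=pq=q$) with $qwq=0$. The enveloping $C^*$-algebra $C^*(X)$ is the Hausdorff completion of $X$ with respect to the largest $C^*$-seminorm on $X$, and the universal representation is the canonical $*$-homomorphism $X\to C^*(X)$. **Theorem.** Let $X$ be a cancelling semigraph algebra. Then the universal representation $\iota:X\to C^*(X)$ is injective on the core. It has dense image and does not vanish on nonzero standard projections, and up to isomorphism it is the only such representation: if $B$ is a $C^*$-algebra and $\rho:X\to B$ is a $*$-homomorphism with dense image and $\rho(p)\ne0$ for every nonzero standard projection $p$, then there is a $*$-isomorphism $\varphi:C^*(X)\to B$ with $\varphi\circ\iota=\rho$. -/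

import Mathlib

/-! ### C*-seminorms and their completions -/

/-- A C*-seminorm on a complex *-algebra `X`: a submultiplicative seminorm with
`N (x* x) = (N x)^2`. -/
structure CStarSeminorm (X : Type*) [NonUnitalRing X] [StarRing X] [Module ℂ X] extends
    Seminorm ℂ X where
  mul_le' : ∀ x y : X, toFun (x * y) ≤ toFun x * toFun y
  star_mul_self' : ∀ x : X, toFun (star x * x) = toFun x * toFun x

namespace CStarSeminorm

section Basic

variable {X : Type*} [NonUnitalRing X] [StarRing X] [Module ℂ X]

instance : CoeFun (CStarSeminorm X) (fun _ => X → ℝ) := ⟨fun N => N.toFun⟩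

theorem mul_le (N : CStarSeminorm X) (x y : X) : N (x * y) ≤ N x * N y := N.mul_le' x y

theorem star_mul_self (N : CStarSeminorm X) (x : X) : N (star x * x) = N x * N x :=
  N.star_mul_self' x

theorem nonneg (N : CStarSeminorm X) (x : X) : 0 ≤ N x := apply_nonneg N.toSeminorm x

theorem add_le (N : CStarSeminorm X) (x y : X) : N (x + y) ≤ N x + N y :=
  map_add_le_add N.toSeminorm x y

theorem smul_eq (N : CStarSeminorm X) (c : ℂ) (x : X) : N (c • x) = ‖c‖ * N x :=
  map_smul_eq_mul N.toSeminorm c x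

theorem map_zero (N : CStarSeminorm X) : N 0 = 0 := _root_.map_zero N.toSeminorm

theorem map_neg (N : CStarSeminorm X) (x : X) : N (-x) = N x := map_neg_eq_map N.toSeminorm x

theorem le_star (N : CStarSeminorm X) (x : X) : N x ≤ N (star x) := by
  rcases (N.nonneg x).eq_or_lt with h | h
  · rw [← h]; exact N.nonneg _
  · have h1 := N.mul_le (star x) x
    rw [N.star_mul_self] at h1
    exact le_of_mul_le_mul_right h1 h

theorem star_eq (N : CStarSeminorm X) (x : X) : N (star x) = N x :=
  le_antisymm (by simpa using N.le_star (star x)) (N.le_star x)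

/-- The C*-seminorm induced by a *-homomorphism into a C*-algebra. -/
def ofHom {B : Type*} [NonUnitalCStarAlgebra B] (ρ : X →⋆ₙₐ[ℂ] B) : CStarSeminorm X where
  toFun x := ‖ρ x‖
  map_zero' := by simp
  add_le' x y := by simpa using norm_add_le (ρ x) (ρ y)
  neg' x := by simp
  smul' c x := by simp [norm_smul]
  mul_le' x y := by simpa using norm_mul_le (ρ x) (ρ y)
  star_mul_self' x := by
    rw [map_mul, map_star, CStarRing.norm_star_mul_self]

/-- The zero C*-seminorm. -/
noncomputable instance : Zero (CStarSeminorm X) :=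
  ⟨{ toFun := fun _ => 0
     map_zero' := rfl
     add_le' := by simp
     neg' := by simp
     smul' := by simp
     mul_le' := by simp
     star_mul_self' := by simp }⟩

/-- The algebra `X`, regarded as a seminormed algebra through the C*-seminorm `N`. -/
def Space (_N : CStarSeminorm X) : Type _ := X

variable (N : CStarSeminorm X)

instance : NonUnitalRing N.Space := inferInstanceAs (NonUnitalRing X)
instance : StarRing N.Space := inferInstanceAs (StarRing X)
instance : Module ℂ N.Space := inferInstanceAs (Module ℂ X)
instance [IsScalarTower ℂ X X] : IsScalarTower ℂ N.Space N.Space :=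
  inferInstanceAs (IsScalarTower ℂ X X)
instance [SMulCommClass ℂ X X] : SMulCommClass ℂ N.Space N.Space :=
  inferInstanceAs (SMulCommClass ℂ X X)
instance [StarModule ℂ X] : StarModule ℂ N.Space := inferInstanceAs (StarModule ℂ X)

noncomputable instance : SeminormedAddCommGroup N.Space :=
  AddGroupSeminorm.toSeminormedAddCommGroup (E := N.Space)
    { toFun := fun x => N x
      map_zero' := N.map_zero
      add_le' := N.add_le
      neg' := N.map_neg }

noncomputable instance : NonUnitalSeminormedRing N.Space where
  __ := (inferInstance : SeminormedAddCommGroup N.Space)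
  __ := (inferInstance : NonUnitalRing N.Space)
  norm_mul_le x y := N.mul_le x y

noncomputable instance : NormedSpace ℂ N.Space where
  __ := (inferInstance : Module ℂ N.Space)
  norm_smul_le c x := (N.smul_eq c x).le

theorem norm_def (x : N.Space) : ‖x‖ = N x := rfl

/-- The Hausdorff completion of `X` with respect to the C*-seminorm `N`. -/
def Completion : Type _ := UniformSpace.Completion N.Space

end Basic

section Completion

open UniformSpace UniformSpace.Completion

variable {X : Type*} [NonUnitalRing X] [StarRing X] [Module ℂ X] (N : CStarSeminorm X)

noncomputable instance : NormedAddCommGroup N.Completion :=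
  inferInstanceAs (NormedAddCommGroup (UniformSpace.Completion N.Space))
noncomputable instance : NormedSpace ℂ N.Completion :=
  inferInstanceAs (NormedSpace ℂ (UniformSpace.Completion N.Space))
instance : CompleteSpace N.Completion :=
  inferInstanceAs (CompleteSpace (UniformSpace.Completion N.Space))

/-- The canonical map from `X` to the completion. -/
noncomputable def coe (x : X) : N.Completion :=
  UniformSpace.Completion.coe' (α := N.Space) x

theorem continuous_coe : Continuous (fun x : N.Space => N.coe x) :=
  UniformSpace.Completion.continuous_coe _

theorem isDenseInducing_coe : IsDenseInducing (fun x : N.Space => N.coe x) :=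
  UniformSpace.Completion.isDenseInducing_coe

theorem denseRange_coe : DenseRange N.coe := N.isDenseInducing_coe.dense

theorem norm_coe (x : X) : ‖N.coe x‖ = N x := UniformSpace.Completion.norm_coe (E := N.Space) x

theorem coe_add (x y : X) : N.coe (x + y) = N.coe x + N.coe y :=
  UniformSpace.Completion.coe_add (α := N.Space) x y

theorem coe_zero : N.coe 0 = 0 := UniformSpace.Completion.coe_zero (α := N.Space)

theorem coe_smul (c : ℂ) (x : X) : N.coe (c • x) = c • N.coe x :=
  UniformSpace.Completion.coe_smul (X := N.Space) c x

theorem induction₁ {p : N.Completion → Prop} (hp : IsClosed {a | p a})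
    (ih : ∀ x : X, p (N.coe x)) (a : N.Completion) : p a :=
  UniformSpace.Completion.induction_on (α := N.Space) a hp ih

theorem induction₂ {p : N.Completion → N.Completion → Prop}
    (hp : IsClosed {a : N.Completion × N.Completion | p a.1 a.2})
    (ih : ∀ x y : X, p (N.coe x) (N.coe y)) (a b : N.Completion) : p a b :=
  UniformSpace.Completion.induction_on₂ (α := N.Space) (β := N.Space) a b hp ih

theorem induction₃ {p : N.Completion → N.Completion → N.Completion → Prop}
    (hp : IsClosed {a : N.Completion × N.Completion × N.Completion | p a.1 a.2.1 a.2.2})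
    (ih : ∀ x y z : X, p (N.coe x) (N.coe y) (N.coe z)) (a b c : N.Completion) : p a b c :=
  UniformSpace.Completion.induction_on₃ (α := N.Space) (β := N.Space) (γ := N.Space) a b c hp ih

/-- Multiplication on the completion, extended by continuity. -/
noncomputable instance : Mul N.Completion :=
  ⟨Function.curry <| (N.isDenseInducing_coe.prodMap N.isDenseInducing_coe).extend
    (fun p : N.Space × N.Space => N.coe (p.1 * p.2))⟩

theorem coe_mul (a b : X) : N.coe (a * b) = N.coe a * N.coe b :=
  ((N.isDenseInducing_coe.prodMap N.isDenseInducing_coe).extend_eq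
    (N.continuous_coe.comp (continuous_mul (M := N.Space))) (a, b)).symm

instance : ContinuousMul N.Completion where
  continuous_mul := by
    let c : N.Space →+ N.Completion :=
      { toFun := fun x => N.coe x, map_zero' := N.coe_zero, map_add' := N.coe_add }
    let m := (AddMonoidHom.mul : N.Space →+ N.Space →+ N.Space).compr₂ c
    have hm : Continuous fun p : N.Space × N.Space => m p.1 p.2 :=
      N.continuous_coe.comp continuous_mul
    have di : IsDenseInducing (c : N.Space → N.Completion) := N.isDenseInducing_coe
    exact (di.extend_Z_bilin di hm :)

/-- The involution on the completion, extended by continuity. -/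
noncomputable instance : Star N.Completion :=
  ⟨UniformSpace.Completion.map (fun x : N.Space => star x)⟩

theorem uniformContinuous_star : UniformContinuous (fun x : N.Space => star x) := by
  refine LipschitzWith.uniformContinuous (K := 1) (LipschitzWith.of_dist_le_mul fun x y => ?_)
  rw [dist_eq_norm, dist_eq_norm, ← star_sub, norm_def, norm_def, NNReal.coe_one, one_mul]
  exact (N.star_eq _).le

theorem coe_star (x : X) : N.coe (star x) = star (N.coe x) :=
  (UniformSpace.Completion.map_coe N.uniformContinuous_star x).symm

instance : ContinuousStar N.Completion :=
  ⟨UniformSpace.Completion.continuous_map⟩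

noncomputable instance : NonUnitalRing N.Completion where
  __ := (inferInstance : AddCommGroup N.Completion)
  __ := (inferInstance : Mul N.Completion)
  zero_mul := N.induction₁ (isClosed_eq (by fun_prop) (by fun_prop)) fun x => by
    rw [← N.coe_zero, ← N.coe_mul, zero_mul]
  mul_zero := N.induction₁ (isClosed_eq (by fun_prop) (by fun_prop)) fun x => by
    rw [← N.coe_zero, ← N.coe_mul, mul_zero]
  mul_assoc := N.induction₃ (isClosed_eq (by fun_prop) (by fun_prop)) fun x y z => by
    simp only [← N.coe_mul, mul_assoc]
  left_distrib := N.induction₃ (isClosed_eq (by fun_prop) (by fun_prop)) fun x y z => by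
    simp only [← N.coe_mul, ← N.coe_add, mul_add]
  right_distrib := N.induction₃ (isClosed_eq (by fun_prop) (by fun_prop)) fun x y z => by
    simp only [← N.coe_mul, ← N.coe_add, add_mul]

noncomputable instance : NonUnitalNormedRing N.Completion where
  __ := (inferInstance : NormedAddCommGroup N.Completion)
  __ := (inferInstance : NonUnitalRing N.Completion)
  norm_mul_le := N.induction₂ (isClosed_le (by fun_prop) (by fun_prop)) fun x y => by
    simp only [← N.coe_mul, N.norm_coe]; exact N.mul_le x y

noncomputable instance : StarRing N.Completion where
  star_involutive := N.induction₁ (isClosed_eq (by fun_prop) (by fun_prop)) fun x => by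
    simp only [← N.coe_star, star_star]
  star_mul := N.induction₂ (isClosed_eq (by fun_prop) (by fun_prop)) fun x y => by
    simp only [← N.coe_star, ← N.coe_mul, star_mul]
  star_add := N.induction₂ (isClosed_eq (by fun_prop) (by fun_prop)) fun x y => by
    simp only [← N.coe_star, ← N.coe_add, star_add]

instance : CStarRing N.Completion where
  norm_mul_self_le := N.induction₁ (isClosed_le (by fun_prop) (by fun_prop)) fun x => by
    simp only [← N.coe_star, ← N.coe_mul, N.norm_coe]; exact (N.star_mul_self x).ge

theorem continuous_smul (c : ℂ) : Continuous fun x : N.Completion => c • x :=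
  continuous_const_smul c

instance [IsScalarTower ℂ X X] : IsScalarTower ℂ N.Completion N.Completion where
  smul_assoc c := N.induction₂ (isClosed_eq
      (((N.continuous_smul c).comp continuous_fst).mul continuous_snd)
      ((N.continuous_smul c).comp (continuous_fst.mul continuous_snd))) fun x y => by
    simp only [smul_eq_mul, ← N.coe_smul, ← N.coe_mul, smul_mul_assoc]

instance [SMulCommClass ℂ X X] : SMulCommClass ℂ N.Completion N.Completion where
  smul_comm c := N.induction₂ (isClosed_eq
      ((N.continuous_smul c).comp (continuous_fst.mul continuous_snd))
      (continuous_fst.mul ((N.continuous_smul c).comp continuous_snd))) fun x y => by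
    simp only [smul_eq_mul, ← N.coe_smul, ← N.coe_mul, mul_smul_comm]

instance [StarModule ℂ X] : StarModule ℂ N.Completion where
  star_smul c := N.induction₁ (isClosed_eq (continuous_star.comp (N.continuous_smul c))
      ((N.continuous_smul (star c)).comp continuous_star)) fun x => by
    simp only [← N.coe_smul, ← N.coe_star, star_smul]

variable [IsScalarTower ℂ X X] [SMulCommClass ℂ X X] [StarModule ℂ X]

/-- The completion of a complex *-algebra with respect to a C*-seminorm is a C*-algebra. -/
noncomputable instance : NonUnitalCStarAlgebra N.Completion where

/-- The canonical *-homomorphism from `X` into its completion. -/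
noncomputable def toCompletion : X →⋆ₙₐ[ℂ] N.Completion where
  toFun := N.coe
  map_smul' := N.coe_smul
  map_zero' := N.coe_zero
  map_add' := N.coe_add
  map_mul' := N.coe_mul
  map_star' := N.coe_star

/-- A *-homomorphism into a C*-algebra that is dominated by the C*-seminorm `N` factors uniquely
through the completion. -/
theorem existsUnique_lift {B : Type*} [NonUnitalCStarAlgebra B] (ρ : X →⋆ₙₐ[ℂ] B)
    (hρ : ∀ x, ‖ρ x‖ ≤ N x) :
    ∃! φ : N.Completion →⋆ₙₐ[ℂ] B, ∀ x, φ (N.toCompletion x) = ρ x := by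
  have hu : UniformContinuous (fun x : N.Space => ρ x) := by
    refine LipschitzWith.uniformContinuous (K := 1) (LipschitzWith.of_dist_le_mul fun x y => ?_)
    rw [dist_eq_norm, dist_eq_norm, NNReal.coe_one, one_mul]
    exact (congrArg norm (map_sub ρ x y)).symm.trans_le (hρ _)
  let f : N.Completion → B := UniformSpace.Completion.extension (fun x : N.Space => ρ x)
  have hf : ∀ x, f (N.coe x) = ρ x := fun x => UniformSpace.Completion.extension_coe hu x
  have hc : Continuous f := UniformSpace.Completion.continuous_extension
  refine ⟨⟨⟨⟨⟨f, fun c => ?_⟩, ?_, ?_⟩, ?_⟩, ?_⟩, hf, fun ψ hψ => ?_⟩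
  · exact N.induction₁ (isClosed_eq (hc.comp (N.continuous_smul c)) (hc.const_smul c)) fun x => by
      simp [← N.coe_smul, hf]
  · change f 0 = 0
    rw [← N.coe_zero, hf, _root_.map_zero]
  · exact N.induction₂ (isClosed_eq (by fun_prop) (by fun_prop)) fun x y => by
      simp [← N.coe_add, hf]
  · exact N.induction₂ (isClosed_eq (by fun_prop) (by fun_prop)) fun x y => by
      simp [← N.coe_mul, hf]
  · exact N.induction₁ (isClosed_eq (by fun_prop) (by fun_prop)) fun x => by
      simpa [← N.coe_star, hf] using map_star ρ x
  · refine NonUnitalStarAlgHom.ext fun a => ?_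
    have hψc : Continuous ψ :=
      AddMonoidHomClass.continuous_of_bound ψ 1 fun a => by
        simpa using NonUnitalStarAlgHom.norm_apply_le ψ a
    exact N.induction₁ (p := fun a => ψ a = f a) (isClosed_eq hψc hc)
      (fun x => (hψ x).trans (hf x).symm) a

end Completion

section Maximal

variable {X : Type*} [NonUnitalRing X] [StarRing X] [Module ℂ X]

/-- The largest C*-seminorm on `X`, when the C*-seminorms are pointwise bounded. -/
noncomputable def maximal (h : ∀ x : X, BddAbove (Set.range fun N : CStarSeminorm X => N x)) :
    CStarSeminorm X :=
  have hle : ∀ (N : CStarSeminorm X) (x : X), N x ≤ ⨆ N : CStarSeminorm X, N x :=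
    fun N x => le_ciSup (h x) N
  have h0 : ∀ x : X, 0 ≤ ⨆ N : CStarSeminorm X, N x :=
    fun x => Real.iSup_nonneg fun N => N.nonneg x
  { toFun := fun x => ⨆ N : CStarSeminorm X, N x
    map_zero' := by simp only [CStarSeminorm.map_zero, ciSup_const]
    add_le' := fun x y => ciSup_le fun N =>
      (N.add_le x y).trans (add_le_add (hle N x) (hle N y))
    neg' := fun x => by simp only [CStarSeminorm.map_neg]
    smul' := fun c x => by
      simp only [CStarSeminorm.smul_eq]
      exact (Real.mul_iSup_of_nonneg (norm_nonneg c) _).symm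
    mul_le' := fun x y => ciSup_le fun N =>
      (N.mul_le x y).trans (mul_le_mul (hle N x) (hle N y) (N.nonneg y) (h0 x))
    star_mul_self' := fun x => by
      refine le_antisymm (ciSup_le fun N => ?_) ?_
      · rw [N.star_mul_self]
        exact mul_le_mul (hle N x) (hle N x) (N.nonneg x) (h0 x)
      · have hs : (⨆ N : CStarSeminorm X, N x) ≤
            Real.sqrt (⨆ N : CStarSeminorm X, N (star x * x)) :=
          ciSup_le fun N => Real.le_sqrt_of_sq_le (by
            rw [sq, ← N.star_mul_self]; exact hle N _)
        calc (⨆ N : CStarSeminorm X, N x) * (⨆ N : CStarSeminorm X, N x)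
            ≤ Real.sqrt (⨆ N : CStarSeminorm X, N (star x * x)) *
              Real.sqrt (⨆ N : CStarSeminorm X, N (star x * x)) :=
                mul_le_mul hs hs (h0 x) (Real.sqrt_nonneg _)
          _ = _ := Real.mul_self_sqrt (h0 _) }

theorem le_maximal (h : ∀ x : X, BddAbove (Set.range fun N : CStarSeminorm X => N x))
    (N : CStarSeminorm X) (x : X) : N x ≤ maximal h x := le_ciSup (h x) N

end Maximal

end CStarSeminorm

/-! ### Semigraphs -/

/-- A subset `S` of a monoid with zero, regarded as a semimultiplicative set: the product of two
elements of `S` is defined iff it is nonzero, and then it lies in `S`. Together with the degree map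
`d` (of which only the values on `S` matter), `S` is a semigraph of rank `k` if `d` is additive
and has the unique factorisation property. -/
structure IsSemigraph {k M : Type*} [MonoidWithZero M] (S : Set M) (d : M → k →₀ ℕ) : Prop where
  zero_notMem : (0 : M) ∉ S
  mul_mem : ∀ x ∈ S, ∀ y ∈ S, x * y ≠ 0 → x * y ∈ S
  degree_mul : ∀ x ∈ S, ∀ y ∈ S, x * y ≠ 0 → d (x * y) = d x + d y
  factorisation : ∀ x ∈ S, ∀ n₁ n₂ : k →₀ ℕ, d x = n₁ + n₂ →
    ∃! p : M × M, p.1 ∈ S ∧ p.2 ∈ S ∧ p.1 * p.2 = x ∧ d p.1 = n₁ ∧ d p.2 = n₂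

/-- The set of minimal common extensions of `x` and `y` in the semigraph `S`. -/
def minCommonExt {k M : Type*} [MonoidWithZero M] (S : Set M) (d : M → k →₀ ℕ) (x y : M) :
    Set (M × M) :=
  {p | p.1 ∈ S ∧ p.2 ∈ S ∧ x * p.1 ≠ 0 ∧ y * p.2 ≠ 0 ∧ x * p.1 = y * p.2 ∧
    d (x * p.1) = d x ⊔ d y}

/-! ### The free *-algebra on the letters `P ∪ T` -/

section Free

variable {k X : Type*} (P T : Set X)

/-- The letters `a` and `a*` for `a` in the disjoint union of `P` and `T`; the boolean is `true`
for starred letters. -/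
abbrev StarLetter := (P ⊕ T) × Bool

/-- The nonempty formal words. -/
abbrev StarWord := FreeSemigroup (StarLetter P T)

/-- The free non-unital *-algebra: the complex vector space with basis the nonempty words. -/
abbrev FreeStarAlg := MonoidAlgebra ℂ (StarWord P T)

variable {P T}

/-- The formal adjoint of a word: reverse it, and exchange starred and unstarred letters. -/
def StarWord.adj (w : StarWord P T) : StarWord P T :=
  (FreeSemigroup.lift (fun l : StarLetter P T => MulOpposite.op (FreeSemigroup.of (l.1, !l.2)))
    w).unop

/-- The formal, conjugate linear adjoint on the free *-algebra. -/
noncomputable def FreeStarAlg.adj (f : FreeStarAlg P T) : FreeStarAlg P T :=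
  f.coeff.sum fun w c => MonoidAlgebra.single w.adj (star c)

/-- The self-adjoint two-sided ideal generated by a subset of the free *-algebra. -/
def FreeStarAlg.starIdeal (Y : Set (FreeStarAlg P T)) : Set (FreeStarAlg P T) :=
  {f | ∀ I : Submodule ℂ (FreeStarAlg P T), Y ⊆ I →
    (∀ a, ∀ b ∈ I, a * b ∈ I ∧ b * a ∈ I) → (∀ b ∈ I, FreeStarAlg.adj b ∈ I) → f ∈ I}

/-- The element of `X` which a letter stands for. -/
def StarLetter.val [Star X] (l : StarLetter P T) : X :=
  let a : X := Sum.elim Subtype.val Subtype.val l.1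
  if l.2 then star a else a

/-- The element of `X` which a word stands for. -/
def StarWord.val [Semigroup X] [Star X] : StarWord P T →ₙ* X := FreeSemigroup.lift StarLetter.val

/-- The canonical homomorphism from the free *-algebra to `X`. -/
noncomputable def FreeStarAlg.val [NonUnitalRing X] [Star X] [Module ℂ X] [IsScalarTower ℂ X X]
    [SMulCommClass ℂ X X] : FreeStarAlg P T →ₙₐ[ℂ] X :=
  MonoidAlgebra.liftMagma ℂ StarWord.val

variable [Zero X]

/-- The degree of a letter: `0` for `p` and `p*`, `d t` for `t` and `- d t` for `t*`. -/
noncomputable def StarLetter.degree (d : Unitization ℂ X → k →₀ ℕ) (l : StarLetter P T) :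
    k →₀ ℤ :=
  let n : k →₀ ℤ := Sum.elim (fun _ => 0)
    (fun t => Finsupp.mapRange.addMonoidHom (Nat.castAddMonoidHom ℤ) (d (t : X))) l.1
  if l.2 then -n else n

/-- The degree of a word: the sum of the degrees of its letters. -/
noncomputable def StarWord.degree (d : Unitization ℂ X → k →₀ ℕ) (w : StarWord P T) : k →₀ ℤ :=
  Multiplicative.toAdd
    (FreeSemigroup.lift (fun l : StarLetter P T => Multiplicative.ofAdd (l.degree d)) w)

/-- The fiber space: the union over `n` of the linear spans of the words of degree `n`. -/
def FreeStarAlg.fiberSpace (d : Unitization ℂ X → k →₀ ℕ) : Set (FreeStarAlg P T) :=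
  ⋃ n : k →₀ ℤ, (Submodule.span ℂ
    {f : FreeStarAlg P T | ∃ w : StarWord P T, w.degree d = n ∧ f = MonoidAlgebra.single w 1} :
      Set (FreeStarAlg P T))

end Free

/-! ### Semigraph algebras -/

/-- The set `T₁ = T ⊔ {1}`, where `1` is the unit of the unitization of `X`. -/
def withUnit {X : Type*} [Zero X] (T : Set X) : Set (Unitization ℂ X) :=
  insert 1 (Unitization.inr '' T)

/-- The structure of a `k`-semigraph algebra on the complex *-algebra `X`. -/
structure SemigraphAlgebra (k X : Type*) [NonUnitalRing X] [StarRing X] [Module ℂ X]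
    [IsScalarTower ℂ X X] [SMulCommClass ℂ X X] [StarModule ℂ X] where
  /-- The set of generating projections. -/
  P : Set X
  /-- The set of generating partial isometries. -/
  T : Set X
  /-- The degree map on `T₁`; values outside of `T₁` are irrelevant. -/
  d : Unitization ℂ X → k →₀ ℕ
  disjoint : Disjoint P T
  generates : NonUnitalStarAlgebra.adjoin ℂ (P ∪ T) = ⊤
  P_proj : ∀ p ∈ P, p * p = p ∧ star p = p
  P_comm : ∀ p ∈ P, ∀ q ∈ P, p * q = q * p
  P_mul : ∀ p ∈ P, ∀ q ∈ P, p * q ∈ P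
  T_ne_zero : ∀ t ∈ T, t ≠ 0
  T_partialIsometry : ∀ t ∈ T, t * star t * t = t
  T_mul : ∀ s ∈ T, ∀ t ∈ T, s * t ≠ 0 → s * t ∈ T
  /-- `T` is a non-unital semigraph, that is, `T₁` is a semigraph. -/
  semigraph : IsSemigraph (withUnit T) d
  finitelyAligned : ∀ x ∈ withUnit T, ∀ y ∈ withUnit T, (minCommonExt (withUnit T) d x y).Finite
  skip : ∀ x ∈ T, ∀ p ∈ P, ∃ q ∈ P, p * x = x * q
  expansion : ∀ (x : Unitization ℂ X) (hx : x ∈ withUnit T) (y : Unitization ℂ X)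
    (hy : y ∈ withUnit T), x ≠ 1 → y ≠ 1 →
    ∃ q : Unitization ℂ X × Unitization ℂ X → X,
      (∀ a ∈ minCommonExt (withUnit T) d x y, q a ∈ P) ∧
      star x * y = ∑ a ∈ (finitelyAligned x hx y hy).toFinset,
        a.1 * (q a : Unitization ℂ X) * star a.2
  /-- The kernel of the canonical epimorphism from the free *-algebra is generated, as a
  self-adjoint two-sided ideal, by a subset of the fiber space. -/
  relations : ∃ Y : Set (FreeStarAlg P T), Y ⊆ FreeStarAlg.fiberSpace d ∧
    ∀ f : FreeStarAlg P T, FreeStarAlg.val f = 0 ↔ f ∈ FreeStarAlg.starIdeal Y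

namespace SemigraphAlgebra

variable {k X : Type*} [NonUnitalRing X] [StarRing X] [Module ℂ X] [IsScalarTower ℂ X X]
  [SMulCommClass ℂ X X] [StarModule ℂ X] (A : SemigraphAlgebra k X)

/-- `T₁ = T ⊔ {1}`. -/
def T₁ : Set (Unitization ℂ X) := withUnit A.T

/-- The standard words `s p t*` with `s, t ∈ T₁` and `p ∈ P`. -/
def IsStandardWord (w : X) : Prop :=
  ∃ s ∈ A.T₁, ∃ p ∈ A.P, ∃ t ∈ A.T₁, (w : Unitization ℂ X) = s * (p : Unitization ℂ X) * star t

/-- The half-standard words `s p` with `s ∈ T₁` and `p ∈ P`. -/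
def IsHalfStandardWord (w : X) : Prop :=
  ∃ s ∈ A.T₁, ∃ p ∈ A.P, (w : Unitization ℂ X) = s * (p : Unitization ℂ X)

/-- The standard projections `x x* (1 - y₁ y₁*) ⋯ (1 - yₘ yₘ*)`, where `x, y₁, …, yₘ` are
half-standard words and `m ≥ 0`. -/
def IsStandardProjection (p : X) : Prop :=
  ∃ x : X, A.IsHalfStandardWord x ∧ ∃ L : List X, (∀ y ∈ L, A.IsHalfStandardWord y) ∧
    (p : Unitization ℂ X) = ((x * star x : X) : Unitization ℂ X) *
      (L.map fun y => 1 - ((y * star y : X) : Unitization ℂ X)).prod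

/-- The element `w` of `X` is a nonzero word of degree `n`. -/
def HasDegree (w : X) (n : k →₀ ℤ) : Prop :=
  w ≠ 0 ∧ ∃ u : StarWord A.P A.T, u.val = w ∧ u.degree A.d = n

/-- The core: the linear span of all words of degree zero. -/
def core : Submodule ℂ X :=
  Submodule.span ℂ {w | ∃ u : StarWord A.P A.T, u.val = w ∧ u.degree A.d = 0}

/-- A semigraph algebra is cancelling if for every standard word `w` of nonzero degree and every
nonzero standard projection `p` there is a nonzero standard projection `q ≤ p` with `q w q = 0`. -/
def IsCancelling : Prop :=
  ∀ w : X, A.IsStandardWord w → ∀ n : k →₀ ℤ, A.HasDegree w n → n ≠ 0 →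
    ∀ p : X, A.IsStandardProjection p → p ≠ 0 →
      ∃ q : X, A.IsStandardProjection q ∧ q ≠ 0 ∧ (q * p = q ∧ p * q = q) ∧ q * w * q = 0

theorem bddAbove_cstarSeminorm (A : SemigraphAlgebra k X) (x : X) :
    BddAbove (Set.range fun N : CStarSeminorm X => N x) := by
  suffices h : ∃ C : ℝ, ∀ N : CStarSeminorm X, N x ≤ C by
    obtain ⟨C, hC⟩ := h
    exact ⟨C, by rintro _ ⟨N, rfl⟩; exact hC N⟩
  have h1 : ∀ t : X, t * star t * t = t → ∀ N : CStarSeminorm X, N t ≤ 1 := by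
    intro t ht N
    have h3 : N (star t * t) * N (star t * t) = N (star t * t) := by
      rw [← N.star_mul_self, star_mul, star_star, mul_assoc, ← mul_assoc t, ht]
    rw [N.star_mul_self] at h3
    have h4 := N.nonneg t
    by_contra hlt
    push Not at hlt
    have h5 : 1 < N t * N t := one_lt_mul_of_lt_of_le hlt hlt.le
    nlinarith
  have hx : x ∈ NonUnitalStarAlgebra.adjoin ℂ (A.P ∪ A.T) := by
    rw [A.generates]; trivial
  induction hx using NonUnitalStarAlgebra.adjoin_induction with
  | mem y hy =>
    refine ⟨1, h1 y ?_⟩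
    rcases hy with hy | hy
    · rw [(A.P_proj y hy).2, (A.P_proj y hy).1, (A.P_proj y hy).1]
    · exact A.T_partialIsometry y hy
  | add y z _ _ hy hz =>
    obtain ⟨C, hC⟩ := hy
    obtain ⟨D, hD⟩ := hz
    exact ⟨C + D, fun N => (N.add_le y z).trans (add_le_add (hC N) (hD N))⟩
  | zero => exact ⟨0, fun N => N.map_zero.le⟩
  | mul y z _ _ hy hz =>
    obtain ⟨C, hC⟩ := hy
    obtain ⟨D, hD⟩ := hz
    exact ⟨C * D, fun N => (N.mul_le y z).trans
      (mul_le_mul (hC N) (hD N) (N.nonneg z) ((N.nonneg y).trans (hC N)))⟩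
  | smul c y _ hy =>
    obtain ⟨C, hC⟩ := hy
    exact ⟨‖c‖ * C, fun N => (N.smul_eq c y).trans_le
      (mul_le_mul_of_nonneg_left (hC N) (norm_nonneg c))⟩
  | star y _ hy =>
    obtain ⟨C, hC⟩ := hy
    exact ⟨C, fun N => (N.star_eq y).trans_le (hC N)⟩

/-- The largest C*-seminorm on a semigraph algebra. -/
noncomputable def universalSeminorm : CStarSeminorm X :=
  CStarSeminorm.maximal A.bddAbove_cstarSeminorm

/-- The enveloping C*-algebra of a semigraph algebra. -/
abbrev CStar : Type _ := A.universalSeminorm.Completion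

/-- The universal representation of a semigraph algebra in its enveloping C*-algebra. -/
noncomputable def universalRep : X →⋆ₙₐ[ℂ] A.CStar := A.universalSeminorm.toCompletion

/-- The universal property of the enveloping C*-algebra. -/
theorem universal {B : Type*} [NonUnitalCStarAlgebra B] (ρ : X →⋆ₙₐ[ℂ] B) :
    ∃! φ : A.CStar →⋆ₙₐ[ℂ] B, ∀ x, φ (A.universalRep x) = ρ x :=
  A.universalSeminorm.existsUnique_lift ρ fun x =>
    CStarSeminorm.le_maximal A.bddAbove_cstarSeminorm (CStarSeminorm.ofHom ρ) x

end SemigraphAlgebra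

/-! The theorem follows from one comparison of seminorms. A seminorm `filterSeminorm` is built from
the combinatorics of standard projections. It dominates every C*-seminorm on X
(`le_filterSeminorm`). If X is cancelling, it is also dominated by every C*-seminorm that vanishes
on no nonzero standard projection (`IsCancelling.filterSeminorm_le`). Hence every admissible ρ is
isometric for the universal seminorm, so its extension to C*(X) is isometric with dense range, thus
an isomorphism. Injectivity on the core holds because `filterSeminorm` is a norm on homogeneous
elements.

Grading and diagonal. Since the relations are generated by homogeneous ones, X is graded by ℤ^k
(`dec`, `gr`), and each component is spanned by standard words (`gr_le_stdWords`). The projections s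
p s* commute and generate a commutative algebra `diagAlg`; its prime ideals give filters of standard
projections (`StdFilter`), which act as points of a spectrum. If each filter has a member q with y q
= 0, then y = 0 (`eq_zero_of_forall_stdFilter`).

The seminorm. Along a filter a homogeneous x has the form x q = (∑ λ_u u) s* q with all u of one
degree (`exists_presents`). Distinct elements of T₁ of equal degree have orthogonal ranges, so q x q
is a multiple of q for x of degree zero, and q x* x q = (∑ |λ_u|²) q for every homogeneous x. This
scalar, extended by zero to nonzero degrees, is a positive functional. Its GNS seminorm does not
increase on passing to components, and `filterSeminorm` is the supremum over all filters.

Upper bound. A core element lies in a finite-dimensional subalgebra of the core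
(`exists_finiteDimensional_of_mem_core`), where any two seminorms compare up to a constant, provided
the dominating one is a norm. The constant disappears on taking 2^m-th roots of N(h^(2^m)) =
N(h)^(2^m) for selfadjoint h. For general elements the number of degrees occurring in h^(2^m) grows
only polynomially in 2^m, so the same trick applies.

Lower bound. Cancellation supplies, below any member of a filter, a nonzero standard projection p
that cuts off all components of nonzero degree. Then p z* z p is the value of the functional times
p, so the GNS norm of z equals M(z p) and is controlled by M. -/

set_option linter.unusedSectionVars false

open Unitization

namespace SemigraphAlgebra

variable {k X : Type*} [NonUnitalRing X] [StarRing X] [Module ℂ X] [IsScalarTower ℂ X X]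
  [SMulCommClass ℂ X X] [StarModule ℂ X] (A : SemigraphAlgebra k X)

/-! ### Relations between the generators -/

/-- The generating projections, viewed in the unitization. -/
def Pinr : Set (Unitization ℂ X) := Unitization.inr '' A.P

/-- The generating projections together with the unit. -/
def P₁ : Set (Unitization ℂ X) := insert 1 A.Pinr

variable {A}

theorem one_mem_T₁ : (1 : Unitization ℂ X) ∈ A.T₁ := Set.mem_insert _ _

theorem one_mem_P₁ : (1 : Unitization ℂ X) ∈ A.P₁ := Set.mem_insert _ _

theorem Pinr_subset_P₁ {p : Unitization ℂ X} (hp : p ∈ A.Pinr) : p ∈ A.P₁ :=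
  Set.mem_insert_of_mem _ hp

theorem inr_mem_T₁ {t : X} (ht : t ∈ A.T) : (t : Unitization ℂ X) ∈ A.T₁ :=
  Set.mem_insert_of_mem _ ⟨t, ht, rfl⟩

theorem inr_mem_Pinr {p : X} (hp : p ∈ A.P) : (p : Unitization ℂ X) ∈ A.Pinr := ⟨p, hp, rfl⟩

theorem mem_T₁_iff {x : Unitization ℂ X} :
    x ∈ A.T₁ ↔ x = 1 ∨ ∃ t ∈ A.T, (t : Unitization ℂ X) = x := Iff.rfl

theorem inr_ne_one (x : X) : (x : Unitization ℂ X) ≠ 1 := fun h => by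
  simpa using congrArg (fun y : Unitization ℂ X => y.fst) h

theorem ne_zero_of_mem_T₁ {x : Unitization ℂ X} (hx : x ∈ A.T₁) : x ≠ 0 := fun h =>
  A.semigraph.zero_notMem (h ▸ hx)

theorem mul_mem_T₁ {x y : Unitization ℂ X} (hx : x ∈ A.T₁) (hy : y ∈ A.T₁) (h : x * y ≠ 0) :
    x * y ∈ A.T₁ := A.semigraph.mul_mem x hx y hy h

theorem d_mul {x y : Unitization ℂ X} (hx : x ∈ A.T₁) (hy : y ∈ A.T₁) (h : x * y ≠ 0) :
    A.d (x * y) = A.d x + A.d y := A.semigraph.degree_mul x hx y hy h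

theorem d_one : A.d 1 = 0 := by
  have h := d_mul (A := A) one_mem_T₁ one_mem_T₁ (by simp)
  simpa using h

theorem factor_unique {a b a' b' : Unitization ℂ X} (ha : a ∈ A.T₁) (hb : b ∈ A.T₁)
    (ha' : a' ∈ A.T₁) (hb' : b' ∈ A.T₁) (h0 : a * b ≠ 0) (h : a * b = a' * b')
    (hd : A.d a = A.d a') : a = a' ∧ b = b' := by
  have h1 := d_mul ha hb h0
  have h2 := d_mul ha' hb' (h ▸ h0)
  have hd' : A.d b' = A.d b := by
    rw [← h, h1, hd] at h2
    exact (add_left_cancel h2).symm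
  obtain ⟨p, -, hp⟩ := A.semigraph.factorisation (a * b) (mul_mem_T₁ ha hb h0) _ _ h1
  have e1 := hp (a, b) ⟨ha, hb, rfl, rfl, rfl⟩
  have e2 := hp (a', b') ⟨ha', hb', h.symm, hd.symm, hd'⟩
  have := e1.trans e2.symm
  exact ⟨congrArg Prod.fst this, congrArg Prod.snd this⟩

theorem mul_left_cancel_T₁ {a b c : Unitization ℂ X} (ha : a ∈ A.T₁) (hb : b ∈ A.T₁)
    (hc : c ∈ A.T₁) (h0 : a * b ≠ 0) (h : a * b = a * c) : b = c :=
  (factor_unique ha hb ha hc h0 h rfl).2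

/-- Both `a * 1` and `1 * a` factor a with a first factor of degree zero, so uniqueness of
factorisation identifies them. -/
theorem eq_one_of_d_eq_zero {a : Unitization ℂ X} (ha : a ∈ A.T₁) (hd : A.d a = 0) : a = 1 :=
  (factor_unique ha one_mem_T₁ one_mem_T₁ ha (by simpa using ne_zero_of_mem_T₁ ha) (by simp)
    (by rw [hd, d_one])).1

variable (A) in
/-- The minimal common extensions in `T₁`. -/
abbrev ext (x y : Unitization ℂ X) : Set (Unitization ℂ X × Unitization ℂ X) :=
  minCommonExt (withUnit A.T) A.d x y

theorem ext_fst_mem {x y : Unitization ℂ X} {a : Unitization ℂ X × Unitization ℂ X}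
    (h : a ∈ A.ext x y) : a.1 ∈ A.T₁ := h.1

theorem ext_snd_mem {x y : Unitization ℂ X} {a : Unitization ℂ X × Unitization ℂ X}
    (h : a ∈ A.ext x y) : a.2 ∈ A.T₁ := h.2.1

theorem ext_ne_zero {x y : Unitization ℂ X} {a : Unitization ℂ X × Unitization ℂ X}
    (h : a ∈ A.ext x y) : x * a.1 ≠ 0 := h.2.2.1

theorem ext_eq {x y : Unitization ℂ X} {a : Unitization ℂ X × Unitization ℂ X}
    (h : a ∈ A.ext x y) : x * a.1 = y * a.2 := h.2.2.2.2.1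

theorem ext_d {x y : Unitization ℂ X} {a : Unitization ℂ X × Unitization ℂ X}
    (h : a ∈ A.ext x y) : A.d (x * a.1) = A.d x ⊔ A.d y := h.2.2.2.2.2

theorem ext_mul_mem {x y : Unitization ℂ X} (hx : x ∈ A.T₁)
    {a : Unitization ℂ X × Unitization ℂ X} (h : a ∈ A.ext x y) : x * a.1 ∈ A.T₁ :=
  mul_mem_T₁ hx h.1 h.2.2.1

theorem ext_of_d_eq {x y : Unitization ℂ X} (hx : x ∈ A.T₁) (hy : y ∈ A.T₁)
    (hd : A.d x = A.d y) {a : Unitization ℂ X × Unitization ℂ X} (h : a ∈ A.ext x y) :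
    a = (1, 1) ∧ x = y := by
  have h1 := ext_d h
  have h2 := ext_d h
  rw [d_mul hx h.1 (ext_ne_zero h), ← hd, sup_idem] at h1
  rw [ext_eq h, d_mul hy h.2.1 h.2.2.2.1, ← hd, sup_idem] at h2
  have e1 := eq_one_of_d_eq_zero h.1 (by simpa using h1)
  have e2 := eq_one_of_d_eq_zero h.2.1 (by simpa using h2)
  have e3 := ext_eq h
  rw [e1, e2, mul_one, mul_one] at e3
  exact ⟨Prod.ext e1 e2, e3⟩

theorem P₁_idem {p : Unitization ℂ X} (hp : p ∈ A.P₁) : p * p = p := by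
  rcases hp with rfl | ⟨p, hp, rfl⟩
  · simp
  · rw [← inr_mul, (A.P_proj p hp).1]

theorem P₁_star {p : Unitization ℂ X} (hp : p ∈ A.P₁) : star p = p := by
  rcases hp with rfl | ⟨p, hp, rfl⟩
  · simp
  · rw [← inr_star, (A.P_proj p hp).2]

theorem P₁_comm {p q : Unitization ℂ X} (hp : p ∈ A.P₁) (hq : q ∈ A.P₁) : p * q = q * p := by
  rcases hp with rfl | ⟨p, hp, rfl⟩
  · simp
  rcases hq with rfl | ⟨q, hq, rfl⟩
  · simp
  rw [← inr_mul, A.P_comm p hp q hq, inr_mul]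

theorem Pinr_mul {p q : Unitization ℂ X} (hp : p ∈ A.Pinr) (hq : q ∈ A.P₁) : p * q ∈ A.Pinr := by
  rcases hq with rfl | ⟨q, hq, rfl⟩
  · simpa using hp
  obtain ⟨p, hp, rfl⟩ := hp
  exact ⟨p * q, A.P_mul p hp q hq, inr_mul _ _ _⟩

theorem P₁_mul {p q : Unitization ℂ X} (hp : p ∈ A.P₁) (hq : q ∈ A.P₁) : p * q ∈ A.P₁ := by
  rcases hp with rfl | hp
  · simpa using hq
  · exact Pinr_subset_P₁ (Pinr_mul hp hq)

theorem skip₁ {x p : Unitization ℂ X} (hx : x ∈ A.T₁) (hp : p ∈ A.P₁) :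
    ∃ q ∈ A.P₁, (p ∈ A.Pinr → q ∈ A.Pinr) ∧ p * x = x * q := by
  rcases mem_T₁_iff.1 hx with rfl | ⟨x, hx', rfl⟩
  · exact ⟨p, hp, id, by simp⟩
  rcases hp with rfl | ⟨p, hp, rfl⟩
  · exact ⟨1, one_mem_P₁, id, by simp⟩
  obtain ⟨q, hq, h⟩ := A.skip x hx' p hp
  exact ⟨q, Pinr_subset_P₁ (inr_mem_Pinr hq), fun _ => inr_mem_Pinr hq,
    by rw [← inr_mul, h, inr_mul]⟩

theorem T₁_isometry {x : Unitization ℂ X} (hx : x ∈ A.T₁) : x * star x * x = x := by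
  rcases mem_T₁_iff.1 hx with rfl | ⟨x, hx', rfl⟩
  · simp
  · rw [← inr_star, ← inr_mul, ← inr_mul, A.T_partialIsometry x hx']

/-- The finite set of minimal common extensions. -/
noncomputable def extFinset {x y : Unitization ℂ X} (hx : x ∈ A.T₁) (hy : y ∈ A.T₁) :
    Finset (Unitization ℂ X × Unitization ℂ X) :=
  (A.finitelyAligned x hx y hy).toFinset

theorem mem_extFinset {x y : Unitization ℂ X} {hx : x ∈ A.T₁} {hy : y ∈ A.T₁}
    {a : Unitization ℂ X × Unitization ℂ X} : a ∈ extFinset hx hy ↔ a ∈ A.ext x y := by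
  simp [extFinset]

theorem extFinset_one_left {y : Unitization ℂ X} (hy : y ∈ A.T₁) :
    extFinset (A := A) one_mem_T₁ hy = {(y, 1)} := by
  ext a
  rw [mem_extFinset, Finset.mem_singleton]
  constructor
  · intro h
    have h1 := ext_eq h
    have h2 := ext_d h
    rw [ext_eq h, d_mul hy h.2.1 h.2.2.2.1, d_one] at h2
    have h3 : a.2 = 1 := eq_one_of_d_eq_zero h.2.1 (by simpa using h2)
    rw [h3, one_mul, mul_one] at h1
    exact Prod.ext h1 h3
  · rintro rfl
    refine ⟨hy, one_mem_T₁, ?_, ?_, by simp, ?_⟩ <;> simp [ne_zero_of_mem_T₁ hy, d_one]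

theorem extFinset_one_right {x : Unitization ℂ X} (hx : x ∈ A.T₁) :
    extFinset (A := A) hx one_mem_T₁ = {(1, x)} := by
  ext a
  rw [mem_extFinset, Finset.mem_singleton]
  constructor
  · intro h
    have h1 := ext_eq h
    have h2 := ext_d h
    rw [d_mul hx h.1 (ext_ne_zero h), d_one] at h2
    have h3 : a.1 = 1 := eq_one_of_d_eq_zero h.1 (by simpa using h2)
    rw [h3, one_mul, mul_one] at h1
    exact Prod.ext h3 h1.symm
  · rintro rfl
    refine ⟨one_mem_T₁, hx, ?_, ?_, by simp, ?_⟩ <;> simp [ne_zero_of_mem_T₁ hx, d_one]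

/-- If x or y is 1 there is exactly one minimal common extension, and the coefficient 1 serves; this
is why the coefficients range over `P₁` and not over the generating projections alone. -/
theorem expansion₁ {x y : Unitization ℂ X} (hx : x ∈ A.T₁) (hy : y ∈ A.T₁) :
    ∃ q : Unitization ℂ X × Unitization ℂ X → Unitization ℂ X,
      (∀ a ∈ extFinset hx hy, q a ∈ A.P₁) ∧
      star x * y = ∑ a ∈ extFinset hx hy, a.1 * q a * star a.2 := by
  by_cases h1 : x = 1
  · subst h1
    exact ⟨fun _ => 1, fun _ _ => one_mem_P₁, by rw [extFinset_one_left]; simp⟩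
  by_cases h2 : y = 1
  · subst h2
    exact ⟨fun _ => 1, fun _ _ => one_mem_P₁, by rw [extFinset_one_right]; simp⟩
  obtain ⟨q, hq, h⟩ := A.expansion x hx y hy h1 h2
  exact ⟨fun a => q a, fun a ha => Pinr_subset_P₁ (inr_mem_Pinr (hq a (mem_extFinset.1 ha))), h⟩

/-- The only minimal common extension of x with itself is (1, 1), so the expansion of x* x reduces
to one coefficient, which is a generating projection. -/
theorem star_mul_self_mem {x : Unitization ℂ X} (hx : x ∈ A.T₁) (h1 : x ≠ 1) :
    star x * x ∈ A.Pinr := by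
  have he : extFinset hx hx = {(1, 1)} := by
    ext a
    rw [mem_extFinset, Finset.mem_singleton]
    constructor
    · exact fun h => (ext_of_d_eq hx hx rfl h).1
    · rintro rfl
      refine ⟨one_mem_T₁, one_mem_T₁, ?_, ?_, by simp, ?_⟩ <;> simp [ne_zero_of_mem_T₁ hx]
  obtain ⟨q, hq, h⟩ := A.expansion x hx x hx h1 h1
  change star x * x = ∑ a ∈ extFinset hx hx, _ at h
  rw [he, Finset.sum_singleton] at h
  rw [h]
  exact ⟨q (1, 1), hq _ (mem_extFinset.1 (by rw [he]; simp) : (1, 1) ∈ A.ext x x), by simp⟩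

theorem star_mul_self_mem_P₁ {x : Unitization ℂ X} (hx : x ∈ A.T₁) : star x * x ∈ A.P₁ := by
  by_cases h1 : x = 1
  · subst h1; simpa using one_mem_P₁
  · exact Pinr_subset_P₁ (star_mul_self_mem hx h1)

/-- Distinct elements of equal degree have no minimal common extension, so the expansion is an empty
sum. This orthogonality underlies all later norm computations. -/
theorem star_mul_eq_zero {x y : Unitization ℂ X} (hx : x ∈ A.T₁) (hy : y ∈ A.T₁)
    (hd : A.d x = A.d y) (h : x ≠ y) : star x * y = 0 := by
  obtain ⟨q, -, he⟩ := expansion₁ hx hy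
  rw [he]
  exact Finset.sum_eq_zero fun a ha => absurd (ext_of_d_eq hx hy hd (mem_extFinset.1 ha)).2 h

theorem skip_star {x p : Unitization ℂ X} (hx : x ∈ A.T₁) (hp : p ∈ A.P₁) :
    ∃ q ∈ A.P₁, (p ∈ A.Pinr → q ∈ A.Pinr) ∧ p * x = x * q ∧ star x * p = q * star x := by
  obtain ⟨q, hq, h1, h2⟩ := skip₁ hx hp
  refine ⟨q, hq, h1, h2, ?_⟩
  have := congrArg star h2
  rwa [star_mul, star_mul, P₁_star hp, P₁_star hq] at this

/-! ### The diagonal projections `s p s*` -/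

variable (A) in
/-- The projections `s p s*` with `s ∈ T₁`, `p ∈ P ∪ {1}`. -/
def diag : Set (Unitization ℂ X) := {e | ∃ s ∈ A.T₁, ∃ p ∈ A.P₁, e = s * p * star s}

variable (A) in
/-- The projections `s p s*` with `s ∈ T₁`, `p ∈ P`. -/
def properDiag : Set (Unitization ℂ X) := {e | ∃ s ∈ A.T₁, ∃ p ∈ A.Pinr, e = s * p * star s}

theorem properDiag_subset {e : Unitization ℂ X} (he : e ∈ A.properDiag) : e ∈ A.diag := by
  obtain ⟨s, hs, p, hp, rfl⟩ := he
  exact ⟨s, hs, p, Pinr_subset_P₁ hp, rfl⟩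

/-- Apart from s = 1, the range projection s s* equals s (s* s) s* with s* s among the generating
projections, so the unit is the only diagonal projection outside X. -/
theorem mem_diag_iff {e : Unitization ℂ X} : e ∈ A.diag ↔ e = 1 ∨ e ∈ A.properDiag := by
  constructor
  · rintro ⟨s, hs, p, hp, rfl⟩
    rcases hp with rfl | hp
    · by_cases h1 : s = 1
      · subst h1; simp
      · exact Or.inr ⟨s, hs, star s * s, star_mul_self_mem hs h1, by
          rw [← mul_assoc, T₁_isometry hs, mul_one]⟩
    · exact Or.inr ⟨s, hs, p, hp, rfl⟩
  · rintro (rfl | he)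
    · exact ⟨1, one_mem_T₁, 1, one_mem_P₁, by simp⟩
    · exact properDiag_subset he

theorem mul_star_mem_diag {s : Unitization ℂ X} (hs : s ∈ A.T₁) : s * star s ∈ A.diag :=
  ⟨s, hs, 1, one_mem_P₁, by simp⟩

theorem diag_star {e : Unitization ℂ X} (he : e ∈ A.diag) : star e = e := by
  obtain ⟨s, hs, p, hp, rfl⟩ := he
  simp [P₁_star hp, mul_assoc]

/-- Expand s* t into terms α c β* and move p past α and q past β*. Since s α = t β, each term is
again a diagonal projection, with base s α. -/
theorem diag_mul_expand {s t p q : Unitization ℂ X} (hs : s ∈ A.T₁) (ht : t ∈ A.T₁)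
    (hp : p ∈ A.P₁) (hq : q ∈ A.P₁) : ∃ r : Unitization ℂ X × Unitization ℂ X → Unitization ℂ X,
      (∀ a ∈ extFinset hs ht, r a ∈ A.P₁ ∧ (p ∈ A.Pinr → r a ∈ A.Pinr)) ∧
      (s * p * star s) * (t * q * star t) =
        ∑ a ∈ extFinset hs ht, (s * a.1) * r a * star (s * a.1) := by
  obtain ⟨c, hc, h⟩ := expansion₁ hs ht
  have key : ∀ a ∈ extFinset hs ht, ∃ r ∈ A.P₁, (p ∈ A.Pinr → r ∈ A.Pinr) ∧
      s * p * (a.1 * c a * star a.2) * (q * star t) = (s * a.1) * r * star (s * a.1) := by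
    intro a ha
    have ha' := mem_extFinset.1 ha
    obtain ⟨p', hp', hpp, h1, -⟩ := skip_star (ext_fst_mem ha') hp
    obtain ⟨q', hq', -, -, h2⟩ := skip_star (ext_snd_mem ha') hq
    refine ⟨p' * (c a * q'), P₁_mul hp' (P₁_mul (hc a ha) hq'),
      fun h => Pinr_mul (hpp h) (P₁_mul (hc a ha) hq'), ?_⟩
    calc s * p * (a.1 * c a * star a.2) * (q * star t)
        = s * (p * a.1) * c a * (star a.2 * q) * star t := by simp only [mul_assoc]
      _ = s * (a.1 * p') * c a * (q' * star a.2) * star t := by rw [h1, h2]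
      _ = (s * a.1) * (p' * (c a * q')) * star (t * a.2) := by simp only [star_mul, mul_assoc]
      _ = _ := by rw [ext_eq ha']
  choose! r hr using key
  refine ⟨r, fun a ha => ⟨(hr a ha).1, (hr a ha).2.1⟩, ?_⟩
  calc (s * p * star s) * (t * q * star t)
      = s * p * (star s * t) * (q * star t) := by simp only [mul_assoc]
    _ = ∑ a ∈ extFinset hs ht, s * p * (a.1 * c a * star a.2) * (q * star t) := by
      rw [h, Finset.mul_sum, Finset.sum_mul]
    _ = _ := Finset.sum_congr rfl fun a ha => (hr a ha).2.2

/-- By the expansion, the product of two diagonal projections is a sum of selfadjoint elements;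
selfadjoint factors with selfadjoint product commute. -/
theorem diag_comm {e f : Unitization ℂ X} (he : e ∈ A.diag) (hf : f ∈ A.diag) :
    e * f = f * e := by
  have h : star (e * f) = e * f := by
    obtain ⟨s, hs, p, hp, rfl⟩ := he
    obtain ⟨t, ht, q, hq, rfl⟩ := hf
    obtain ⟨r, hr, h⟩ := diag_mul_expand hs ht hp hq
    rw [h, star_sum]
    exact Finset.sum_congr rfl fun a ha =>
      diag_star ⟨_, ext_mul_mem hs (mem_extFinset.1 ha), _, (hr a ha).1, rfl⟩
  rw [← h, star_mul, diag_star he, diag_star hf]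

theorem diag_idem {e : Unitization ℂ X} (he : e ∈ A.diag) : e * e = e := by
  obtain ⟨s, hs, p, hp, rfl⟩ := he
  calc s * p * star s * (s * p * star s) = s * (p * (star s * s)) * p * star s := by
        simp only [mul_assoc]
    _ = s * star s * s * (p * p) * star s := by
        rw [P₁_comm hp (star_mul_self_mem_P₁ hs)]; simp only [mul_assoc]
    _ = _ := by rw [T₁_isometry hs, P₁_idem hp]

/-- Multiplying diagonal projections, with orthogonal summands each below the product. -/
theorem diag_mul_decompose {e f : Unitization ℂ X} (he : e ∈ A.diag) (hf : f ∈ A.diag) :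
    ∃ G : Finset (Unitization ℂ X × Unitization ℂ X), ∃ g : Unitization ℂ X × Unitization ℂ X →
      Unitization ℂ X, (∀ a ∈ G, g a ∈ A.diag ∧ (e ∈ A.properDiag → g a ∈ A.properDiag)) ∧
      (∀ a ∈ G, g a * (e * f) = g a) ∧ e * f = ∑ a ∈ G, g a := by
  have main : ∀ s ∈ A.T₁, ∀ p ∈ A.P₁, ∀ t ∈ A.T₁, ∀ q ∈ A.P₁,
      ∃ G : Finset (Unitization ℂ X × Unitization ℂ X),
      ∃ g : Unitization ℂ X × Unitization ℂ X → Unitization ℂ X,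
      (∀ a ∈ G, g a ∈ A.diag ∧ (p ∈ A.Pinr → g a ∈ A.properDiag)) ∧
      (∀ a ∈ G, g a * ((s * p * star s) * (t * q * star t)) = g a) ∧
      (s * p * star s) * (t * q * star t) = ∑ a ∈ G, g a := by
    intro s hs p hp t ht q hq
    obtain ⟨r, hr, h⟩ := diag_mul_expand hs ht hp hq
    refine ⟨extFinset hs ht, fun a => (s * a.1) * r a * star (s * a.1), fun a ha =>
      ⟨⟨_, ext_mul_mem hs (mem_extFinset.1 ha), _, (hr a ha).1, rfl⟩, fun h =>
        ⟨_, ext_mul_mem hs (mem_extFinset.1 ha), _, (hr a ha).2 h, rfl⟩⟩, fun a ha => ?_, h⟩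
    have ha' := mem_extFinset.1 ha
    rw [h, Finset.mul_sum, Finset.sum_eq_single a]
    · exact diag_idem ⟨_, ext_mul_mem hs ha', _, (hr a ha).1, rfl⟩
    · intro b hb hba
      have hb' := mem_extFinset.1 hb
      -- All s α have degree d(s) ∨ d(t). If two of them coincided, left cancellation in sα = sα'
      -- and in tβ = tβ' would identify the pairs; so distinct summands have orthogonal ranges.
      have : star (s * a.1) * (s * b.1) = 0 := by
        refine star_mul_eq_zero (ext_mul_mem hs ha') (ext_mul_mem hs hb')
          (by rw [ext_d ha', ext_d hb']) fun hab => hba ?_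
        have h1 := mul_left_cancel_T₁ hs ha'.1 hb'.1 (ext_ne_zero ha') hab
        have h2 := mul_left_cancel_T₁ ht ha'.2.1 hb'.2.1 ha'.2.2.2.1
          (by rw [← ext_eq ha', ← ext_eq hb', hab])
        exact Prod.ext h1.symm h2.symm
      calc s * a.1 * r a * star (s * a.1) * (s * b.1 * r b * star (s * b.1))
          = s * a.1 * r a * (star (s * a.1) * (s * b.1)) * (r b * star (s * b.1)) := by
            simp only [mul_assoc]
        _ = 0 := by rw [this]; simp
    · exact fun h => absurd ha h
  obtain ⟨t, ht, q, hq, rfl⟩ := hf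
  by_cases hp : e ∈ A.properDiag
  · obtain ⟨s, hs, p, hp, rfl⟩ := hp
    obtain ⟨G, g, h1, h2, h3⟩ := main s hs p (Pinr_subset_P₁ hp) t ht q hq
    exact ⟨G, g, fun a ha => ⟨(h1 a ha).1, fun _ => (h1 a ha).2 hp⟩, h2, h3⟩
  · obtain ⟨s, hs, p, hp', rfl⟩ := he
    obtain ⟨G, g, h1, h2, h3⟩ := main s hs p hp' t ht q hq
    exact ⟨G, g, fun a ha => ⟨(h1 a ha).1, fun h => absurd h hp⟩, h2, h3⟩

end SemigraphAlgebra

/-! ### Values, adjoints and degrees of formal words. -/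

section FreeLemmas

variable {k X : Type*} {P T : Set X}

theorem StarLetter.val_adj [NonUnitalRing X] [StarRing X] (l : StarLetter P T) :
    StarLetter.val (l.1, !l.2) = star (StarLetter.val l) := by
  obtain ⟨a, b⟩ := l
  cases b <;> simp [StarLetter.val]

theorem StarWord.adj_of (l : StarLetter P T) :
    StarWord.adj (FreeSemigroup.of l) = FreeSemigroup.of (l.1, !l.2) := by
  simp [StarWord.adj]

theorem StarWord.adj_mul (u v : StarWord P T) :
    StarWord.adj (u * v) = StarWord.adj v * StarWord.adj u := by
  simp [StarWord.adj]

theorem StarWord.val_of [NonUnitalRing X] [StarRing X] (l : StarLetter P T) :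
    StarWord.val (FreeSemigroup.of l) = StarLetter.val l := by
  simp [StarWord.val]

theorem StarWord.val_adj [NonUnitalRing X] [StarRing X] (w : StarWord P T) :
    StarWord.val w.adj = star (StarWord.val w) := by
  induction w using FreeSemigroup.recOnMul with
  | ih1 l => rw [StarWord.adj_of, StarWord.val_of, StarWord.val_of, StarLetter.val_adj]
  | ih2 l w h1 h2 => rw [StarWord.adj_mul, map_mul, map_mul, star_mul, h1, h2]

theorem StarLetter.degree_inl [Zero X] (d : Unitization ℂ X → k →₀ ℕ) (p : P) (b : Bool) :
    StarLetter.degree d ((Sum.inl p, b) : StarLetter P T) = 0 := by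
  cases b
  · rfl
  · exact neg_zero

theorem StarLetter.degree_inr [Zero X] (d : Unitization ℂ X → k →₀ ℕ) (t : T) :
    StarLetter.degree d ((Sum.inr t, false) : StarLetter P T) =
      Finsupp.mapRange.addMonoidHom (Nat.castAddMonoidHom ℤ) (d (t : X)) := rfl

theorem StarLetter.degree_inr_star [Zero X] (d : Unitization ℂ X → k →₀ ℕ) (t : T) :
    StarLetter.degree d ((Sum.inr t, true) : StarLetter P T) =
      - Finsupp.mapRange.addMonoidHom (Nat.castAddMonoidHom ℤ) (d (t : X)) := rfl

theorem StarWord.degree_of [Zero X] (d : Unitization ℂ X → k →₀ ℕ) (l : StarLetter P T) :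
    StarWord.degree d (FreeSemigroup.of l) = l.degree d := by
  simp [StarWord.degree]

theorem StarWord.degree_mul [Zero X] (d : Unitization ℂ X → k →₀ ℕ) (u v : StarWord P T) :
    StarWord.degree d (u * v) = u.degree d + v.degree d := by
  simp [StarWord.degree]

theorem StarWord.degree_adj [Zero X] (d : Unitization ℂ X → k →₀ ℕ) (w : StarWord P T) :
    StarWord.degree d w.adj = - w.degree d := by
  induction w using FreeSemigroup.recOnMul with
  | ih1 l =>
    rw [StarWord.adj_of, StarWord.degree_of, StarWord.degree_of]
    obtain ⟨a, b⟩ := l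
    cases b <;> simp [StarLetter.degree]
  | ih2 l w h1 h2 =>
    rw [StarWord.adj_mul, StarWord.degree_mul, StarWord.degree_mul, h1, h2, neg_add_rev]

theorem FreeStarAlg.adj_add (f g : FreeStarAlg P T) :
    FreeStarAlg.adj (f + g) = FreeStarAlg.adj f + FreeStarAlg.adj g := by
  unfold FreeStarAlg.adj
  rw [MonoidAlgebra.coeff_add]
  exact Finsupp.sum_add_index' (by simp) (by simp)

theorem FreeStarAlg.adj_zero : FreeStarAlg.adj (0 : FreeStarAlg P T) = 0 := by
  simp [FreeStarAlg.adj]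

theorem FreeStarAlg.adj_single (w : StarWord P T) (c : ℂ) :
    FreeStarAlg.adj (MonoidAlgebra.single w c) = MonoidAlgebra.single w.adj (star c) := by
  simp [FreeStarAlg.adj]

variable [NonUnitalRing X] [StarRing X] [Module ℂ X] [IsScalarTower ℂ X X] [SMulCommClass ℂ X X]

theorem FreeStarAlg.val_single (w : StarWord P T) (c : ℂ) :
    FreeStarAlg.val (MonoidAlgebra.single w c) = c • StarWord.val w := by
  simp [FreeStarAlg.val]

theorem FreeStarAlg.val_adj [StarModule ℂ X] (f : FreeStarAlg P T) :
    FreeStarAlg.val (FreeStarAlg.adj f) = star (FreeStarAlg.val f) := by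
  induction f using MonoidAlgebra.induction_linear with
  | zero => simp [FreeStarAlg.adj_zero]
  | add f g hf hg => rw [FreeStarAlg.adj_add, map_add, map_add, star_add, hf, hg]
  | single w c => rw [FreeStarAlg.adj_single, val_single, val_single, StarWord.val_adj, star_smul]

/-- The decomposition of the value of an element of the free *-algebra according to degrees of
words. -/
noncomputable def FreeStarAlg.dec (d : Unitization ℂ X → k →₀ ℕ) :
    FreeStarAlg P T →ₗ[ℂ] ((k →₀ ℤ) →₀ X) :=
  (Finsupp.lsum ℂ fun w : StarWord P T =>
    (Finsupp.lsingle (w.degree d)).comp (LinearMap.toSpanSingleton ℂ X w.val)).comp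
  ({ toFun := fun f => f.coeff
     map_add' := fun _ _ => rfl
     map_smul' := fun _ _ => rfl } : FreeStarAlg P T →ₗ[ℂ] (StarWord P T →₀ ℂ))

theorem FreeStarAlg.dec_single (d : Unitization ℂ X → k →₀ ℕ) (w : StarWord P T) (c : ℂ) :
    FreeStarAlg.dec d (MonoidAlgebra.single w c) = Finsupp.single (w.degree d) (c • w.val) := by
  change (Finsupp.lsum ℂ _) (Finsupp.single w c) = _
  rw [Finsupp.lsum_single]
  simp

theorem FreeStarAlg.dec_of_homogeneous (d : Unitization ℂ X → k →₀ ℕ) (n : k →₀ ℤ)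
    (f : FreeStarAlg P T) (hf : f ∈ Submodule.span ℂ {f : FreeStarAlg P T |
      ∃ w : StarWord P T, w.degree d = n ∧ f = MonoidAlgebra.single w 1}) :
    FreeStarAlg.dec d f = Finsupp.single n (FreeStarAlg.val f) := by
  induction hf using Submodule.span_induction with
  | mem f hf =>
    obtain ⟨w, rfl, rfl⟩ := hf
    rw [dec_single, val_single]
  | zero => simp
  | add f g _ _ hf hg => rw [map_add, hf, hg, map_add, Finsupp.single_add]
  | smul c f _ hf =>
    have : FreeStarAlg.val (c • f) = c • FreeStarAlg.val f := map_smul FreeStarAlg.val c f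
    rw [map_smul, hf, this, Finsupp.smul_single]

/-- Multiplying by a word multiplies each component by its value and shifts all degrees by its
degree. It therefore acts on the decomposition itself, which makes the kernel of `dec` an ideal;
`dec_mul_single` and `dec_adj` are the analogues for the right side and the adjoint. -/
theorem FreeStarAlg.dec_single_mul (d : Unitization ℂ X → k →₀ ℕ) (w : StarWord P T) (c : ℂ)
    (f : FreeStarAlg P T) (hf : FreeStarAlg.dec d f = 0) :
    FreeStarAlg.dec d (MonoidAlgebra.single w c * f) = 0 := by
  have h : ∀ f : FreeStarAlg P T, FreeStarAlg.dec d (MonoidAlgebra.single w c * f) =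
      Finsupp.lsum ℂ (fun n : k →₀ ℤ => (Finsupp.lsingle (w.degree d + n)).comp
        (c • LinearMap.mulLeft ℂ w.val)) (FreeStarAlg.dec d f) := fun f => by
    induction f using MonoidAlgebra.induction_linear with
    | zero => simp
    | add f g hf hg => rw [mul_add, map_add, map_add, map_add, hf, hg]
    | single v e =>
      rw [MonoidAlgebra.single_mul_single, dec_single, dec_single, StarWord.degree_mul, map_mul]
      simp only [Finsupp.lsum_single, LinearMap.comp_apply, LinearMap.smul_apply,
        LinearMap.mulLeft_apply, Finsupp.lsingle_apply, mul_smul_comm, smul_smul]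
  rw [h, hf, map_zero]

theorem FreeStarAlg.dec_mul_single (d : Unitization ℂ X → k →₀ ℕ) (w : StarWord P T) (c : ℂ)
    (f : FreeStarAlg P T) (hf : FreeStarAlg.dec d f = 0) :
    FreeStarAlg.dec d (f * MonoidAlgebra.single w c) = 0 := by
  have h : ∀ f : FreeStarAlg P T, FreeStarAlg.dec d (f * MonoidAlgebra.single w c) =
      Finsupp.lsum ℂ (fun n : k →₀ ℤ => (Finsupp.lsingle (n + w.degree d)).comp
        (c • LinearMap.mulRight ℂ w.val)) (FreeStarAlg.dec d f) := fun f => by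
    induction f using MonoidAlgebra.induction_linear with
    | zero => simp
    | add f g hf hg => rw [add_mul, map_add, map_add, map_add, hf, hg]
    | single v e =>
      rw [MonoidAlgebra.single_mul_single, dec_single, dec_single, StarWord.degree_mul, map_mul]
      simp only [Finsupp.lsum_single, LinearMap.comp_apply, LinearMap.smul_apply,
        LinearMap.mulRight_apply, Finsupp.lsingle_apply, smul_mul_assoc, smul_smul, mul_comm c]
  rw [h, hf, map_zero]

theorem FreeStarAlg.dec_adj [StarModule ℂ X] (d : Unitization ℂ X → k →₀ ℕ)
    (f : FreeStarAlg P T) (hf : FreeStarAlg.dec d f = 0) :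
    FreeStarAlg.dec d (FreeStarAlg.adj f) = 0 := by
  have h : ∀ f : FreeStarAlg P T, FreeStarAlg.dec d (FreeStarAlg.adj f) =
      Finsupp.liftAddHom (fun n : k →₀ ℤ => (Finsupp.singleAddHom (-n)).comp
        (starAddEquiv : X ≃+ X).toAddMonoidHom) (FreeStarAlg.dec d f) := fun f => by
    induction f using MonoidAlgebra.induction_linear with
    | zero => simp [FreeStarAlg.adj_zero]
    | add f g hf hg => rw [FreeStarAlg.adj_add, map_add, map_add, map_add, hf, hg]
    | single v e =>
      rw [FreeStarAlg.adj_single, dec_single, dec_single, StarWord.degree_adj, StarWord.val_adj]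
      simp
  rw [h, hf, map_zero]

end FreeLemmas

namespace SemigraphAlgebra

variable {k X : Type*} [NonUnitalRing X] [StarRing X] [Module ℂ X] [IsScalarTower ℂ X X]
  [SMulCommClass ℂ X X] [StarModule ℂ X] (A : SemigraphAlgebra k X)

/-! ### The grading -/

/-- The kernel of `FreeStarAlg.dec` is a selfadjoint two-sided ideal. It contains each homogeneous
generator of the relations, whose only component is its value 0; hence it contains all relations. -/
theorem dec_eq_zero (f : FreeStarAlg A.P A.T) (hf : FreeStarAlg.val f = 0) :
    FreeStarAlg.dec A.d f = 0 := by
  obtain ⟨Y, hY, hker⟩ := A.relations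
  refine (hker f).1 hf (LinearMap.ker (FreeStarAlg.dec A.d)) ?_ ?_ ?_
  · intro y hy
    have h0 : FreeStarAlg.val y = 0 := (hker y).2 fun I hI _ _ => hI hy
    obtain ⟨n, hn⟩ := Set.mem_iUnion.1 (hY hy)
    simp [FreeStarAlg.dec_of_homogeneous A.d n y hn, h0]
  · intro a b hb
    rw [LinearMap.mem_ker] at hb
    induction a using MonoidAlgebra.induction_linear with
    | zero => simp
    | add f g hf hg =>
      rw [add_mul, mul_add]
      exact ⟨add_mem hf.1 hg.1, add_mem hf.2 hg.2⟩
    | single w c =>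
      exact ⟨FreeStarAlg.dec_single_mul A.d w c b hb, FreeStarAlg.dec_mul_single A.d w c b hb⟩
  · exact fun b hb => FreeStarAlg.dec_adj A.d b hb

theorem val_surjective : Function.Surjective (FreeStarAlg.val : FreeStarAlg A.P A.T → X) := by
  intro x
  have hx : x ∈ NonUnitalStarAlgebra.adjoin ℂ (A.P ∪ A.T) := by rw [A.generates]; trivial
  induction hx using NonUnitalStarAlgebra.adjoin_induction with
  | mem y hy =>
    rcases hy with hy | hy
    · exact ⟨MonoidAlgebra.single (FreeSemigroup.of (Sum.inl ⟨y, hy⟩, false)) 1, by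
        rw [FreeStarAlg.val_single, StarWord.val_of]; simp [StarLetter.val]⟩
    · exact ⟨MonoidAlgebra.single (FreeSemigroup.of (Sum.inr ⟨y, hy⟩, false)) 1, by
        rw [FreeStarAlg.val_single, StarWord.val_of]; simp [StarLetter.val]⟩
  | add y z _ _ hy hz =>
    obtain ⟨f, rfl⟩ := hy
    obtain ⟨g, rfl⟩ := hz
    exact ⟨f + g, map_add _ _ _⟩
  | zero => exact ⟨0, map_zero _⟩
  | mul y z _ _ hy hz =>
    obtain ⟨f, rfl⟩ := hy
    obtain ⟨g, rfl⟩ := hz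
    exact ⟨f * g, map_mul _ _ _⟩
  | smul c y _ hy =>
    obtain ⟨f, rfl⟩ := hy
    exact ⟨c • f, map_smul _ _ _⟩
  | star y _ hy =>
    obtain ⟨f, rfl⟩ := hy
    exact ⟨FreeStarAlg.adj f, FreeStarAlg.val_adj f⟩

/-- The decomposition vanishes on the kernel of the canonical map, so it factors through X; the
factor is obtained from a linear section. -/
theorem exists_dec : ∃ D : X →ₗ[ℂ] ((k →₀ ℤ) →₀ X),
    ∀ f : FreeStarAlg A.P A.T, D (FreeStarAlg.val f) = FreeStarAlg.dec A.d f := by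
  let v : FreeStarAlg A.P A.T →ₗ[ℂ] X :=
    { toFun := FreeStarAlg.val, map_add' := map_add _, map_smul' := map_smul _ }
  obtain ⟨g, hg⟩ := v.exists_rightInverse_of_surjective
    (LinearMap.range_eq_top.2 A.val_surjective)
  refine ⟨(FreeStarAlg.dec A.d).comp g, fun f => ?_⟩
  rw [LinearMap.comp_apply, ← sub_eq_zero, ← map_sub]
  refine A.dec_eq_zero _ ?_
  rw [map_sub, sub_eq_zero]
  exact LinearMap.congr_fun hg (FreeStarAlg.val f)

/-- The decomposition of an element of a semigraph algebra into homogeneous components. -/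
noncomputable def dec : X →ₗ[ℂ] ((k →₀ ℤ) →₀ X) := A.exists_dec.choose

theorem dec_val (f : FreeStarAlg A.P A.T) : A.dec (FreeStarAlg.val f) = FreeStarAlg.dec A.d f :=
  A.exists_dec.choose_spec f

/-- The homogeneous elements of degree `n`. -/
def gr (n : k →₀ ℤ) : Submodule ℂ X :=
  Submodule.span ℂ {w | ∃ u : StarWord A.P A.T, u.val = w ∧ u.degree A.d = n}

variable {A}

theorem dec_of_mem_gr {n : k →₀ ℤ} {x : X} (hx : x ∈ A.gr n) : A.dec x = Finsupp.single n x := by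
  induction hx using Submodule.span_induction with
  | mem f hf =>
    obtain ⟨w, rfl, rfl⟩ := hf
    have := A.dec_val (MonoidAlgebra.single w 1)
    rwa [FreeStarAlg.val_single, FreeStarAlg.dec_single, one_smul] at this
  | zero => simp
  | add f g _ _ hf hg => rw [map_add, hf, hg, Finsupp.single_add]
  | smul c f _ hf => rw [map_smul, hf, Finsupp.smul_single]

theorem mem_gr_of_word (u : StarWord A.P A.T) : u.val ∈ A.gr (u.degree A.d) :=
  Submodule.subset_span ⟨u, rfl, rfl⟩

/-- Every element is a finite sum of homogeneous elements. -/
theorem gr_induction {p : X → Prop} (zero : p 0) (add : ∀ x y, p x → p y → p (x + y))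
    (gr : ∀ n, ∀ x ∈ A.gr n, p x) (x : X) : p x := by
  obtain ⟨f, rfl⟩ := A.val_surjective x
  induction f using MonoidAlgebra.induction_linear with
  | zero => simpa using zero
  | add f g hf hg => rw [map_add]; exact add _ _ hf hg
  | single w c =>
    rw [FreeStarAlg.val_single]
    exact gr _ _ (Submodule.smul_mem _ _ (mem_gr_of_word w))

theorem dec_mem (x : X) (n : k →₀ ℤ) : A.dec x n ∈ A.gr n := by
  induction x using A.gr_induction with
  | zero => simp
  | add x y hx hy => rw [map_add]; exact add_mem hx hy
  | gr m x hx =>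
    rw [dec_of_mem_gr hx]
    classical
    rw [Finsupp.single_apply]
    split_ifs with h
    · exact h ▸ hx
    · exact zero_mem _

theorem dec_sum (x : X) : ((A.dec x).sum fun _ y => y) = x := by
  induction x using A.gr_induction with
  | zero => simp
  | add x y hx hy =>
    rw [map_add, Finsupp.sum_add_index' (by simp) (by simp), hx, hy]
  | gr m x hx => rw [dec_of_mem_gr hx, Finsupp.sum_single_index rfl]

theorem gr_mul {m n : k →₀ ℤ} {x y : X} (hx : x ∈ A.gr m) (hy : y ∈ A.gr n) :
    x * y ∈ A.gr (m + n) := by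
  induction hx using Submodule.span_induction with
  | zero => simp
  | add f g _ _ hf hg => rw [add_mul]; exact add_mem hf hg
  | smul c f _ hf => rw [smul_mul_assoc]; exact Submodule.smul_mem _ _ hf
  | mem f hf =>
    obtain ⟨u, rfl, rfl⟩ := hf
    induction hy using Submodule.span_induction with
    | zero => simp
    | add f g _ _ hf hg => rw [mul_add]; exact add_mem hf hg
    | smul c f _ hf => rw [mul_smul_comm]; exact Submodule.smul_mem _ _ hf
    | mem g hg =>
      obtain ⟨v, rfl, rfl⟩ := hg
      rw [← map_mul, ← StarWord.degree_mul]
      exact mem_gr_of_word _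

theorem gr_star {n : k →₀ ℤ} {x : X} (hx : x ∈ A.gr n) : star x ∈ A.gr (-n) := by
  induction hx using Submodule.span_induction with
  | zero => simp
  | add f g _ _ hf hg => rw [star_add]; exact add_mem hf hg
  | smul c f _ hf => rw [star_smul]; exact Submodule.smul_mem _ _ hf
  | mem f hf =>
    obtain ⟨u, rfl, rfl⟩ := hf
    rw [← StarWord.val_adj, ← StarWord.degree_adj]
    exact mem_gr_of_word _

/-! ### Standard words span the homogeneous elements -/

/-- The embedding of degrees. -/
noncomputable abbrev intDeg : (k →₀ ℕ) →+ (k →₀ ℤ) :=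
  Finsupp.mapRange.addMonoidHom (Nat.castAddMonoidHom ℤ)

theorem intDeg_injective : Function.Injective (intDeg : (k →₀ ℕ) →+ (k →₀ ℤ)) := by
  intro a b h
  ext i
  have := DFunLike.congr_fun h i
  simpa using this

/-- X is an ideal in its unitization. -/
theorem exists_inr_mul_mul (a b : Unitization ℂ X) (x : X) :
    ∃ y : X, (y : Unitization ℂ X) = a * x * b :=
  ⟨(a * x * b).snd, by ext <;> simp⟩

variable (A) in
/-- The standard words of degree `n`. -/
def stdWords (n : k →₀ ℤ) : Set X :=
  {w | ∃ s ∈ A.T₁, ∃ p ∈ A.Pinr, ∃ t ∈ A.T₁, (w : Unitization ℂ X) = s * p * star t ∧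
    intDeg (A.d s) - intDeg (A.d t) = n}

/-- Admitting s = 0 and t = 0 avoids a separate discussion of products in T₁ which are not defined.
-/
theorem mem_span_stdWords {n : k →₀ ℤ} {x : X} {s p t : Unitization ℂ X}
    (h : (x : Unitization ℂ X) = s * p * star t) (hp : p ∈ A.Pinr)
    (hs : s = 0 ∨ s ∈ A.T₁) (ht : t = 0 ∨ t ∈ A.T₁)
    (hn : s ∈ A.T₁ → t ∈ A.T₁ → intDeg (A.d s) - intDeg (A.d t) = n) :
    x ∈ Submodule.span ℂ (A.stdWords n) := by
  rcases hs with rfl | hs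
  · have : x = 0 := by
      apply inr_injective (R := ℂ); rw [h]; simp
    rw [this]; exact zero_mem _
  rcases ht with rfl | ht
  · have : x = 0 := by
      apply inr_injective (R := ℂ); rw [h]; simp
    rw [this]; exact zero_mem _
  exact Submodule.subset_span ⟨s, hs, p, hp, t, ht, h, hn hs ht⟩

theorem mul_eq_zero_or_mem {s t : Unitization ℂ X} (hs : s ∈ A.T₁) (ht : t ∈ A.T₁) :
    s * t = 0 ∨ s * t ∈ A.T₁ := by
  by_cases h : s * t = 0
  · exact Or.inl h
  · exact Or.inr (mul_mem_T₁ hs ht h)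

theorem d_mul_of_mem {s t : Unitization ℂ X} (hs : s ∈ A.T₁) (ht : t ∈ A.T₁)
    (h : s * t ∈ A.T₁) : A.d (s * t) = A.d s + A.d t :=
  d_mul hs ht (ne_zero_of_mem_T₁ h)

theorem letter_val_cases (l : StarLetter A.P A.T) :
    (((StarLetter.val l : X) : Unitization ℂ X) ∈ A.Pinr ∧ l.degree A.d = 0) ∨
    (∃ t ∈ A.T₁, t ≠ 1 ∧ ((StarLetter.val l : X) : Unitization ℂ X) = t ∧
      l.degree A.d = intDeg (A.d t)) ∨
    (∃ t ∈ A.T₁, t ≠ 1 ∧ ((StarLetter.val l : X) : Unitization ℂ X) = star t ∧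
      l.degree A.d = - intDeg (A.d t)) := by
  obtain ⟨a | a, b⟩ := l
  · left
    have : StarLetter.val ((Sum.inl a, b) : StarLetter A.P A.T) = (a : X) := by
      cases b <;> simp [StarLetter.val, (A.P_proj a a.2).2]
    rw [this]
    exact ⟨inr_mem_Pinr a.2, StarLetter.degree_inl _ _ _⟩
  · right
    cases b
    · exact Or.inl ⟨_, inr_mem_T₁ a.2, inr_ne_one _, rfl, StarLetter.degree_inr _ _⟩
    · exact Or.inr ⟨_, inr_mem_T₁ a.2, inr_ne_one _, by simp [StarLetter.val],
        StarLetter.degree_inr_star _ _⟩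

/-- A projection moves past s, an element u of T is absorbed into u s, and u* s expands into terms α
c β*, after which p moves past β* and β* merges with t*. The degrees match because d(u) + d(α) =
d(s) + d(β). -/
theorem letter_mul_stdWords (l : StarLetter A.P A.T) {n : k →₀ ℤ} {x : X}
    (hx : x ∈ Submodule.span ℂ (A.stdWords n)) :
    StarLetter.val l * x ∈ Submodule.span ℂ (A.stdWords (l.degree A.d + n)) := by
  induction hx using Submodule.span_induction with
  | zero => simp
  | add f g _ _ hf hg => rw [mul_add]; exact add_mem hf hg
  | smul c f _ hf => rw [mul_smul_comm]; exact Submodule.smul_mem _ _ hf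
  | mem x hx =>
    obtain ⟨s, hs, p, hp, t, ht, hx, rfl⟩ := hx
    have hp₁ := Pinr_subset_P₁ hp
    rcases letter_val_cases l with ⟨hl, hd⟩ | ⟨u, hu, -, hl, hd⟩ | ⟨u, hu, -, hl, hd⟩
    · obtain ⟨q, hq, hq', h⟩ := skip₁ hs (Pinr_subset_P₁ hl)
      refine mem_span_stdWords (s := s) (p := q * p) (t := t) ?_ (Pinr_mul (hq' hl) hp₁)
        (Or.inr hs) (Or.inr ht) fun _ _ => by rw [hd, zero_add]
      rw [inr_mul, hx, ← mul_assoc, ← mul_assoc, h, ← mul_assoc]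
    · refine mem_span_stdWords (s := u * s) (p := p) (t := t) ?_ hp
        (mul_eq_zero_or_mem hu hs) (Or.inr ht) fun h _ => ?_
      · rw [inr_mul, hx, hl]; simp only [mul_assoc]
      · rw [hd, d_mul_of_mem hu hs h, map_add]; abel
    · obtain ⟨c, hc, he⟩ := expansion₁ hu hs
      have key : ∀ a ∈ extFinset hu hs, ∃ y ∈ Submodule.span ℂ
          (A.stdWords (l.degree A.d + (intDeg (A.d s) - intDeg (A.d t)))),
          (y : Unitization ℂ X) = a.1 * c a * star a.2 * p * star t := by
        intro a ha
        have ha' := mem_extFinset.1 ha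
        obtain ⟨p', hp', hpp, h1, h2⟩ := skip_star (ext_snd_mem ha') hp₁
        have hcp : c a * p' ∈ A.Pinr := by
          rw [P₁_comm (hc a ha) hp']; exact Pinr_mul (hpp hp) (hc a ha)
        have e : a.1 * c a * star a.2 * p * star t = a.1 * (c a * p') * star (t * a.2) := by
          rw [mul_assoc _ (star a.2) p, h2, star_mul]; simp only [mul_assoc]
        obtain ⟨y₀, hy₁, hy₀⟩ := hcp
        obtain ⟨y, hy⟩ := exists_inr_mul_mul a.1 (star (t * a.2)) y₀
        refine ⟨y, mem_span_stdWords (s := a.1) (p := c a * p') (t := t * a.2) ?_ ⟨y₀, hy₁, hy₀⟩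
          (Or.inr ha'.1) (mul_eq_zero_or_mem ht ha'.2.1) fun _ h => ?_, ?_⟩
        · rw [hy, hy₀]
        · have h3 := congrArg A.d (ext_eq ha')
          rw [d_mul hu ha'.1 (ext_ne_zero ha'), d_mul hs ha'.2.1 ha'.2.2.2.1] at h3
          have h4 := congrArg intDeg h3
          rw [map_add, map_add] at h4
          rw [d_mul_of_mem ht ha'.2.1 h, map_add, hd]
          have h6 : intDeg (A.d a.1) = intDeg (A.d s) + intDeg (A.d a.2) - intDeg (A.d u) := by
            rw [← map_add, ← h3, map_add]; abel
          rw [h6]; abel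
        · rw [e, hy, hy₀]
      choose! y hy hy' using key
      have : StarLetter.val l * x = ∑ a ∈ extFinset hu hs, y a := by
        apply inr_injective (R := ℂ)
        have hsum : ((∑ a ∈ extFinset hu hs, y a : X) : Unitization ℂ X) =
            ∑ a ∈ extFinset hu hs, (y a : Unitization ℂ X) :=
          map_sum (Unitization.inrNonUnitalAlgHom ℂ X) _ _
        rw [hsum, inr_mul, hx, hl, Finset.sum_congr rfl hy', ← Finset.sum_mul, ← Finset.sum_mul,
          ← he]
        simp only [mul_assoc]
      rw [this]
      exact sum_mem hy

/-- A letter t becomes a standard word by writing t = t (t* t), since t* t is a generating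
projection. -/
theorem letter_mem_stdWords (l : StarLetter A.P A.T) :
    StarLetter.val l ∈ Submodule.span ℂ (A.stdWords (l.degree A.d)) := by
  rcases letter_val_cases l with ⟨hl, hd⟩ | ⟨u, hu, h1, hl, hd⟩ | ⟨u, hu, h1, hl, hd⟩
  · exact mem_span_stdWords (s := 1) (t := 1) (by simp) hl (Or.inr one_mem_T₁)
      (Or.inr one_mem_T₁) fun _ _ => by rw [hd, sub_self]
  · exact mem_span_stdWords (s := u) (t := 1) (p := star u * u)
      (by rw [← mul_assoc, T₁_isometry hu, hl]; simp) (star_mul_self_mem hu h1) (Or.inr hu)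
      (Or.inr one_mem_T₁) fun _ _ => by rw [hd, d_one, map_zero, sub_zero]
  · refine mem_span_stdWords (s := 1) (t := u) (p := star u * u) ?_ (star_mul_self_mem hu h1)
      (Or.inr one_mem_T₁) (Or.inr hu) fun _ _ => by rw [hd, d_one, map_zero, zero_sub]
    have := congrArg star (T₁_isometry hu)
    rw [star_mul, star_mul, star_star] at this
    rw [hl, one_mul, mul_assoc, this]

theorem word_mem_stdWords (u : StarWord A.P A.T) :
    u.val ∈ Submodule.span ℂ (A.stdWords (u.degree A.d)) := by
  induction u using FreeSemigroup.recOnMul with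
  | ih1 l =>
    rw [StarWord.val_of, StarWord.degree_of]
    exact letter_mem_stdWords l
  | ih2 l w h1 h2 =>
    rw [map_mul, StarWord.degree_mul, StarWord.val_of, StarWord.degree_of]
    exact letter_mul_stdWords l h2

theorem gr_le_stdWords (n : k →₀ ℤ) : A.gr n ≤ Submodule.span ℂ (A.stdWords n) := by
  refine Submodule.span_le.2 ?_
  rintro _ ⟨u, rfl, rfl⟩
  exact word_mem_stdWords u

/-- A standard word is the value of a formal word of the same degree. -/
theorem exists_word_of_stdWords {n : k →₀ ℤ} {w : X} (hw : w ∈ A.stdWords n) :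
    ∃ u : StarWord A.P A.T, u.val = w ∧ u.degree A.d = n := by
  obtain ⟨s, hs, _, ⟨p, hp, rfl⟩, t, ht, hw, rfl⟩ := hw
  have h1 : ∃ u : StarWord A.P A.T, (u.val : Unitization ℂ X) = p * star t ∧
      u.degree A.d = - intDeg (A.d t) := by
    let up : StarWord A.P A.T := FreeSemigroup.of (Sum.inl ⟨p, hp⟩, false)
    rcases mem_T₁_iff.1 ht with rfl | ⟨t, ht', rfl⟩
    · exact ⟨up, by rw [StarWord.val_of]; simp [StarLetter.val],
        by rw [StarWord.degree_of]; simp [StarLetter.degree_inl, d_one]⟩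
    · exact ⟨up * FreeSemigroup.of (Sum.inr ⟨t, ht'⟩, true),
        by rw [map_mul, StarWord.val_of, StarWord.val_of]; simp [StarLetter.val],
        by rw [StarWord.degree_mul, StarWord.degree_of, StarWord.degree_of]
           simp [StarLetter.degree_inl, StarLetter.degree_inr_star]⟩
  obtain ⟨u, hu, hud⟩ := h1
  rcases mem_T₁_iff.1 hs with rfl | ⟨s, hs', rfl⟩
  · exact ⟨u, inr_injective (R := ℂ) (by rw [hu, hw]; simp), by rw [hud, d_one]; simp⟩
  · refine ⟨FreeSemigroup.of (Sum.inr ⟨s, hs'⟩, false) * u, inr_injective (R := ℂ) ?_, ?_⟩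
    · rw [map_mul, inr_mul, hu, hw, StarWord.val_of, mul_assoc]; simp [StarLetter.val]
    · rw [StarWord.degree_mul, hud, StarWord.degree_of]; simp [StarLetter.degree_inr, sub_eq_add_neg]

end SemigraphAlgebra

namespace SemigraphAlgebra

variable {k X : Type*} [NonUnitalRing X] [StarRing X] [Module ℂ X] [IsScalarTower ℂ X X]
  [SMulCommClass ℂ X X] [StarModule ℂ X] (A : SemigraphAlgebra k X)

/-! ### The diagonal algebra and standard projections -/

/-- The commutative algebra generated by the diagonal projections. -/
def diagAlg : Subalgebra ℂ (Unitization ℂ X) := Algebra.adjoin ℂ A.diag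

/-- The generators commute by `diag_comm`. Commutativity makes prime and maximal ideals available,
which replace the spectrum of the diagonal. -/
noncomputable instance : CommRing A.diagAlg :=
  { A.diagAlg.toRing with
    mul_comm := (Algebra.isMulCommutative_adjoin ℂ
      fun _ ha _ hb => diag_comm ha hb).is_comm.comm }

variable {A}

theorem diag_subset_diagAlg {e : Unitization ℂ X} (he : e ∈ A.diag) : e ∈ A.diagAlg :=
  Algebra.subset_adjoin he

theorem diagAlg_comm {a b : Unitization ℂ X} (ha : a ∈ A.diagAlg) (hb : b ∈ A.diagAlg) :
    a * b = b * a :=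
  congrArg Subtype.val (mul_comm (⟨a, ha⟩ : A.diagAlg) ⟨b, hb⟩)

theorem one_sub_prod {L : List (Unitization ℂ X)} (hL : ∀ f ∈ L, f ∈ A.properDiag) :
    (L.map fun f => 1 - f).prod ∈ A.diagAlg ∧
    star (L.map fun f => 1 - f).prod = (L.map fun f => 1 - f).prod ∧
    (L.map fun f => 1 - f).prod * (L.map fun f => 1 - f).prod =
      (L.map fun f => 1 - f).prod := by
  induction L with
  | nil => simp [one_mem]
  | cons f L ih =>
    obtain ⟨h1, h2, h3⟩ := ih fun g hg => hL g (List.mem_cons_of_mem _ hg)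
    have hf := properDiag_subset (hL f List.mem_cons_self)
    have hf' : 1 - f ∈ A.diagAlg := sub_mem (one_mem _) (diag_subset_diagAlg hf)
    rw [List.map_cons, List.prod_cons]
    refine ⟨mul_mem hf' h1, ?_, ?_⟩
    · rw [star_mul, h2, star_sub, star_one, diag_star hf, diagAlg_comm h1 hf']
    · have hi : (1 - f) * (1 - f) = 1 - f := by
        rw [mul_sub, mul_one, sub_mul, one_mul, diag_idem hf, sub_self, sub_zero]
      rw [mul_assoc, ← mul_assoc _ (1 - f), diagAlg_comm h1 hf', mul_assoc, h3, ← mul_assoc, hi]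

variable (A) in
/-- The standard projections, viewed in the unitization. -/
def stdProj : Set (Unitization ℂ X) :=
  {q | ∃ e ∈ A.properDiag, ∃ L : List (Unitization ℂ X), (∀ f ∈ L, f ∈ A.properDiag) ∧
    q = e * (L.map fun f => 1 - f).prod}

theorem properDiag_subset_stdProj {e : Unitization ℂ X} (he : e ∈ A.properDiag) :
    e ∈ A.stdProj := ⟨e, he, [], by simp, by simp⟩

theorem stdProj_mul_one_sub {q f : Unitization ℂ X} (hq : q ∈ A.stdProj)
    (hf : f ∈ A.properDiag) : q * (1 - f) ∈ A.stdProj := by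
  obtain ⟨e, he, L, hL, rfl⟩ := hq
  refine ⟨e, he, L ++ [f], ?_, by simp [mul_assoc]⟩
  intro g hg
  rcases List.mem_append.1 hg with hg | hg
  · exact hL g hg
  · rw [List.mem_singleton.1 hg]; exact hf

theorem stdProj_subset_diagAlg {q : Unitization ℂ X} (hq : q ∈ A.stdProj) : q ∈ A.diagAlg := by
  obtain ⟨e, he, L, hL, rfl⟩ := hq
  exact mul_mem (diag_subset_diagAlg (properDiag_subset he)) (one_sub_prod hL).1

theorem stdProj_star {q : Unitization ℂ X} (hq : q ∈ A.stdProj) : star q = q := by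
  obtain ⟨e, he, L, hL, rfl⟩ := hq
  rw [star_mul, (one_sub_prod hL).2.1, diag_star (properDiag_subset he)]
  exact diagAlg_comm (one_sub_prod hL).1 (diag_subset_diagAlg (properDiag_subset he))

theorem stdProj_idem {q : Unitization ℂ X} (hq : q ∈ A.stdProj) : q * q = q := by
  obtain ⟨e, he, L, hL, rfl⟩ := hq
  have he' := properDiag_subset he
  obtain ⟨h1, -, h3⟩ := one_sub_prod hL
  rw [mul_assoc, ← mul_assoc _ e, diagAlg_comm h1 (diag_subset_diagAlg he'), mul_assoc, h3,
    ← mul_assoc, diag_idem he']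

theorem properDiag_iff {e : Unitization ℂ X} :
    e ∈ A.properDiag ↔ ∃ x : X, A.IsHalfStandardWord x ∧ ((x * star x : X) : Unitization ℂ X) = e := by
  have key : ∀ s p : Unitization ℂ X, p ∈ A.P₁ → s * p * star (s * p) = s * p * star s := by
    intro s p hp
    rw [star_mul, P₁_star hp, ← mul_assoc, mul_assoc s, P₁_idem hp]
  constructor
  · rintro ⟨s, hs, _, ⟨p, hp, rfl⟩, rfl⟩
    obtain ⟨x, hx⟩ := exists_inr_mul_mul s 1 p
    rw [mul_one] at hx
    exact ⟨x, ⟨s, hs, p, hp, hx⟩, by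
      rw [inr_mul, inr_star, hx, key s p (Pinr_subset_P₁ (inr_mem_Pinr hp))]⟩
  · rintro ⟨x, ⟨s, hs, p, hp, hx⟩, rfl⟩
    exact ⟨s, hs, p, inr_mem_Pinr hp, by
      rw [inr_mul, inr_star, hx, key s p (Pinr_subset_P₁ (inr_mem_Pinr hp))]⟩

theorem isStandardProjection_iff {p : X} :
    A.IsStandardProjection p ↔ (p : Unitization ℂ X) ∈ A.stdProj := by
  constructor
  · rintro ⟨x, hx, L, hL, h⟩
    refine ⟨_, properDiag_iff.2 ⟨x, hx, rfl⟩,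
      L.map fun y => ((y * star y : X) : Unitization ℂ X), ?_, ?_⟩
    · intro f hf
      obtain ⟨y, hy, rfl⟩ := List.mem_map.1 hf
      exact properDiag_iff.2 ⟨y, hL y hy, rfl⟩
    · rw [h, List.map_map]; rfl
  · rintro ⟨e, he, L, hL, h⟩
    obtain ⟨x, hx, rfl⟩ := properDiag_iff.1 he
    choose! y hy hy' using fun f hf => properDiag_iff.1 (hL f hf)
    refine ⟨x, hx, L.map y, ?_, ?_⟩
    · intro z hz
      obtain ⟨f, hf, rfl⟩ := List.mem_map.1 hz
      exact hy f hf
    · rw [h, List.map_map]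
      congr 2
      exact List.map_congr_left fun f hf => by simp only [Function.comp_apply, hy' f hf]

theorem exists_inr_of_properDiag {e : Unitization ℂ X} (he : e ∈ A.properDiag) :
    ∃ x : X, (x : Unitization ℂ X) = e := by
  obtain ⟨x, -, h⟩ := properDiag_iff.1 he
  exact ⟨_, h⟩

theorem exists_inr_of_stdProj {q : Unitization ℂ X} (hq : q ∈ A.stdProj) :
    ∃ x : X, (x : Unitization ℂ X) = q := by
  obtain ⟨e, he, L, hL, rfl⟩ := hq
  obtain ⟨x, rfl⟩ := exists_inr_of_properDiag he
  obtain ⟨y, hy⟩ := exists_inr_mul_mul 1 (L.map fun f => 1 - f).prod x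
  exact ⟨y, by rw [hy, one_mul]⟩

/-! ### Ultrafilters of standard projections -/

variable (A) in
/-- A downward directed set of nonzero standard projections which decides each diagonal
projection. -/
structure StdFilter where
  carrier : Set (Unitization ℂ X)
  std : ∀ q ∈ carrier, q ∈ A.stdProj
  ne_zero : ∀ q ∈ carrier, q ≠ 0
  nonempty : carrier.Nonempty
  directed : ∀ q ∈ carrier, ∀ q' ∈ carrier, ∃ r ∈ carrier, r * q = r ∧ r * q' = r
  decides : ∀ e ∈ A.diag, ∃ q ∈ carrier, q * e = q ∨ q * e = 0

/-- An idempotent or its complement belongs to a prime ideal. -/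
theorem one_sub_mem_of_idem {R : Type*} [CommRing R] {m : Ideal R} [hm : m.IsPrime] {e : R}
    (he : e * e = e) (h : e ∉ m) : 1 - e ∈ m := by
  have : e * (1 - e) ∈ m := by rw [mul_sub, mul_one, he, sub_self]; exact zero_mem _
  exact (hm.mem_or_mem this).resolve_left h

/-- The filter of standard projections defined by a prime ideal of the diagonal algebra. -/
def StdFilter.ofPrime (m : Ideal A.diagAlg) [hm : m.IsPrime] (e₀ : A.diagAlg)
    (he₀ : (e₀ : Unitization ℂ X) ∈ A.stdProj) (hm₀ : e₀ ∉ m) : A.StdFilter where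
  carrier := {q | q ∈ A.stdProj ∧ ∃ a : A.diagAlg, (a : Unitization ℂ X) = q ∧ 1 - a ∈ m}
  std q hq := hq.1
  ne_zero := by
    rintro q ⟨-, a, ha, h⟩ rfl
    have : a = 0 := Subtype.ext ha
    rw [this, sub_zero] at h
    exact hm.ne_top ((Ideal.eq_top_iff_one m).2 h)
  nonempty := ⟨e₀, he₀, e₀, rfl, one_sub_mem_of_idem (Subtype.ext (stdProj_idem he₀)) hm₀⟩
  directed := by
    rintro q ⟨hq, a, ha, hma⟩ q' ⟨hq', a', ha', hma'⟩
    have haa : a * a = a := Subtype.ext (by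
      change (a : Unitization ℂ X) * a = a
      rw [ha, stdProj_idem hq])
    have haa' : a' * a' = a' := Subtype.ext (by
      change (a' : Unitization ℂ X) * a' = a'
      rw [ha', stdProj_idem hq'])
    obtain ⟨e, he, L, hL, rfl⟩ := id hq
    obtain ⟨e', he', L', hL', rfl⟩ := id hq'
    have hed := properDiag_subset he
    have hed' := properDiag_subset he'
    obtain ⟨G, g, hg1, hg2, hg3⟩ := diag_mul_decompose hed hed'
    let E : A.diagAlg := ⟨e, diag_subset_diagAlg hed⟩
    let E' : A.diagAlg := ⟨e', diag_subset_diagAlg hed'⟩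
    let c : A.diagAlg := ⟨_, (one_sub_prod hL).1⟩
    let c' : A.diagAlg := ⟨_, (one_sub_prod hL').1⟩
    have hac : a = E * c := Subtype.ext ha
    have hac' : a' = E' * c' := Subtype.ext ha'
    -- Modulo m both a and a' are 1, and a a' is a multiple of E E'.
    have hEE' : E * E' ∉ m := fun h => by
      have h1 : a * a' ∈ m := by
        rw [hac, hac', mul_mul_mul_comm]; exact m.mul_mem_right _ h
      have h2 : (1 - a) + a * (1 - a') ∈ m := add_mem hma (m.mul_mem_left _ hma')
      have h3 := add_mem h2 h1
      rw [show (1 - a) + a * (1 - a') + a * a' = 1 by ring] at h3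
      exact hm.ne_top ((Ideal.eq_top_iff_one m).2 h3)
    -- E E' is only a sum of diagonal projections, so a a' need not be a standard projection. Some
    -- summand γ lies outside m, and γ c c' is a standard projection below both q and q'.
    have hex : ∃ i ∈ G, ∃ γ : A.diagAlg, (γ : Unitization ℂ X) = g i ∧ γ ∉ m := by
      by_contra hcon
      push Not at hcon
      refine hEE' ?_
      have : E * E' = ∑ i : G, (⟨g i, diag_subset_diagAlg (hg1 i i.2).1⟩ : A.diagAlg) := by
        apply Subtype.ext
        change e * e' = _
        rw [hg3, AddSubmonoidClass.coe_finsetSum]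
        exact (Finset.sum_coe_sort G g).symm
      rw [this]
      exact sum_mem fun i _ => hcon i i.2 _ rfl
    obtain ⟨i, hi, γ, hγ, hγm⟩ := hex
    have hγγ : γ * γ = γ := Subtype.ext (by
      change (γ : Unitization ℂ X) * γ = γ
      rw [hγ, diag_idem (hg1 i hi).1])
    have hγE : γ * (E * E') = γ := Subtype.ext (by
      change (γ : Unitization ℂ X) * (e * e') = γ
      rw [hγ, hg2 i hi])
    have hγm' := one_sub_mem_of_idem hγγ hγm
    have hr : γ * (c * c') = γ * (a * a') := by
      rw [hac, hac', mul_mul_mul_comm, ← mul_assoc γ (E * E'), hγE]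
    refine ⟨(γ * (c * c') : A.diagAlg), ⟨?_, _, rfl, ?_⟩, ?_, ?_⟩
    · refine ⟨g i, (hg1 i hi).2 he, L ++ L', ?_, ?_⟩
      · intro f hf
        exact (List.mem_append.1 hf).elim (hL f) (hL' f)
      · rw [List.map_append, List.prod_append, ← hγ]; rfl
    · rw [hr, show 1 - γ * (a * a') = (1 - γ) + γ * ((1 - a) + a * (1 - a')) by ring]
      exact add_mem hγm' (m.mul_mem_left _ (add_mem hma (m.mul_mem_left _ hma')))
    · rw [← ha, ← MulMemClass.coe_mul, hr, mul_assoc, mul_assoc, mul_comm a' a, ← mul_assoc a a,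
        haa]
    · rw [← ha', ← MulMemClass.coe_mul, hr, mul_assoc, mul_assoc, haa']
  decides := by
    intro e he
    have he₀e : 1 - e₀ ∈ m := one_sub_mem_of_idem (Subtype.ext (stdProj_idem he₀)) hm₀
    rcases mem_diag_iff.1 he with rfl | he'
    · exact ⟨e₀, ⟨he₀, e₀, rfl, he₀e⟩, Or.inl (mul_one _)⟩
    let E : A.diagAlg := ⟨e, diag_subset_diagAlg he⟩
    have hE : E * E = E := Subtype.ext (diag_idem he)
    by_cases h : E ∈ m
    -- A complement 1 - e is not in X; multiplying by e₀ turns it into a standard projection.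
    · refine ⟨(e₀ : Unitization ℂ X) * (1 - e), ⟨stdProj_mul_one_sub he₀ he', e₀ * (1 - E), rfl,
        ?_⟩, Or.inr ?_⟩
      · rw [show 1 - e₀ * (1 - E) = (1 - e₀) + e₀ * E by ring]
        exact add_mem he₀e (m.mul_mem_left _ h)
      · rw [mul_assoc, sub_mul, one_mul, diag_idem he, sub_self, mul_zero]
    · exact ⟨e, ⟨properDiag_subset_stdProj he', E, rfl, one_sub_mem_of_idem hE h⟩,
        Or.inl (diag_idem he)⟩

/-- Every nonzero standard projection belongs to some filter. -/
theorem exists_stdFilter {p : Unitization ℂ X} (hp : p ∈ A.stdProj) (h0 : p ≠ 0) :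
    ∃ S : A.StdFilter, p ∈ S.carrier := by
  let e₀ : A.diagAlg := ⟨p, stdProj_subset_diagAlg hp⟩
  have hne : Ideal.span {1 - e₀} ≠ ⊤ := by
    intro h
    obtain ⟨a, ha⟩ := Ideal.mem_span_singleton'.1 ((Ideal.eq_top_iff_one _).1 h)
    have h1 : e₀ * e₀ = e₀ := Subtype.ext (stdProj_idem hp)
    have h2 : e₀ = 0 := by linear_combination (-e₀) * ha - a * h1
    exact h0 (congrArg Subtype.val h2)
  obtain ⟨m, hm, hle⟩ := Ideal.exists_le_maximal _ hne
  have hprime := hm.isPrime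
  have hmem : 1 - e₀ ∈ m := hle (Ideal.mem_span_singleton_self _)
  have hm₀ : e₀ ∉ m := fun h => hprime.ne_top ((Ideal.eq_top_iff_one m).2 (by
    have := add_mem hmem h
    rwa [sub_add_cancel] at this))
  exact ⟨StdFilter.ofPrime m e₀ hp hm₀, hp, e₀, rfl, hmem⟩

/-- An ideal of the diagonal algebra which meets every filter contains all `s p s*`. -/
theorem properDiag_subset_of_meets (J : Ideal A.diagAlg)
    (hJ : ∀ S : A.StdFilter, ∃ a ∈ J, (a : Unitization ℂ X) ∈ S.carrier) (E : A.diagAlg)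
    (hE : (E : Unitization ℂ X) ∈ A.properDiag) : E ∈ J := by
  -- Otherwise a maximal ideal m contains J and 1 - E. Its filter then has a member in J, which lies
  -- in m and is 1 modulo m. From the resulting equation 1 = j + a (1 - E), multiplication by E
  -- gives E = j E.
  have htop : J ⊔ Ideal.span {1 - E} = ⊤ := by
    by_contra hne
    obtain ⟨m, hm, hle⟩ := Ideal.exists_le_maximal _ hne
    have hprime := hm.isPrime
    have hmem : 1 - E ∈ m := hle (Ideal.mem_sup_right (Ideal.mem_span_singleton_self _))
    have hm₀ : E ∉ m := fun h => hprime.ne_top ((Ideal.eq_top_iff_one m).2 (by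
      have := add_mem hmem h
      rwa [sub_add_cancel] at this))
    obtain ⟨a, haJ, -, b, hb, hbm⟩ :=
      hJ (StdFilter.ofPrime m E (properDiag_subset_stdProj hE) hm₀)
    rw [Subtype.ext hb] at hbm
    refine hprime.ne_top ((Ideal.eq_top_iff_one m).2 ?_)
    have := add_mem hbm (hle (Ideal.mem_sup_left haJ))
    rwa [sub_add_cancel] at this
  obtain ⟨j, hj, b, hb, h1⟩ := Submodule.mem_sup.1 ((Ideal.eq_top_iff_one _).1 htop)
  obtain ⟨a, rfl⟩ := Ideal.mem_span_singleton'.1 hb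
  have hEE : E * E = E := Subtype.ext (diag_idem (properDiag_subset hE))
  have : E = j * E := by linear_combination (-E) * h1 - a * hEE
  rw [this]
  exact J.mul_mem_right _ hj

/-- A standard word carries a diagonal projection on its right, so whether it survives along a
filter is decided inside the diagonal algebra. -/
theorem stdWord_eq_mul {s p t : Unitization ℂ X} (ht : t ∈ A.T₁) (hp : p ∈ A.P₁) :
    s * p * star t = s * star t * (t * p * star t) := by
  have h := congrArg star (T₁_isometry ht)
  rw [star_mul, star_mul, star_star] at h
  calc s * p * star t = s * p * (star t * t * star t) := by rw [mul_assoc (star t), h]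
    _ = s * (p * (star t * t)) * star t := by simp only [mul_assoc]
    _ = _ := by rw [P₁_comm hp (star_mul_self_mem_P₁ ht)]; simp only [mul_assoc]

/-- A standard word s p t* is annihilated from the right by 1 - t p t*, which is 1 modulo J; for
sums, multiply the annihilators. X may lack a unit, so it is not enough to know that J is large:
this supplies the missing complement. -/
theorem exists_right_annihilator (J : Ideal A.diagAlg)
    (hJ : ∀ E : A.diagAlg, (E : Unitization ℂ X) ∈ A.properDiag → E ∈ J) (y : X) :
    ∃ a : A.diagAlg, 1 - a ∈ J ∧ (y : Unitization ℂ X) * a = 0 := by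
  have hadd : ∀ x y : X, (∃ a : A.diagAlg, 1 - a ∈ J ∧ (x : Unitization ℂ X) * a = 0) →
      (∃ a : A.diagAlg, 1 - a ∈ J ∧ (y : Unitization ℂ X) * a = 0) →
      ∃ a : A.diagAlg, 1 - a ∈ J ∧ ((x + y : X) : Unitization ℂ X) * a = 0 := by
    rintro x y ⟨a, ha, hxa⟩ ⟨b, hb, hyb⟩
    refine ⟨a * b, ?_, ?_⟩
    · rw [show 1 - a * b = (1 - a) + a * (1 - b) by ring]
      exact add_mem ha (J.mul_mem_left _ hb)
    · rw [inr_add, add_mul, MulMemClass.coe_mul, ← mul_assoc, hxa, zero_mul, zero_add,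
        diagAlg_comm a.2 b.2, ← mul_assoc, hyb, zero_mul]
  have h0 : ∃ a : A.diagAlg, 1 - a ∈ J ∧ ((0 : X) : Unitization ℂ X) * a = 0 :=
    ⟨1, by rw [sub_self]; exact zero_mem _, by simp⟩
  induction y using A.gr_induction with
  | zero => exact h0
  | add x y hx hy => exact hadd x y hx hy
  | gr n x hx =>
    have hx' := gr_le_stdWords n hx
    clear hx
    induction hx' using Submodule.span_induction with
    | zero => exact h0
    | add x y _ _ hx hy => exact hadd x y hx hy
    | smul c x _ hx =>
      obtain ⟨a, ha, h⟩ := hx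
      exact ⟨a, ha, by rw [inr_smul, smul_mul_assoc, h, smul_zero]⟩
    | mem x hx =>
      obtain ⟨s, hs, p, hp, t, ht, hx, -⟩ := hx
      have hE : t * p * star t ∈ A.properDiag := ⟨t, ht, p, hp, rfl⟩
      have hEd := properDiag_subset hE
      refine ⟨1 - ⟨_, diag_subset_diagAlg hEd⟩, ?_, ?_⟩
      · rw [sub_sub_cancel]
        exact hJ _ hE
      · change (x : Unitization ℂ X) * (1 - t * p * star t) = 0
        rw [hx, stdWord_eq_mul ht (Pinr_subset_P₁ hp), mul_assoc, mul_sub, mul_one,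
          diag_idem hEd, sub_self, mul_zero]

/-- An element which is annihilated by some member of each filter vanishes. -/
theorem eq_zero_of_forall_stdFilter (y : X)
    (h : ∀ S : A.StdFilter, ∃ q ∈ S.carrier, (y : Unitization ℂ X) * q = 0) : y = 0 := by
  -- J consists of the right annihilators of y. Once J contains all s p s*, y is killed both by some
  -- a with 1 - a in J and by 1 - a.
  let J : Ideal A.diagAlg :=
    { carrier := {a | (y : Unitization ℂ X) * a = 0}
      zero_mem' := by simp
      add_mem' := fun {a b} ha hb => by
        change (y : Unitization ℂ X) * (a + b) = 0
        rw [mul_add, show (y : Unitization ℂ X) * a = 0 from ha,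
          show (y : Unitization ℂ X) * b = 0 from hb, add_zero]
      smul_mem' := fun c a ha => by
        change (y : Unitization ℂ X) * (c * a) = 0
        rw [diagAlg_comm c.2 a.2, ← mul_assoc, show (y : Unitization ℂ X) * a = 0 from ha,
          zero_mul] }
  have hJ := properDiag_subset_of_meets J fun S => by
    obtain ⟨q, hq, hy⟩ := h S
    exact ⟨⟨q, stdProj_subset_diagAlg (S.std q hq)⟩, hy, hq⟩
  obtain ⟨a, ha, hya⟩ := exists_right_annihilator J hJ y
  have ha' : (y : Unitization ℂ X) * (1 - a) = 0 := ha
  rw [mul_sub, hya, mul_one, sub_zero] at ha'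
  exact inr_injective (R := ℂ) ha'

end SemigraphAlgebra

namespace SemigraphAlgebra

variable {k X : Type*} [NonUnitalRing X] [StarRing X] [Module ℂ X] [IsScalarTower ℂ X X]
  [SMulCommClass ℂ X X] [StarModule ℂ X] {A : SemigraphAlgebra k X}

/-! ### Compressions by standard projections -/

namespace StdFilter

variable (S : A.StdFilter)

theorem idem {q : Unitization ℂ X} (hq : q ∈ S.carrier) : q * q = q := stdProj_idem (S.std q hq)

theorem star_eq {q : Unitization ℂ X} (hq : q ∈ S.carrier) : star q = q := stdProj_star (S.std q hq)

theorem mem_diagAlg {q : Unitization ℂ X} (hq : q ∈ S.carrier) : q ∈ A.diagAlg :=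
  stdProj_subset_diagAlg (S.std q hq)

theorem mul_comm_of_mem {q a : Unitization ℂ X} (hq : q ∈ S.carrier) (ha : a ∈ A.diagAlg) :
    q * a = a * q := diagAlg_comm (S.mem_diagAlg hq) ha

theorem decides_finset (F : Finset (Unitization ℂ X)) (hF : ∀ e ∈ F, e ∈ A.diag) :
    ∃ q ∈ S.carrier, ∀ e ∈ F, q * e = q ∨ q * e = 0 := by
  classical
  induction F using Finset.induction_on with
  | empty => exact ⟨S.nonempty.some, S.nonempty.some_mem, by simp⟩
  | insert e F _ ih =>
    obtain ⟨q, hq, h⟩ := ih fun f hf => hF f (Finset.mem_insert_of_mem hf)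
    obtain ⟨q', hq', h'⟩ := S.decides e (hF e (Finset.mem_insert_self _ _))
    obtain ⟨r, hr, h1, h2⟩ := S.directed q hq q' hq'
    refine ⟨r, hr, fun f hf => ?_⟩
    rcases Finset.mem_insert.1 hf with rfl | hf
    · rw [← h2, mul_assoc]
      rcases h' with h' | h' <;> simp [h']
    · rw [← h1, mul_assoc]
      rcases h f hf with h | h <;> simp [h]

end StdFilter

theorem star_mul_isometry {t : Unitization ℂ X} (ht : t ∈ A.T₁) : star t * t * star t = star t := by
  have := congrArg star (T₁_isometry ht)
  rwa [star_mul, star_mul, star_star, ← mul_assoc] at this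

theorem mem_diag_of_mem_P₁ {p : Unitization ℂ X} (hp : p ∈ A.P₁) : p ∈ A.diag :=
  ⟨1, one_mem_T₁, p, hp, by simp⟩

/-- The projections s* s and α α* are both diagonal, hence commute. -/
theorem star_mul_ext {s α : Unitization ℂ X} (hs : s ∈ A.T₁) (hα : α ∈ A.T₁) :
    star s * (s * α * star (s * α)) = α * star (s * α) := by
  have h := diag_comm (mem_diag_of_mem_P₁ (star_mul_self_mem_P₁ hs)) (mul_star_mem_diag hα)
  calc star s * (s * α * star (s * α)) = (star s * s) * (α * star α) * star s := by
        simp only [star_mul, mul_assoc]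
    _ = α * star α * (star s * s * star s) := by rw [h]; simp only [mul_assoc]
    _ = _ := by rw [star_mul_isometry hs, star_mul, mul_assoc]

/-- Passing from s to an extension s α merely cuts the projection s p s* down by the range of s α.
This preserves admissibility when a presentation is extended. -/
theorem conj_ext {s α p : Unitization ℂ X} (hs : s ∈ A.T₁) (hα : α ∈ A.T₁) (hp : p ∈ A.P₁) :
    s * α * (star α * p * α) * star (s * α) = s * p * star s * (s * α * star (s * α)) := by
  have hαd := mul_star_mem_diag hα
  have h := diag_comm (mem_diag_of_mem_P₁ hp) hαd
  have h2 := P₁_comm hp (star_mul_self_mem_P₁ hs)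
  have e1 : s * α * (star α * p * α) * star (s * α) = s * p * (α * star α) * star s := by
    calc s * α * (star α * p * α) * star (s * α)
        = s * ((α * star α) * p) * (α * star α) * star s := by simp only [star_mul, mul_assoc]
      _ = s * p * ((α * star α) * (α * star α)) * star s := by
        rw [← h]; simp only [mul_assoc]
      _ = _ := by rw [diag_idem hαd]
  have e2 : s * p * star s * (s * α * star (s * α)) = s * p * (α * star α) * star s := by
    calc s * p * star s * (s * α * star (s * α))
        = s * (p * (star s * s)) * (α * star α) * star s := by simp only [star_mul, mul_assoc]
      _ = (s * star s * s) * p * (α * star α) * star s := by rw [h2]; simp only [mul_assoc]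
      _ = _ := by rw [T₁_isometry hs]
  rw [e1, e2]

/-- Two elements of `T₁` whose range projections belong to a filter have a common extension with
the same property. -/
theorem StdFilter.exists_ext (S : A.StdFilter) {s t q q' : Unitization ℂ X} (hs : s ∈ A.T₁)
    (ht : t ∈ A.T₁) (hq : q ∈ S.carrier) (hq' : q' ∈ S.carrier) (h : s * star s * q = q)
    (h' : t * star t * q' = q') :
    ∃ r ∈ S.carrier, ∃ α ∈ A.T₁, ∃ β ∈ A.T₁, r * q = r ∧ r * q' = r ∧ s * α = t * β ∧
      s * α ∈ A.T₁ ∧ s * α * star (s * α) * r = r := by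
  classical
  obtain ⟨c, hc, hexp⟩ := diag_mul_expand hs ht one_mem_P₁ one_mem_P₁
  rw [mul_one, mul_one] at hexp
  let e : Unitization ℂ X × Unitization ℂ X → Unitization ℂ X :=
    fun a => s * a.1 * c a * star (s * a.1)
  have hmem : ∀ a ∈ extFinset hs ht, e a ∈ A.diag := fun a ha =>
    ⟨_, ext_mul_mem hs (mem_extFinset.1 ha), _, (hc a ha).1, rfl⟩
  obtain ⟨r₀, hr₀, hdec⟩ := S.decides_finset ((extFinset hs ht).image e) (by
    intro f hf
    obtain ⟨a, ha, rfl⟩ := Finset.mem_image.1 hf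
    exact hmem a ha)
  obtain ⟨r₁, hr₁, h1, h2⟩ := S.directed q hq q' hq'
  obtain ⟨r, hr, h3, h4⟩ := S.directed r₀ hr₀ r₁ hr₁
  have hrq : r * q = r := by rw [← h4, mul_assoc, h1]
  have hrq' : r * q' = r := by rw [← h4, mul_assoc, h2]
  have hsd := diag_subset_diagAlg (mul_star_mem_diag hs)
  have htd := diag_subset_diagAlg (mul_star_mem_diag ht)
  have hrs : r * (s * star s) = r := by
    rw [← hrq, mul_assoc, S.mul_comm_of_mem hq hsd, h]
  have hrt : r * (t * star t) = r := by
    rw [← hrq', mul_assoc, S.mul_comm_of_mem hq' htd, h']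
  have hsum : r = ∑ a ∈ extFinset hs ht, r * e a := by
    rw [← Finset.mul_sum, ← hexp, ← mul_assoc, hrs, hrt]
  -- r lies below both s s* and t t*, whose product is the sum of the e(a), so not all r e(a)
  -- vanish. As r decides every e(a), it lies below one of them.
  have hex : ∃ a ∈ extFinset hs ht, r * e a ≠ 0 := by
    by_contra hcon
    push Not at hcon
    rw [Finset.sum_eq_zero hcon] at hsum
    exact S.ne_zero r hr hsum
  obtain ⟨a, ha, hra⟩ := hex
  have ha' := mem_extFinset.1 ha
  have hv := ext_mul_mem hs ha'
  have hra1 : r * e a = r := by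
    rcases hdec (e a) (Finset.mem_image_of_mem _ ha) with hd | hd
    · rw [← h3, mul_assoc, hd]
    · rw [← h3, mul_assoc, hd, mul_zero] at hra
      exact absurd rfl hra
  refine ⟨r, hr, a.1, ha'.1, a.2, ha'.2.1, hrq, hrq', ext_eq ha', hv, ?_⟩
  rw [← S.mul_comm_of_mem hr (diag_subset_diagAlg (mul_star_mem_diag hv)), ← hra1, mul_assoc]
  congr 1
  change s * a.1 * c a * star (s * a.1) * (s * a.1 * star (s * a.1)) =
    s * a.1 * c a * star (s * a.1)
  rw [mul_assoc, ← mul_assoc (star (s * a.1)), star_mul_isometry hv]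

/-- The elements `u` of `T₁` of degree `d s + n` such that `q` is below the range projection of
`s u*`. -/
def admissible (A : SemigraphAlgebra k X) (n : k →₀ ℤ) (q s : Unitization ℂ X) :
    Set (Unitization ℂ X) :=
  {u | u ∈ A.T₁ ∧ intDeg (A.d u) = intDeg (A.d s) + n ∧ s * (star u * u) * star s * q = q}

/-- A presentation `x q = (∑ λ_u u) s* q`. -/
def Presents (A : SemigraphAlgebra k X) (n : k →₀ ℤ) (x q s : Unitization ℂ X)
    (l : Unitization ℂ X →₀ ℂ) : Prop :=
  s ∈ A.T₁ ∧ (∀ u ∈ l.support, u ∈ admissible A n q s) ∧ s * star s * q = q ∧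
    x * q = Finsupp.linearCombination ℂ id l * star s * q

/-- Since r lies below the range of s α, that range projection may be inserted after s*, turning u
s* into (u α)(s α)*. No u α vanishes, because the nonzero r remains below s α (u α)*(u α)(s α)*. -/
theorem Presents.extend {n : k →₀ ℤ} {x q s : Unitization ℂ X} {l : Unitization ℂ X →₀ ℂ}
    (S : A.StdFilter) (hq : q ∈ S.carrier) (h : Presents A n x q s l) {r α : Unitization ℂ X}
    (hr : r ∈ S.carrier) (hrq : r * q = r) (hα : α ∈ A.T₁) (hv : s * α ∈ A.T₁)
    (hvr : s * α * star (s * α) * r = r) :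
    Presents A n x r (s * α) (l.mapDomain (· * α)) := by
  classical
  obtain ⟨hs, hl, hsq, hx⟩ := h
  have hqr : q * r = r := by rw [← S.mul_comm_of_mem hr (S.mem_diagAlg hq), hrq]
  refine ⟨hv, ?_, hvr, ?_⟩
  · intro w hw
    obtain ⟨u, hu, rfl⟩ := Finset.mem_image.1 (Finsupp.mapDomain_support hw)
    obtain ⟨hu1, hu2, hu3⟩ := hl u hu
    have key : s * α * (star (u * α) * (u * α)) * star (s * α) * r = r := by
      have e : star (u * α) * (u * α) = star α * (star u * u) * α := by
        simp only [star_mul, mul_assoc]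
      rw [e, conj_ext hs hα (star_mul_self_mem_P₁ hu1), mul_assoc, hvr, ← hqr, ← mul_assoc, hu3]
    have hne : u * α ≠ 0 := fun h0 => S.ne_zero r hr (by rw [← key, h0]; simp)
    refine ⟨mul_mem_T₁ hu1 hα hne, ?_, key⟩
    rw [d_mul hu1 hα hne, d_mul_of_mem hs hα hv, map_add, map_add, hu2]
    abel
  · have h1 : Finsupp.linearCombination ℂ id (l.mapDomain (· * α)) =
        Finsupp.linearCombination ℂ id l * α := by
      rw [Finsupp.linearCombination_mapDomain, Finsupp.linearCombination_apply,
        Finsupp.linearCombination_apply, Finsupp.sum, Finsupp.sum, Finset.sum_mul]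
      exact Finset.sum_congr rfl fun u _ => by simp
    calc x * r = x * q * r := by rw [mul_assoc, hqr]
      _ = Finsupp.linearCombination ℂ id l * star s * r := by rw [hx, mul_assoc, hqr]
      _ = Finsupp.linearCombination ℂ id l * (star s * (s * α * star (s * α))) * r := by
        rw [mul_assoc, mul_assoc, mul_assoc (star s), hvr]
      _ = _ := by rw [star_mul_ext hs hα, h1]; simp only [mul_assoc]

/-- If the filter rejects t p t* or t (s* s) t*, the word vanishes on a member and the zero
combination presents it. Otherwise both projections are absorbed and the word acts as s t*. -/
theorem exists_presents_stdWord (S : A.StdFilter) {n : k →₀ ℤ} {x : X} (hx : x ∈ A.stdWords n) :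
    ∃ q ∈ S.carrier, ∃ s l, Presents A n x q s l := by
  obtain ⟨s, hs, p, hp, t, ht, hx, hn⟩ := hx
  have hp₁ := Pinr_subset_P₁ hp
  have hss := star_mul_self_mem_P₁ hs
  have htt := star_mul_self_mem_P₁ ht
  have hE : t * p * star t ∈ A.diag := ⟨t, ht, p, hp₁, rfl⟩
  have hE' : t * (star s * s) * star t ∈ A.diag := ⟨t, ht, _, hss, rfl⟩
  have hzero : ∀ q : Unitization ℂ X, (x : Unitization ℂ X) * q = 0 →
      Presents A n x q 1 0 := fun q h =>
    ⟨one_mem_T₁, by simp, by simp, by simp [h]⟩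
  have hx1 : (x : Unitization ℂ X) = s * star t * (t * p * star t) := by
    rw [hx, stdWord_eq_mul ht hp₁]
  have hst : s * star t = s * star t * (t * (star s * s) * star t) := by
    calc s * star t = s * (star s * s) * star t := by rw [← mul_assoc s, T₁_isometry hs]
      _ = _ := stdWord_eq_mul ht hss
  obtain ⟨q, hq, h⟩ := S.decides _ hE
  obtain ⟨q', hq', h'⟩ := S.decides _ hE'
  rcases h with h | h
  swap
  · refine ⟨q, hq, 1, 0, hzero q ?_⟩
    rw [hx1, mul_assoc, ← S.mul_comm_of_mem hq (diag_subset_diagAlg hE), h, mul_zero]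
  rcases h' with h' | h'
  swap
  · refine ⟨q', hq', 1, 0, hzero q' ?_⟩
    rw [hx1, hst, mul_assoc, mul_assoc, diagAlg_comm (diag_subset_diagAlg hE')
      (mul_mem (diag_subset_diagAlg hE) (S.mem_diagAlg hq')), mul_assoc (t * p * star t), h',
      mul_zero, mul_zero]
  obtain ⟨r, hr, h1, h2⟩ := S.directed q hq q' hq'
  have hrE : t * p * star t * r = r := by
    rw [← S.mul_comm_of_mem hr (diag_subset_diagAlg hE), ← h1, mul_assoc, h]
  have hrE' : t * (star s * s) * star t * r = r := by
    rw [← S.mul_comm_of_mem hr (diag_subset_diagAlg hE'), ← h2, mul_assoc, h']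
  refine ⟨r, hr, t, Finsupp.single s 1, ht, ?_, ?_, ?_⟩
  · intro u hu
    have := Finsupp.support_single_subset hu
    rw [Finset.mem_singleton] at this
    subst this
    exact ⟨hs, by rw [← hn]; abel, hrE'⟩
  · rw [← hrE, ← mul_assoc, ← mul_assoc, ← mul_assoc, T₁_isometry ht]
  · rw [hx1, mul_assoc, hrE]
    simp

/-- Every homogeneous element has a presentation along every filter. -/
theorem exists_presents (S : A.StdFilter) {n : k →₀ ℤ} {x : X} (hx : x ∈ A.gr n) :
    ∃ q ∈ S.carrier, ∃ s l, Presents A n x q s l := by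
  classical
  have hx' := gr_le_stdWords n hx
  clear hx
  induction hx' using Submodule.span_induction with
  | mem x hx => exact exists_presents_stdWord S hx
  | zero =>
    exact ⟨S.nonempty.some, S.nonempty.some_mem, 1, 0, one_mem_T₁, by simp, by simp, by simp⟩
  | smul c x _ hx =>
    obtain ⟨q, hq, s, l, hs, hl, h1, h2⟩ := hx
    refine ⟨q, hq, s, c • l, hs, fun u hu => hl u (Finsupp.support_smul hu), h1, ?_⟩
    rw [inr_smul, map_smul, smul_mul_assoc, h2, smul_mul_assoc, smul_mul_assoc]
  | add x y _ _ hx hy =>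
    obtain ⟨q, hq, s, l, h⟩ := hx
    obtain ⟨q', hq', s', l', h'⟩ := hy
    -- Presentations can be added only over the same base; both are moved to a common extension s α
    -- = s' β accepted by the filter.
    obtain ⟨r, hr, α, hα, β, hβ, h1, h2, h3, h4, h5⟩ :=
      S.exists_ext h.1 h'.1 hq hq' h.2.2.1 h'.2.2.1
    have e := h.extend S hq hr h1 hα h4 h5
    have e' := h'.extend S hq' hr h2 hβ (h3 ▸ h4) (h3 ▸ h5)
    rw [← h3] at e'
    refine ⟨r, hr, s * α, l.mapDomain (· * α) + l'.mapDomain (· * β), h4, ?_, h5, ?_⟩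
    · intro u hu
      rcases Finset.mem_union.1 (Finsupp.support_add hu) with hu | hu
      · exact e.2.1 u hu
      · exact e'.2.1 u hu
    · rw [inr_add, add_mul, e.2.2.2, e'.2.2.2, map_add, add_mul, add_mul]

/-- In degree zero every u has the degree of s, so s* u = 0 unless u = s. Inserting s s* next to q
leaves only the coefficient of s. -/
theorem exists_compress (S : A.StdFilter) {x : X} (hx : x ∈ A.gr 0) :
    ∃ q ∈ S.carrier, ∃ c : ℂ, q * x * q = c • q := by
  obtain ⟨q, hq, s, l, hs, hl, h1, h2⟩ := exists_presents S hx
  refine ⟨q, hq, l s, ?_⟩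
  have hqs : q * (s * star s) = q := by
    rw [S.mul_comm_of_mem hq (diag_subset_diagAlg (mul_star_mem_diag hs)), h1]
  rw [mul_assoc, h2, Finsupp.linearCombination_apply, Finsupp.sum, Finset.sum_mul, Finset.sum_mul,
    Finset.mul_sum, Finset.sum_eq_single s]
  · rw [id, smul_mul_assoc, smul_mul_assoc, h1, mul_smul_comm, S.idem hq]
  · intro u hu hus
    obtain ⟨hu1, hu2, -⟩ := hl u hu
    have h0 : star s * u = 0 := star_mul_eq_zero hs hu1
      (intDeg_injective (by rw [hu2, add_zero])) (Ne.symm hus)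
    rw [id, smul_mul_assoc, smul_mul_assoc, mul_smul_comm, ← hqs]
    have : q * (s * star s) * (u * star s * (q * (s * star s))) =
        q * s * (star s * u) * star s * (q * (s * star s)) := by simp only [mul_assoc]
    rw [this, h0]; simp
  · intro h
    rw [Finsupp.notMem_support_iff.1 h]
    simp

/-- All u have the same degree, so their ranges are orthogonal and the cross terms vanish. Each s u*
u s* lies above q, so the scalar is ∑ |λ_u|²; it vanishes only if all coefficients do. -/
theorem exists_compress_star_mul_self (S : A.StdFilter) {n : k →₀ ℤ} {x : X} (hx : x ∈ A.gr n) :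
    ∃ q ∈ S.carrier, ∃ c : ℝ, 0 ≤ c ∧ q * (star x * x : X) * q = (c : ℂ) • q ∧
      (c = 0 → (x : Unitization ℂ X) * q = 0) := by
  obtain ⟨q, hq, s, l, hs, hl, h1, h2⟩ := exists_presents S hx
  refine ⟨q, hq, ∑ u ∈ l.support, ‖l u‖ ^ 2, Finset.sum_nonneg fun _ _ => by positivity, ?_, ?_⟩
  · have hL : star (Finsupp.linearCombination ℂ id l) * Finsupp.linearCombination ℂ id l =
        ∑ u ∈ l.support, ((‖l u‖ ^ 2 : ℝ) : ℂ) • (star u * u) := by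
      rw [Finsupp.linearCombination_apply, Finsupp.sum, star_sum, Finset.sum_mul]
      refine Finset.sum_congr rfl fun u hu => ?_
      rw [Finset.mul_sum, Finset.sum_eq_single u]
      · rw [id, star_smul, smul_mul_assoc, mul_smul_comm, smul_smul]
        congr 1
        rw [mul_comm, Complex.star_def, Complex.mul_conj, Complex.normSq_eq_norm_sq]
      · intro v hv hvu
        have : star u * v = 0 := star_mul_eq_zero (hl u hu).1 (hl v hv).1
          (intDeg_injective (by rw [(hl u hu).2.1, (hl v hv).2.1])) (Ne.symm hvu)
        rw [id, id, star_smul, smul_mul_assoc, mul_smul_comm, this, smul_zero, smul_zero]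
      · exact fun h => absurd hu h
    have e : q * (star x * x : X) * q = star ((x : Unitization ℂ X) * q) * (x * q) := by
      rw [star_mul, S.star_eq hq, inr_mul, inr_star]; simp only [mul_assoc]
    have e2 : star (Finsupp.linearCombination ℂ id l * star s * q) *
        (Finsupp.linearCombination ℂ id l * star s * q) = q * (s *
        (star (Finsupp.linearCombination ℂ id l) * Finsupp.linearCombination ℂ id l) * star s * q) := by
      rw [star_mul, star_mul, star_star, S.star_eq hq]; simp only [mul_assoc]
    rw [e, h2, e2, hL, Finset.mul_sum, Finset.sum_mul, Finset.sum_mul, Complex.ofReal_sum,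
      Finset.sum_smul, Finset.mul_sum]
    refine Finset.sum_congr rfl fun u hu => ?_
    rw [mul_smul_comm, smul_mul_assoc, smul_mul_assoc, (hl u hu).2.2, mul_smul_comm, S.idem hq]
  · intro hc
    rw [Finset.sum_eq_zero_iff_of_nonneg fun _ _ => by positivity] at hc
    have : l = 0 := by
      ext u
      by_cases hu : u ∈ l.support
      · simpa using hc u hu
      · simpa using hu
    rw [h2, this]
    simp

/-! ### The functional of a filter -/

theorem properDiag_mem_gr {e : Unitization ℂ X} (he : e ∈ A.properDiag) :
    ∃ y ∈ A.gr 0, (y : Unitization ℂ X) = e := by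
  obtain ⟨x, hx⟩ := exists_inr_of_properDiag he
  obtain ⟨s, hs, p, hp, rfl⟩ := he
  obtain ⟨u, rfl, hu⟩ := exists_word_of_stdWords (A := A) (n := 0)
    (w := x) ⟨s, hs, p, hp, s, hs, hx, sub_self _⟩
  exact ⟨_, hu ▸ mem_gr_of_word u, hx⟩

theorem stdProj_mem_gr {x : X} (hx : (x : Unitization ℂ X) ∈ A.stdProj) : x ∈ A.gr 0 := by
  obtain ⟨e, he, L, hL, h⟩ := hx
  have : ∀ L : List (Unitization ℂ X), (∀ f ∈ L, f ∈ A.properDiag) → ∀ y ∈ A.gr 0,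
      ∃ z ∈ A.gr 0, (z : Unitization ℂ X) = y * (L.map fun f => 1 - f).prod := by
    intro L
    induction L with
    | nil => exact fun _ y hy => ⟨y, hy, by simp⟩
    | cons f L ih =>
      intro hL y hy
      obtain ⟨g, hg, rfl⟩ := properDiag_mem_gr (hL f List.mem_cons_self)
      obtain ⟨z, hz, h⟩ := ih (fun f hf => hL f (List.mem_cons_of_mem _ hf)) (y - y * g)
        (sub_mem hy (by simpa using gr_mul hy hg))
      refine ⟨z, hz, ?_⟩
      rw [h, List.map_cons, List.prod_cons, inr_sub, inr_mul, ← mul_assoc, mul_sub, mul_one]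
  obtain ⟨y, hy, rfl⟩ := properDiag_mem_gr he
  obtain ⟨z, hz, h'⟩ := this L hL y hy
  rw [← h] at h'
  rwa [← inr_injective h']

namespace StdFilter

variable (S : A.StdFilter)

theorem compress_of_le {q r x : Unitization ℂ X} {c : ℂ} (hq : q ∈ S.carrier)
    (hr : r ∈ A.stdProj) (hrq : r * q = r) (h : q * x * q = c • q) : r * x * r = c • r := by
  have hqr : q * r = r := by
    rw [← diagAlg_comm (stdProj_subset_diagAlg hr) (S.mem_diagAlg hq), hrq]
  calc r * x * r = r * q * x * (q * r) := by rw [hrq, hqr]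
    _ = r * (q * x * q) * r := by simp only [mul_assoc]
    _ = c • r := by rw [h, mul_smul_comm, smul_mul_assoc, hrq, stdProj_idem hr]

theorem compress_unique {x : Unitization ℂ X} {q q' : Unitization ℂ X} {c c' : ℂ}
    (hq : q ∈ S.carrier) (hq' : q' ∈ S.carrier) (h : q * x * q = c • q)
    (h' : q' * x * q' = c' • q') : c = c' := by
  obtain ⟨r, hr, h1, h2⟩ := S.directed q hq q' hq'
  have e := (S.compress_of_le hq (S.std r hr) h1 h).symm.trans
    (S.compress_of_le hq' (S.std r hr) h2 h')
  rw [← sub_eq_zero, ← sub_smul] at e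
  exact sub_eq_zero.1 ((smul_eq_zero.1 e).resolve_right (S.ne_zero r hr))

/-- The scalar persists on smaller members of the filter and is unique because members are nonzero;
directedness then gives additivity. -/
theorem exists_functional : ∃ F : X →ₗ[ℂ] ℂ, ∀ x, ∃ q ∈ S.carrier,
    q * (A.dec x 0 : X) * q = F x • q := by
  choose q hq c hc using fun x : X => exists_compress S (A.dec_mem x 0)
  refine ⟨⟨⟨c, fun x y => ?_⟩, fun a x => ?_⟩, fun x => ⟨q x, hq x, hc x⟩⟩
  · obtain ⟨r, hr, h1, h2⟩ := S.directed _ (hq x) _ (hq y)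
    refine S.compress_unique (hq (x + y)) hr (hc (x + y)) ?_
    rw [map_add, Finsupp.add_apply, inr_add, mul_add, add_mul,
      S.compress_of_le (hq x) (S.std r hr) h1 (hc x),
      S.compress_of_le (hq y) (S.std r hr) h2 (hc y), add_smul]
  · refine S.compress_unique (hq (a • x)) (hq x) (hc (a • x)) ?_
    rw [map_smul, Finsupp.smul_apply, inr_smul, mul_smul_comm, smul_mul_assoc, hc x, smul_smul]
    rfl

/-- The functional of a filter: `f x` is the number `c` such that `q E(x) q = c q` for some `q` in
the filter, where `E(x)` is the component of degree zero. -/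
noncomputable def functional : X →ₗ[ℂ] ℂ := S.exists_functional.choose

theorem functional_spec (x : X) : ∃ q ∈ S.carrier,
    q * (A.dec x 0 : X) * q = S.functional x • q := S.exists_functional.choose_spec x

theorem functional_eq {x : X} {q : Unitization ℂ X} {c : ℂ} (hq : q ∈ S.carrier)
    (h : q * (A.dec x 0 : X) * q = c • q) : S.functional x = c := by
  obtain ⟨q', hq', h'⟩ := S.functional_spec x
  exact S.compress_unique hq' hq h' h

theorem functional_dec (x : X) : S.functional (A.dec x 0) = S.functional x := by
  obtain ⟨q, hq, h⟩ := S.functional_spec x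
  refine S.functional_eq hq ?_
  rw [dec_of_mem_gr (A.dec_mem x 0), Finsupp.single_eq_same, h]

theorem functional_of_mem {x : X} (hx : (x : Unitization ℂ X) ∈ S.carrier) :
    S.functional x = 1 := by
  refine S.functional_eq hx ?_
  rw [dec_of_mem_gr (stdProj_mem_gr (S.std _ hx)), Finsupp.single_eq_same, S.idem hx, S.idem hx,
    one_smul]

theorem functional_star_mul_self_of_mem_gr {n : k →₀ ℤ} {x : X} (hx : x ∈ A.gr n) :
    ∃ c : ℝ, 0 ≤ c ∧ S.functional (star x * x) = c := by
  obtain ⟨q, hq, c, hc, h, -⟩ := exists_compress_star_mul_self S hx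
  refine ⟨c, hc, S.functional_eq hq ?_⟩
  have : star x * x ∈ A.gr 0 := by simpa using gr_mul (gr_star hx) hx
  rw [dec_of_mem_gr this, Finsupp.single_eq_same, h]

end StdFilter

theorem dec_mul_of_mem_gr {m : k →₀ ℤ} {a : X} (ha : a ∈ A.gr m) (x : X) (n : k →₀ ℤ) :
    A.dec (a * x) (m + n) = a * A.dec x n := by
  classical
  induction x using A.gr_induction with
  | zero => simp
  | add x y hx hy => rw [mul_add, map_add A.dec, map_add A.dec, Finsupp.add_apply,
      Finsupp.add_apply, hx, hy, mul_add]
  | gr l x hx =>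
    rw [dec_of_mem_gr (gr_mul ha hx), dec_of_mem_gr hx, Finsupp.single_apply, Finsupp.single_apply]
    by_cases h : l = n
    · simp [h]
    · simp [h]

theorem dec_star (x : X) (n : k →₀ ℤ) : A.dec (star x) n = star (A.dec x (-n)) := by
  classical
  induction x using A.gr_induction with
  | zero => simp
  | add x y hx hy => rw [star_add, map_add, map_add, Finsupp.add_apply, Finsupp.add_apply, hx, hy,
      star_add]
  | gr l x hx =>
    rw [dec_of_mem_gr (gr_star hx), dec_of_mem_gr hx, Finsupp.single_apply, Finsupp.single_apply]
    by_cases h : -l = n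
    · subst h; simp
    · have h' : l ≠ -n := fun h' => h (by rw [h', neg_neg])
      rw [if_neg h, if_neg h', star_zero]

theorem dec_star_mul (x y : X) :
    A.dec (star x * y) 0 = (A.dec x).sum fun n a => star a * A.dec y n := by
  have h : ∀ x : X, A.dec (star x * y) 0 =
      Finsupp.liftAddHom (fun n : k →₀ ℤ => (AddMonoidHom.mulRight (A.dec y n)).comp
        (starAddEquiv : X ≃+ X).toAddMonoidHom) (A.dec x) := fun x => by
    induction x using A.gr_induction with
    | zero => simp
    | add x z hx hz => rw [star_add, add_mul, map_add, Finsupp.add_apply, hx, hz, map_add, map_add]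
    | gr n x hx =>
      rw [dec_of_mem_gr hx, Finsupp.liftAddHom_apply_single]
      have := dec_mul_of_mem_gr (gr_star hx) y n
      rw [neg_add_cancel] at this
      rw [this]; rfl
  rw [h]; rfl

namespace StdFilter

variable (S : A.StdFilter)

theorem functional_star (x : X) : S.functional (star x) = star (S.functional x) := by
  obtain ⟨q, hq, h⟩ := S.functional_spec x
  refine S.functional_eq hq ?_
  rw [dec_star, neg_zero]
  have := congrArg star h
  rw [star_mul, star_mul, S.star_eq hq, star_smul, S.star_eq hq] at this
  rw [inr_star, mul_assoc, this]

/-- The functional sees only degree zero, so components of different degree are orthogonal for the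
form F(x* y). -/
theorem functional_star_mul (x y : X) : S.functional (star x * y) =
    (A.dec x).sum fun n a => S.functional (star a * A.dec y n) := by
  rw [← S.functional_dec, dec_star_mul, Finsupp.sum, map_sum]; rfl

/-- The quadratic form of the functional. -/
noncomputable def quad (x : X) : ℝ := (S.functional (star x * x)).re

theorem quad_of_mem_gr {n : k →₀ ℤ} {x : X} (hx : x ∈ A.gr n) :
    S.functional (star x * x) = S.quad x ∧ 0 ≤ S.quad x := by
  obtain ⟨c, hc, h⟩ := S.functional_star_mul_self_of_mem_gr hx
  rw [quad, h]
  simpa using hc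

theorem functional_star_mul_self (x : X) : S.functional (star x * x) =
    (((A.dec x).sum fun _ a => S.quad a : ℝ) : ℂ) := by
  rw [S.functional_star_mul, Finsupp.sum, Finsupp.sum, Complex.ofReal_sum]
  exact Finset.sum_congr rfl fun n _ => (S.quad_of_mem_gr (A.dec_mem x n)).1

theorem quad_eq_sum (x : X) : S.quad x = (A.dec x).sum fun _ a => S.quad a := by
  rw [quad, S.functional_star_mul_self, Complex.ofReal_re]

theorem quad_nonneg (x : X) : 0 ≤ S.quad x := by
  rw [quad_eq_sum]
  exact Finset.sum_nonneg fun n _ => (S.quad_of_mem_gr (A.dec_mem x n)).2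

theorem quad_dec_le (x : X) (n : k →₀ ℤ) : S.quad (A.dec x n) ≤ S.quad x := by
  by_cases h : n ∈ (A.dec x).support
  · rw [S.quad_eq_sum x]
    exact Finset.single_le_sum (f := fun n => S.quad (A.dec x n))
      (fun n _ => S.quad_nonneg _) h
  · rw [Finsupp.notMem_support_iff.1 h]
    simpa [quad] using S.quad_nonneg x

/-- The quadratic form of a product with a homogeneous element is computed by components. -/
theorem quad_mul_of_mem_gr {m : k →₀ ℤ} {a : X} (ha : a ∈ A.gr m) (x : X) :
    S.quad (a * x) = (A.dec x).sum fun _ y => S.quad (a * y) := by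
  have h : star (a * x) * (a * x) = star x * (star a * a * x) := by
    simp only [star_mul, mul_assoc]
  have h0 : star a * a ∈ A.gr 0 := by simpa using gr_mul (gr_star ha) ha
  rw [quad, h, S.functional_star_mul, Finsupp.sum, Finsupp.sum, Complex.re_sum]
  refine Finset.sum_congr rfl fun n _ => ?_
  have := dec_mul_of_mem_gr h0 x n
  rw [zero_add] at this
  rw [this, quad]
  simp only [star_mul, mul_assoc]

end StdFilter

end SemigraphAlgebra

/-! ### The C*-seminorm of a positive functional -/

section GNS

variable {X : Type*} [NonUnitalRing X] [StarRing X] [Module ℂ X] [IsScalarTower ℂ X X]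
  [SMulCommClass ℂ X X] [StarModule ℂ X]

/-- The C*-seminorm of a bounded *-representation on a semi-inner product space. -/
theorem CStarSeminorm.exists_of_representation {H : Type*} [SeminormedAddCommGroup H]
    [InnerProductSpace ℂ H] (π : X →ₗ[ℂ] H →ₗ[ℂ] H)
    (hmul : ∀ x y ξ, π (x * y) ξ = π x (π y ξ))
    (hstar : ∀ x ξ η, inner ℂ (π x ξ) η = inner ℂ ξ (π (star x) η))
    (hbdd : ∀ x, ∃ C : ℝ, ∀ ξ, ‖π x ξ‖ ≤ C * ‖ξ‖) :
    ∃ N : CStarSeminorm X, (∀ x ξ, ‖π x ξ‖ ≤ N x * ‖ξ‖) ∧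
      ∀ x C, 0 ≤ C → (∀ ξ, ‖π x ξ‖ ≤ C * ‖ξ‖) → N x ≤ C := by
  let L : X → H →L[ℂ] H := fun x => (π x).mkContinuousOfExistsBound (hbdd x)
  have hL : ∀ x ξ, L x ξ = π x ξ := fun _ _ => rfl
  have hle : ∀ x ξ, ‖π x ξ‖ ≤ ‖L x‖ * ‖ξ‖ := fun x ξ => (L x).le_opNorm ξ
  have hLmul : ∀ x y, ‖L (x * y)‖ ≤ ‖L x‖ * ‖L y‖ := fun x y => by
    have : L (x * y) = (L x).comp (L y) := by
      ext ξ; rw [ContinuousLinearMap.comp_apply, hL, hL, hL, hmul]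
    rw [this]
    exact ContinuousLinearMap.opNorm_comp_le _ _
  have hLstar : ∀ x, ‖L x‖ * ‖L x‖ ≤ ‖L (star x * x)‖ := fun x => by
    -- The C*-inequality comes from ‖π(x)ξ‖² = ⟨ξ, π(x* x)ξ⟩ and Cauchy–Schwarz.
    have h : ‖L x‖ ≤ Real.sqrt ‖L (star x * x)‖ := by
      refine ContinuousLinearMap.opNorm_le_bound _ (Real.sqrt_nonneg _) fun ξ => ?_
      refine le_of_sq_le_sq ?_ (by positivity)
      rw [mul_pow, Real.sq_sqrt (norm_nonneg _), hL]
      calc ‖π x ξ‖ ^ 2 = (inner ℂ ξ (π (star x * x) ξ)).re := by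
            rw [hmul, ← hstar]; exact norm_sq_eq_re_inner (𝕜 := ℂ) _
        _ ≤ ‖inner ℂ ξ (π (star x * x) ξ)‖ := Complex.re_le_norm _
        _ ≤ ‖ξ‖ * ‖π (star x * x) ξ‖ := norm_inner_le_norm _ _
        _ ≤ ‖ξ‖ * (‖L (star x * x)‖ * ‖ξ‖) :=
          mul_le_mul_of_nonneg_left (hle _ _) (norm_nonneg _)
        _ = _ := by ring
    calc ‖L x‖ * ‖L x‖ ≤ Real.sqrt ‖L (star x * x)‖ * Real.sqrt ‖L (star x * x)‖ :=
          mul_le_mul h h (norm_nonneg _) (Real.sqrt_nonneg _)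
      _ = _ := Real.mul_self_sqrt (norm_nonneg _)
  have hle_star : ∀ x, ‖L x‖ ≤ ‖L (star x)‖ := fun x => by
    rcases (norm_nonneg (L x)).eq_or_lt with h | h
    · rw [← h]; exact norm_nonneg _
    · exact le_of_mul_le_mul_right ((hLstar x).trans (hLmul _ _)) h
  refine ⟨{ toFun := fun x => ‖L x‖, map_zero' := ?_, add_le' := ?_, neg' := ?_, smul' := ?_,
            mul_le' := hLmul, star_mul_self' := ?_ }, hle, ?_⟩
  · have : L 0 = 0 := by ext z; simp [hL]
    simp [this]
  · intro x y
    have : L (x + y) = L x + L y := by ext z; simp [hL]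
    rw [this]; exact norm_add_le _ _
  · intro x
    have : L (-x) = -L x := by ext z; simp [hL]
    rw [this]; exact norm_neg _
  · intro a x
    have : L (a • x) = a • L x := by ext z; simp [hL]
    rw [this]; exact norm_smul _ _
  · intro x
    refine le_antisymm ((hLmul _ _).trans (mul_le_mul_of_nonneg_right ?_ (norm_nonneg _)))
      (hLstar x)
    simpa using hle_star (star x)
  · exact fun x C hC h => ContinuousLinearMap.opNorm_le_bound _ hC h

/-- The C*-seminorm of the GNS representation of a positive functional. -/
theorem CStarSeminorm.exists_of_positive (F : X →ₗ[ℂ] ℂ) (hF : ∀ x, F (star x) = star (F x))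
    (hpos : ∀ x, 0 ≤ (F (star x * x)).re)
    (hbdd : ∀ x, ∃ C : ℝ, ∀ y, (F (star (x * y) * (x * y))).re ≤ C * (F (star y * y)).re) :
    ∃ N : CStarSeminorm X,
      (∀ x y, (F (star (x * y) * (x * y))).re ≤ N x ^ 2 * (F (star y * y)).re) ∧
      ∀ x C, 0 ≤ C → (∀ y, (F (star (x * y) * (x * y))).re ≤ C ^ 2 * (F (star y * y)).re) →
        N x ≤ C := by
  -- X with the form F(x* y) and left multiplication is used as it stands: operator seminorms make
  -- sense on a seminormed space, so neither the quotient nor the completion is formed.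
  let c : PreInnerProductSpace.Core ℂ X :=
    { inner := fun x y => F (star x * y)
      conj_inner_symm := fun x y => by
        rw [starRingEnd_apply, ← hF, star_mul, star_star]
      re_inner_nonneg := hpos
      add_left := fun x y z => by rw [star_add, add_mul, map_add]
      smul_left := fun x y r => by
        rw [star_smul, smul_mul_assoc, map_smul, smul_eq_mul, starRingEnd_apply] }
  let i1 : SeminormedAddCommGroup X := InnerProductSpace.Core.toSeminormedAddCommGroup (𝕜 := ℂ)
  let i2 : InnerProductSpace ℂ X := InnerProductSpace.ofCore c
  have hinner : ∀ x y : X, inner ℂ x y = F (star x * y) := fun _ _ => rfl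
  have hn : ∀ y : X, (F (star y * y)).re = ‖y‖ ^ 2 := fun y => by
    rw [← hinner]; exact (norm_sq_eq_re_inner (𝕜 := ℂ) y).symm
  have hbdd' : ∀ x : X, ∃ C : ℝ, ∀ y : X, ‖LinearMap.mul ℂ X x y‖ ≤ C * ‖y‖ := fun x => by
    obtain ⟨C, hC⟩ := hbdd x
    refine ⟨Real.sqrt (max C 0), fun y => ?_⟩
    refine le_of_sq_le_sq ?_ (by positivity)
    rw [mul_pow, Real.sq_sqrt (le_max_right _ _), LinearMap.mul_apply_apply, ← hn, ← hn]
    exact (hC y).trans (mul_le_mul_of_nonneg_right (le_max_left _ _) (hpos y))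
  obtain ⟨N, h1, h2⟩ := CStarSeminorm.exists_of_representation (H := X) (LinearMap.mul ℂ X)
    (fun x y z => mul_assoc x y z)
    (fun x y z => by
      rw [hinner, hinner, LinearMap.mul_apply_apply, LinearMap.mul_apply_apply, star_mul,
        mul_assoc]) hbdd'
  refine ⟨N, fun x y => ?_, fun x C hC h => h2 x C hC fun y => ?_⟩
  · rw [hn, hn, ← mul_pow]
    exact pow_le_pow_left₀ (norm_nonneg _) (h1 x y) 2
  · refine le_of_sq_le_sq ?_ (by positivity)
    rw [mul_pow, LinearMap.mul_apply_apply, ← hn, ← hn]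
    exact h y

end GNS

/-! ### The C*-seminorm of a filter. -/

namespace SemigraphAlgebra

variable {k X : Type*} [NonUnitalRing X] [StarRing X] [Module ℂ X] [IsScalarTower ℂ X X]
  [SMulCommClass ℂ X X] [StarModule ℂ X] {A : SemigraphAlgebra k X}

namespace StdFilter

variable (S : A.StdFilter)

/-- As t* t is a projection, `quad (y - t* t y)` equals `quad y - quad (t y)`, and it is
nonnegative. -/
theorem quad_isometry_mul_le {t : X} (ht : t * star t * t = t) (y : X) :
    S.quad (t * y) ≤ S.quad y := by
  have h := S.quad_nonneg (y - star t * t * y)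
  have e1 : star t * t * (star t * t) = star t * t := by
    rw [mul_assoc, ← mul_assoc t, ht]
  have e : star (y - star t * t * y) * (y - star t * t * y) =
      star y * y - star (t * y) * (t * y) := by
    have e2 : star (y - star t * t * y) = star y - star y * (star t * t) := by
      rw [star_sub, star_mul, star_mul, star_star]
    have e3 : star y * (star t * t) * (star t * t * y) = star y * (star t * t * y) := by
      rw [mul_assoc, ← mul_assoc (star t * t), e1]
    have e4 : star (t * y) * (t * y) = star y * (star t * t * y) := by
      rw [star_mul]; simp only [mul_assoc]
    rw [e2, e4, mul_sub, sub_mul, sub_mul, e3, mul_assoc (star y) (star t * t) y]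
    abel
  unfold quad at h ⊢
  rw [e, map_sub, Complex.sub_re] at h
  linarith

theorem quad_smul (c : ℂ) (x : X) : S.quad (c • x) = ‖c‖ ^ 2 * S.quad x := by
  unfold quad
  rw [star_smul, smul_mul_assoc, mul_smul_comm, smul_smul, map_smul, smul_eq_mul, mul_comm (star c),
    Complex.star_def, Complex.mul_conj, Complex.re_ofReal_mul, Complex.normSq_eq_norm_sq]

theorem quad_add_le (x y : X) : S.quad (x + y) ≤ 2 * S.quad x + 2 * S.quad y := by
  have h := S.quad_nonneg (x - y)
  unfold quad at h ⊢
  simp only [star_add, star_sub, add_mul, mul_add, sub_mul, mul_sub, map_add, map_sub,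
    Complex.add_re, Complex.sub_re] at h ⊢
  linarith

/-- Generators and their adjoints are partial isometries, hence contractions for the form.
Boundedness passes to sums and products; x and x* are carried together so that the induction
survives the involution. -/
theorem quad_mul_bound (x : X) : ∃ C : ℝ, ∀ y, S.quad (x * y) ≤ C * S.quad y := by
  suffices h : (∃ C : ℝ, 0 ≤ C ∧ ∀ y, S.quad (x * y) ≤ C * S.quad y) ∧
      ∃ C : ℝ, 0 ≤ C ∧ ∀ y, S.quad (star x * y) ≤ C * S.quad y by
    obtain ⟨⟨C, -, hC⟩, -⟩ := h
    exact ⟨C, hC⟩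
  have hx : x ∈ NonUnitalStarAlgebra.adjoin ℂ (A.P ∪ A.T) := by
    rw [A.generates]; trivial
  have hiso : ∀ t : X, t * star t * t = t →
      (∃ C : ℝ, 0 ≤ C ∧ ∀ y, S.quad (t * y) ≤ C * S.quad y) ∧
      ∃ C : ℝ, 0 ≤ C ∧ ∀ y, S.quad (star t * y) ≤ C * S.quad y := by
    intro t ht
    have ht' : star t * star (star t) * star t = star t := by
      have := congrArg star ht
      rwa [star_mul, star_mul, ← mul_assoc] at this
    exact ⟨⟨1, zero_le_one, fun y => by rw [one_mul]; exact S.quad_isometry_mul_le ht y⟩,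
      ⟨1, zero_le_one, fun y => by rw [one_mul]; exact S.quad_isometry_mul_le ht' y⟩⟩
  have hadd : ∀ a b : X, (∃ C : ℝ, 0 ≤ C ∧ ∀ y, S.quad (a * y) ≤ C * S.quad y) →
      (∃ C : ℝ, 0 ≤ C ∧ ∀ y, S.quad (b * y) ≤ C * S.quad y) →
      ∃ C : ℝ, 0 ≤ C ∧ ∀ y, S.quad ((a + b) * y) ≤ C * S.quad y := by
    rintro a b ⟨C, hC, h⟩ ⟨D, hD, h'⟩
    refine ⟨2 * C + 2 * D, by positivity, fun y => ?_⟩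
    rw [add_mul]
    have := S.quad_add_le (a * y) (b * y)
    linarith [h y, h' y]
  have hmul : ∀ a b : X, (∃ C : ℝ, 0 ≤ C ∧ ∀ y, S.quad (a * y) ≤ C * S.quad y) →
      (∃ C : ℝ, 0 ≤ C ∧ ∀ y, S.quad (b * y) ≤ C * S.quad y) →
      ∃ C : ℝ, 0 ≤ C ∧ ∀ y, S.quad (a * b * y) ≤ C * S.quad y := by
    rintro a b ⟨C, hC, h⟩ ⟨D, hD, h'⟩
    refine ⟨C * D, by positivity, fun y => ?_⟩
    rw [mul_assoc, mul_assoc]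
    exact (h _).trans (mul_le_mul_of_nonneg_left (h' y) hC)
  have hsmul : ∀ (c : ℂ) (a : X), (∃ C : ℝ, 0 ≤ C ∧ ∀ y, S.quad (a * y) ≤ C * S.quad y) →
      ∃ C : ℝ, 0 ≤ C ∧ ∀ y, S.quad (c • a * y) ≤ C * S.quad y := by
    rintro c a ⟨C, hC, h⟩
    refine ⟨‖c‖ ^ 2 * C, by positivity, fun y => ?_⟩
    rw [smul_mul_assoc, quad_smul, mul_assoc]
    exact mul_le_mul_of_nonneg_left (h y) (by positivity)
  induction hx using NonUnitalStarAlgebra.adjoin_induction with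
  | mem y hy =>
    refine hiso y ?_
    rcases hy with hy | hy
    · rw [(A.P_proj y hy).2, (A.P_proj y hy).1, (A.P_proj y hy).1]
    · exact A.T_partialIsometry y hy
  | add y z _ _ hy hz =>
    exact ⟨hadd _ _ hy.1 hz.1, by rw [star_add]; exact hadd _ _ hy.2 hz.2⟩
  | zero => exact ⟨⟨0, le_rfl, fun y => by simp [quad]⟩, ⟨0, le_rfl, fun y => by simp [quad]⟩⟩
  | mul y z _ _ hy hz =>
    exact ⟨hmul _ _ hy.1 hz.1, by rw [star_mul]; exact hmul _ _ hz.2 hy.2⟩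
  | smul c y _ hy =>
    exact ⟨hsmul _ _ hy.1, by rw [star_smul]; exact hsmul _ _ hy.2⟩
  | star y _ hy => exact ⟨hy.2, by rw [star_star]; exact hy.1⟩

theorem exists_seminorm : ∃ N : CStarSeminorm X,
    (∀ x y, S.quad (x * y) ≤ N x ^ 2 * S.quad y) ∧
    ∀ x C, 0 ≤ C → (∀ y, S.quad (x * y) ≤ C ^ 2 * S.quad y) → N x ≤ C :=
  CStarSeminorm.exists_of_positive S.functional S.functional_star S.quad_nonneg S.quad_mul_bound

/-- The C*-seminorm of the GNS representation of the functional of a filter. -/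
noncomputable def seminorm : CStarSeminorm X := S.exists_seminorm.choose

theorem quad_mul_le (x y : X) : S.quad (x * y) ≤ S.seminorm x ^ 2 * S.quad y :=
  S.exists_seminorm.choose_spec.1 x y

theorem seminorm_le {x : X} {C : ℝ} (hC : 0 ≤ C)
    (h : ∀ y, S.quad (x * y) ≤ C ^ 2 * S.quad y) : S.seminorm x ≤ C :=
  S.exists_seminorm.choose_spec.2 x C hC h

theorem quad_of_mem {x : X} (hx : (x : Unitization ℂ X) ∈ S.carrier) : S.quad x = 1 := by
  have : star x * x = x := by
    apply inr_injective (R := ℂ)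
    rw [inr_mul, inr_star, S.star_eq hx, S.idem hx]
  rw [quad, this, S.functional_of_mem hx, Complex.one_re]

theorem seminorm_ne_zero {x : X} (hx : (x : Unitization ℂ X) ∈ S.carrier) : S.seminorm x ≠ 0 := by
  intro h
  have h1 := S.quad_mul_le x x
  have : x * x = x := inr_injective (R := ℂ) (by rw [inr_mul, S.idem hx])
  rw [this, h, S.quad_of_mem hx] at h1
  norm_num at h1

/-- The seminorm of a filter does not increase on passing to homogeneous components. -/
theorem seminorm_dec_le (x : X) (n : k →₀ ℤ) : S.seminorm (A.dec x n) ≤ S.seminorm x := by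
  refine S.seminorm_le (S.seminorm.nonneg x) fun y => ?_
  rw [S.quad_mul_of_mem_gr (A.dec_mem x n), S.quad_eq_sum y, Finsupp.sum, Finsupp.sum,
    Finset.mul_sum]
  refine Finset.sum_le_sum fun m _ => ?_
  refine le_trans ?_ (S.quad_mul_le x (A.dec y m))
  -- Orthogonality of degrees has reduced the test vector to a single component of y, on which the
  -- component of x acts as a component of x y.
  have : A.dec x n * A.dec y m = A.dec (x * A.dec y m) (n + m) := by
    have h1 := A.dec_mem y m
    generalize A.dec y m = z at h1
    classical
    induction x using A.gr_induction with
    | zero => simp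
    | add x x' hx hx' =>
      rw [add_mul, map_add A.dec, map_add A.dec, Finsupp.add_apply, Finsupp.add_apply, add_mul,
        hx, hx']
    | gr l x hx =>
      rw [dec_of_mem_gr (gr_mul hx h1), dec_of_mem_gr hx, Finsupp.single_apply,
        Finsupp.single_apply]
      by_cases h : l = n <;> simp [h]
  rw [this]
  exact S.quad_dec_le _ _

/-- A homogeneous element in the kernel of the seminorm is annihilated by a member of the
filter. -/
theorem exists_mul_eq_zero {n : k →₀ ℤ} {y : X} (hy : y ∈ A.gr n) (h0 : S.seminorm y = 0) :
    ∃ q ∈ S.carrier, (y : Unitization ℂ X) * q = 0 := by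
  obtain ⟨q, hq, c, hc, h1, h2⟩ := exists_compress_star_mul_self S hy
  refine ⟨q, hq, h2 ?_⟩
  obtain ⟨x, rfl⟩ := exists_inr_of_stdProj (S.std q hq)
  have hxs : star x = x := inr_injective (R := ℂ) (by rw [inr_star, S.star_eq hq])
  -- The member x of the filter serves as test vector: the form of y x is c, and seminorm zero
  -- forces c ≤ 0.
  have h3 := S.quad_mul_le y x
  have h4 : star (y * x) * (y * x) = (c : ℂ) • x := by
    apply inr_injective (R := ℂ)
    rw [inr_smul, ← h1, star_mul, hxs]
    simp only [inr_mul, mul_assoc]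
  rw [h0, quad, h4, map_smul, S.functional_of_mem hq] at h3
  simp at h3
  exact le_antisymm h3 hc

end StdFilter

/-! ### Cancellation -/

/-- In a cancelling semigraph algebra, the part of an element of nonzero degree can be cut off
below every nonzero standard projection. -/
theorem IsCancelling.exists_cut_gr (hA : A.IsCancelling) {n : k →₀ ℤ} (hn : n ≠ 0) {x : X}
    (hx : x ∈ A.gr n) : ∀ p ∈ A.stdProj, p ≠ 0 →
    ∃ q ∈ A.stdProj, q ≠ 0 ∧ q * p = q ∧ q * x * q = 0 := by
  have hx' := gr_le_stdWords n hx
  clear hx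
  induction hx' using Submodule.span_induction with
  | zero => exact fun p hp h0 => ⟨p, hp, h0, stdProj_idem hp, by simp⟩
  | smul c x _ hx =>
    intro p hp h0
    obtain ⟨q, hq, h1, h2, h3⟩ := hx p hp h0
    exact ⟨q, hq, h1, h2, by rw [inr_smul, mul_smul_comm, smul_mul_assoc, h3, smul_zero]⟩
  | add x y _ _ hx hy =>
    intro p hp h0
    obtain ⟨q, hq, h1, h2, h3⟩ := hx p hp h0
    obtain ⟨r, hr, h4, h5, h6⟩ := hy q hq h1
    refine ⟨r, hr, h4, by rw [← h5, mul_assoc, h2], ?_⟩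
    have h7 : q * r = r := by
      rw [← diagAlg_comm (stdProj_subset_diagAlg hr) (stdProj_subset_diagAlg hq), h5]
    have h8 : r * x * r = 0 := by
      calc r * x * r = r * q * x * (q * r) := by rw [h5, h7]
        _ = r * (q * x * q) * r := by simp only [mul_assoc]
        _ = 0 := by rw [h3]; simp
    rw [inr_add, mul_add, add_mul, h8, h6, add_zero]
  | mem x hx =>
    intro p hp h0
    by_cases hx0 : x = 0
    · exact ⟨p, hp, h0, stdProj_idem hp, by simp [hx0]⟩
    obtain ⟨u, hu⟩ := exists_word_of_stdWords hx
    obtain ⟨s, hs, _, ⟨p', hp', rfl⟩, t, ht, hx, -⟩ := hx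
    obtain ⟨p, rfl⟩ := exists_inr_of_stdProj hp
    obtain ⟨q, hq, h1, ⟨h2, -⟩, h3⟩ := hA x ⟨s, hs, p', hp', t, ht, hx⟩ n ⟨hx0, u, hu⟩ hn p
      (isStandardProjection_iff.2 hp) (fun h => h0 (by rw [h, inr_zero]))
    refine ⟨q, isStandardProjection_iff.1 hq, fun h => h1 (inr_injective (R := ℂ) h), ?_, ?_⟩
    · rw [← inr_mul, h2]
    · rw [← inr_mul, ← inr_mul, h3, inr_zero]

/-- The homogeneous parts are treated one after another with ever smaller projections. An identity
of compressions survives compression by a smaller projection, so earlier cuts are not undone. -/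
theorem IsCancelling.exists_cut (hA : A.IsCancelling) (x : X) : ∀ p ∈ A.stdProj, p ≠ 0 →
    ∃ q ∈ A.stdProj, q ≠ 0 ∧ q * p = q ∧ q * x * q = q * (A.dec x 0 : X) * q := by
  classical
  induction x using A.gr_induction with
  | zero => exact fun p hp h0 => ⟨p, hp, h0, stdProj_idem hp, by simp⟩
  | gr n x hx =>
    intro p hp h0
    rw [dec_of_mem_gr hx]
    by_cases hn : n = 0
    · subst hn
      exact ⟨p, hp, h0, stdProj_idem hp, by simp⟩
    · obtain ⟨q, hq, h1, h2, h3⟩ := hA.exists_cut_gr hn hx p hp h0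
      exact ⟨q, hq, h1, h2, by rw [h3, Finsupp.single_eq_of_ne (Ne.symm hn)]; simp⟩
  | add x y hx hy =>
    intro p hp h0
    obtain ⟨q, hq, h1, h2, h3⟩ := hx p hp h0
    obtain ⟨r, hr, h4, h5, h6⟩ := hy q hq h1
    refine ⟨r, hr, h4, by rw [← h5, mul_assoc, h2], ?_⟩
    have h7 : q * r = r := by
      rw [← diagAlg_comm (stdProj_subset_diagAlg hr) (stdProj_subset_diagAlg hq), h5]
    have h8 : ∀ z : Unitization ℂ X, r * z * r = r * (q * z * q) * r := fun z => by
      calc r * z * r = r * q * z * (q * r) := by rw [h5, h7]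
        _ = _ := by simp only [mul_assoc]
    rw [map_add, Finsupp.add_apply, inr_add, inr_add, mul_add, add_mul, mul_add, add_mul, h6,
      h8 x, h3, ← h8]

/-- In a cancelling semigraph algebra, the seminorm of a filter is dominated by every C*-seminorm
which does not vanish on nonzero standard projections. -/
theorem IsCancelling.seminorm_le (hA : A.IsCancelling) (S : A.StdFilter) (M : CStarSeminorm X)
    (hM : ∀ p : X, (p : Unitization ℂ X) ∈ A.stdProj → p ≠ 0 → M p ≠ 0) (x : X) :
    S.seminorm x ≤ M x := by
  refine S.seminorm_le (M.nonneg x) fun y => ?_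
  obtain ⟨q₁, hq₁, e₁⟩ := S.functional_spec (star (x * y) * (x * y))
  obtain ⟨q₂, hq₂, e₂⟩ := S.functional_spec (star y * y)
  obtain ⟨q, hq, h1, h2⟩ := S.directed q₁ hq₁ q₂ hq₂
  -- Below q the degree zero parts of (xy)*(xy) and y* y are already scalars. Two successive cuts
  -- remove the other degrees; the resulting projection need not belong to the filter, it only has
  -- to be nonzero.
  obtain ⟨r, hr, hr0, hrq, e₃⟩ := hA.exists_cut (star (x * y) * (x * y)) q (S.std q hq)
    (S.ne_zero q hq)
  obtain ⟨s, hs, hs0, hsr, e₄⟩ := hA.exists_cut (star y * y) r hr hr0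
  have hsq : s * q = s := by rw [← hsr, mul_assoc, hrq]
  have hrs : r * s = s := by
    rw [← diagAlg_comm (stdProj_subset_diagAlg hs) (stdProj_subset_diagAlg hr), hsr]
  have hcut : s * (star (x * y) * (x * y) : X) * s =
      s * (A.dec (star (x * y) * (x * y)) 0 : X) * s := by
    have h8 : ∀ z : Unitization ℂ X, s * z * s = s * (r * z * r) * s := fun z => by
      calc s * z * s = s * r * z * (r * s) := by rw [hsr, hrs]
        _ = _ := by simp only [mul_assoc]
    rw [h8, e₃, ← h8]
  obtain ⟨p, rfl⟩ := exists_inr_of_stdProj hs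
  have hp0 : p ≠ 0 := fun h => hs0 (by rw [h, inr_zero])
  have hps : star p = p := inr_injective (R := ℂ) (by rw [inr_star, stdProj_star hs])
  have hpp : p * p = p := inr_injective (R := ℂ) (by rw [inr_mul, stdProj_idem hs])
  have hMp : M p = 1 := by
    have := M.star_mul_self p
    rw [hps, hpp] at this
    have h0 := hM p hs hp0
    field_simp at this
    exact this.symm
  -- Because M p = 1, the C*-identity turns the scalar compression of z* z into the value of M at z
  -- p. Submultiplicativity of M then yields the estimate for the form.
  have key : ∀ z : X, (p : Unitization ℂ X) * (star z * z : X) * p =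
      S.functional (star z * z) • (p : Unitization ℂ X) → M (z * p) ^ 2 = S.quad z := by
    intro z hz
    have h3 : star (z * p) * (z * p) = S.functional (star z * z) • p := by
      apply inr_injective (R := ℂ)
      rw [inr_smul, ← hz, star_mul, hps]
      simp only [inr_mul, mul_assoc]
    have h4 := M.star_mul_self (z * p)
    rw [h3, M.smul_eq, hMp, mul_one] at h4
    rw [sq, ← h4, S.functional_star_mul_self, Complex.norm_real, ← S.quad_eq_sum,
      Real.norm_of_nonneg (S.quad_nonneg z)]
  have k1 : M (x * y * p) ^ 2 = S.quad (x * y) := key _ (by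
    rw [hcut]
    exact S.compress_of_le hq hs hsq (S.compress_of_le hq₁ (S.std q hq) h1 e₁))
  have k2 : M (y * p) ^ 2 = S.quad y := key _ (by
    rw [e₄]
    exact S.compress_of_le hq hs hsq (S.compress_of_le hq₂ (S.std q hq) h2 e₂))
  rw [← k1, ← k2, ← mul_pow, mul_assoc]
  exact pow_le_pow_left₀ (M.nonneg _) (M.mul_le _ _) 2

end SemigraphAlgebra

namespace SemigraphAlgebra

variable {k X : Type*} [NonUnitalRing X] [StarRing X] [Module ℂ X] [IsScalarTower ℂ X X]
  [SMulCommClass ℂ X X] [StarModule ℂ X] {A : SemigraphAlgebra k X}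

/-! ### Finite subsets closed under common extensions and exchange of prefixes -/

variable (A) in
/-- The total degree. -/
noncomputable def len (u : Unitization ℂ X) : ℕ := (A.d u).degree

theorem len_mul {u v : Unitization ℂ X} (hu : u ∈ A.T₁) (hv : v ∈ A.T₁) (h : u * v ≠ 0) :
    A.len (u * v) = A.len u + A.len v := by
  rw [len, d_mul hu hv h, map_add]; rfl

theorem eq_one_of_len {u : Unitization ℂ X} (hu : u ∈ A.T₁) (h : A.len u = 0) : u = 1 :=
  eq_one_of_d_eq_zero hu ((Finsupp.degree_eq_zero_iff _).1 h)

/-- Cut a and b where x a and y b reach degree d(x) ∨ d(y); unique factorisation of the common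
product identifies the two initial segments and the two remainders. -/
theorem exists_min_ext {x y a b : Unitization ℂ X} (hx : x ∈ A.T₁) (hy : y ∈ A.T₁)
    (ha : a ∈ A.T₁) (hb : b ∈ A.T₁) (h0 : x * a ≠ 0) (h : x * a = y * b) :
    ∃ e ∈ A.ext x y, ∃ η ∈ A.T₁, a = e.1 * η ∧ b = e.2 * η := by
  have h1 := d_mul hx ha h0
  have h2 := d_mul hy hb (h ▸ h0)
  rw [← h] at h2
  have hle1 : A.d x ≤ A.d (x * a) := by rw [h1]; exact le_self_add
  have hle2 : A.d y ≤ A.d (x * a) := by rw [h2]; exact le_self_add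
  have hsup : A.d x ⊔ A.d y ≤ A.d (x * a) := sup_le hle1 hle2
  obtain ⟨m₁, hm₁⟩ := exists_add_of_le (le_sup_left : A.d x ≤ A.d x ⊔ A.d y)
  obtain ⟨m₂, hm₂⟩ := exists_add_of_le (le_sup_right : A.d y ≤ A.d x ⊔ A.d y)
  obtain ⟨n, hn⟩ := exists_add_of_le hsup
  have ea : A.d a = m₁ + n := by
    have := h1.symm.trans hn
    rw [hm₁, add_assoc] at this
    exact add_left_cancel this
  have eb : A.d b = m₂ + n := by
    have := h2.symm.trans hn
    rw [hm₂, add_assoc] at this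
    exact add_left_cancel this
  obtain ⟨⟨a₁, a₂⟩, ⟨ha₁, ha₂, haa, hda₁, -⟩, -⟩ := A.semigraph.factorisation a ha _ _ ea
  obtain ⟨⟨b₁, b₂⟩, ⟨hb₁, hb₂, hbb, hdb₁, -⟩, -⟩ := A.semigraph.factorisation b hb _ _ eb
  dsimp only at *
  subst haa hbb
  have n1 : x * a₁ ≠ 0 := fun h' => h0 (by rw [← mul_assoc, h', zero_mul])
  have n2 : y * b₁ ≠ 0 := fun h' => h0 (by rw [h, ← mul_assoc, h', zero_mul])
  have e1 : A.d (x * a₁) = A.d x ⊔ A.d y := by rw [d_mul hx ha₁ n1, hda₁, ← hm₁]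
  have e2 : A.d (y * b₁) = A.d x ⊔ A.d y := by rw [d_mul hy hb₁ n2, hdb₁, ← hm₂]
  obtain ⟨f1, f2⟩ := factor_unique (mul_mem_T₁ hx ha₁ n1) ha₂ (mul_mem_T₁ hy hb₁ n2) hb₂
    (by rwa [mul_assoc]) (by rw [mul_assoc, mul_assoc, h]) (e1.trans e2.symm)
  exact ⟨(a₁, b₁), ⟨ha₁, hb₁, n1, n2, f1, e1⟩, a₂, ha₂, rfl, by rw [f2]⟩

variable (A) in
/-- The closure of a set under minimal common extensions and exchange of prefixes of equal
degree. -/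
inductive PrefixClosure (E : Set (Unitization ℂ X)) : Unitization ℂ X → Prop
  | base (e : Unitization ℂ X) : e ∈ E → PrefixClosure E e
  | join (s t : Unitization ℂ X) (a : Unitization ℂ X × Unitization ℂ X) : PrefixClosure E s →
      PrefixClosure E t → a ∈ A.ext s t → PrefixClosure E (s * a.1)
  | swap (s t α : Unitization ℂ X) : PrefixClosure E s → PrefixClosure E t →
      PrefixClosure E (s * α) → α ∈ A.T₁ → A.d s = A.d t → t * α ≠ 0 → PrefixClosure E (t * α)

namespace PrefixClosure

variable {E : Set (Unitization ℂ X)}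

theorem mem_T₁ (hE : E ⊆ A.T₁) {g : Unitization ℂ X} (hg : A.PrefixClosure E g) : g ∈ A.T₁ := by
  induction hg with
  | base e he => exact hE he
  | join s t a _ _ ha hs _ => exact ext_mul_mem hs ha
  | swap s t α _ _ _ hα _ h0 _ ht _ => exact mul_mem_T₁ ht hα h0

/-- A minimal common extension has the supremum of the two degrees and an exchange of prefixes keeps
the degree, so any common bound on E persists. -/
theorem d_le (hE : E ⊆ A.T₁) {B : k →₀ ℕ} (hB : ∀ e ∈ E, A.d e ≤ B) {g : Unitization ℂ X}
    (hg : A.PrefixClosure E g) : A.d g ≤ B := by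
  induction hg with
  | base e he => exact hB e he
  | join s t a _ _ ha hs ht => rw [ext_d ha]; exact sup_le hs ht
  | swap s t α hs ht hsα hα hd h0 _ _ h =>
    rw [d_mul (ht.mem_T₁ hE) hα h0, ← hd,
      ← d_mul (hs.mem_T₁ hE) hα (ne_zero_of_mem_T₁ (hsα.mem_T₁ hE))]
    exact h

variable (A E) in
/-- The elements of the closure of total degree less than `N`. -/
def shorter (N : ℕ) : Set (Unitization ℂ X) := {g | A.PrefixClosure E g ∧ A.len g < N}

variable (A E) in
/-- Generators and minimal common extensions of elements of smaller degree. -/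
def fresh (N : ℕ) : Set (Unitization ℂ X) :=
  E ∪ {w | ∃ s ∈ shorter A E N, ∃ t ∈ shorter A E N, ∃ a ∈ A.ext s t, w = s * a.1}

variable (A E) in
/-- The results of exchanging a prefix of smaller degree of a fresh element. -/
def swapped (N : ℕ) : Set (Unitization ℂ X) :=
  {w | ∃ u ∈ shorter A E N, ∃ v ∈ shorter A E N, ∃ β ∈ A.T₁, A.d u = A.d v ∧ u * β ∈ fresh A E N ∧
    v * β ≠ 0 ∧ w = v * β}

theorem fresh_subset (hE : E ⊆ A.T₁) {N : ℕ} {w : Unitization ℂ X} (hw : w ∈ fresh A E N) :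
    w ∈ A.T₁ := by
  rcases hw with hw | ⟨s, hs, t, -, a, ha, rfl⟩
  · exact hE hw
  · exact ext_mul_mem (hs.1.mem_T₁ hE) ha

/-- A chain of exchanges collapses to a single exchange applied to a fresh element, with prefixes
that are strictly shorter. Therefore the elements of one length are controlled by shorter ones, even
though exchanges do not increase the length. -/
theorem mem_fresh_or_swapped (hE : E ⊆ A.T₁) {g : Unitization ℂ X} (hg : A.PrefixClosure E g) :
    g ∈ fresh A E (A.len g) ∨ g ∈ swapped A E (A.len g) := by
  suffices h : ∀ N, A.len g = N → g ∈ fresh A E N ∨ g ∈ swapped A E N from h _ rfl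
  intro N
  induction hg with
  | base e he => exact fun _ => Or.inl (Or.inl he)
  | join s t a hs ht ha ihs iht =>
    intro hN
    have hsT := hs.mem_T₁ hE
    have htT := ht.mem_T₁ hE
    have h1 := len_mul hsT ha.1 (ext_ne_zero ha)
    have h2 := len_mul htT ha.2.1 ha.2.2.2.1
    rw [← ext_eq ha] at h2
    by_cases hs' : A.len s = N
    · have e : a.1 = 1 := eq_one_of_len ha.1 (by omega)
      rw [e, mul_one]
      exact ihs hs'
    by_cases ht' : A.len t = N
    · have e : a.2 = 1 := eq_one_of_len ha.2.1 (by omega)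
      rw [ext_eq ha, e, mul_one]
      exact iht ht'
    · exact Or.inl (Or.inr ⟨s, ⟨hs, by omega⟩, t, ⟨ht, by omega⟩, a, ha, rfl⟩)
  | swap s t α hs ht hsα hα hd h0 ihs iht ih =>
    intro hN
    have hsT := hs.mem_T₁ hE
    have htT := ht.mem_T₁ hE
    have hsα0 := ne_zero_of_mem_T₁ (hsα.mem_T₁ hE)
    have h1 := len_mul htT hα h0
    have h2 := len_mul hsT hα hsα0
    have h3 : A.len s = A.len t := by rw [len, len, hd]
    by_cases ht' : A.len t = N
    · have e : α = 1 := eq_one_of_len hα (by omega)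
      rw [e, mul_one]
      exact iht ht'
    have hsN : A.len s < N := by omega
    have htN : A.len t < N := by omega
    rcases ih (by omega) with hf | ⟨u, hu, v, hv, β, hβ, hduv, hfr, hv0, hw⟩
    · exact Or.inr ⟨s, ⟨hs, hsN⟩, t, ⟨ht, htN⟩, α, hα, hd, hf, h0, rfl⟩
    have huT := hu.1.mem_T₁ hE
    have hvT := hv.1.mem_T₁ hE
    obtain ⟨e, he, η, hη, rfl, rfl⟩ := exists_min_ext hsT hvT hα hβ hsα0 hw
    have hz := PrefixClosure.join s v e hs hv.1 he
    have h4 := len_mul (ext_mul_mem hsT he) hη (by rwa [mul_assoc])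
    rw [mul_assoc] at h4
    -- s α = v β is an extension by η of the minimal common extension s e₁ = v e₂. If η = 1, the
    -- element is itself fresh. Otherwise the exchanges v → u and s → t lift to v e₂ → u e₂ and s e₁
    -- → t e₁, and they compose to the single exchange of u e₂ by t e₁ in front of η.
    by_cases hzN : A.len (s * e.1) = N
    · have e1 : η = 1 := eq_one_of_len hη (by omega)
      subst e1
      refine Or.inr ⟨s, ⟨hs, hsN⟩, t, ⟨ht, htN⟩, e.1 * 1, hα, hd, ?_, h0, rfl⟩
      rw [mul_one]
      exact Or.inr ⟨s, ⟨hs, hsN⟩, v, hv, e, he, rfl⟩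
    · have n1 : t * e.1 ≠ 0 := fun h => h0 (by rw [← mul_assoc, h, zero_mul])
      have n2 : u * e.2 ≠ 0 := fun h => ne_zero_of_mem_T₁ (fresh_subset hE hfr)
        (by rw [← mul_assoc, h, zero_mul])
      have c1 := PrefixClosure.swap s t e.1 hs ht hz he.1 hd n1
      have c2 := PrefixClosure.swap v u e.2 hv.1 hu.1 (by rw [← ext_eq he]; exact hz) he.2.1
        hduv.symm n2
      have d1 : A.d (t * e.1) = A.d (s * e.1) := by
        rw [d_mul htT he.1 n1, d_mul hsT he.1 (ext_ne_zero he), hd]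
      have d2 : A.d (u * e.2) = A.d (s * e.1) := by
        rw [ext_eq he, d_mul huT he.2.1 n2, d_mul hvT he.2.1 he.2.2.2.1, hduv]
      have l1 : A.len (t * e.1) = A.len (s * e.1) := by rw [len, len, d1]
      have l2 : A.len (u * e.2) = A.len (s * e.1) := by rw [len, len, d2]
      exact Or.inr ⟨u * e.2, ⟨c2, by omega⟩, t * e.1, ⟨c1, by omega⟩, η, hη, d2.trans d1.symm,
        by rwa [mul_assoc], by rwa [mul_assoc], by rw [mul_assoc]⟩

/-- Finite alignment bounds the fresh elements of the next length. For the exchanged ones, left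
cancellation shows that β is determined by u and the fresh element u β. -/
theorem finite_shorter (hE : E ⊆ A.T₁) (hfin : E.Finite) (N : ℕ) : (shorter A E N).Finite := by
  induction N with
  | zero => exact Set.Finite.subset Set.finite_empty fun g hg => absurd hg.2 (by omega)
  | succ N ih =>
    have hT : ∀ u ∈ shorter A E N, u ∈ A.T₁ := fun u hu => hu.1.mem_T₁ hE
    have hfresh : (fresh A E N).Finite := by
      refine hfin.union ?_
      have : {w | ∃ s ∈ shorter A E N, ∃ t ∈ shorter A E N, ∃ a ∈ A.ext s t, w = s * a.1} ⊆
          ⋃ s ∈ shorter A E N, ⋃ t ∈ shorter A E N, (fun a => s * a.1) '' A.ext s t := by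
        rintro w ⟨s, hs, t, ht, a, ha, rfl⟩
        exact Set.mem_biUnion hs (Set.mem_biUnion ht ⟨a, ha, rfl⟩)
      exact (ih.biUnion fun s hs => ih.biUnion fun t ht =>
        (A.finitelyAligned s (hT s hs) t (hT t ht)).image _).subset this
    have hswap : (swapped A E N).Finite := by
      have : swapped A E N ⊆ ⋃ u ∈ shorter A E N, ⋃ v ∈ shorter A E N,
          (fun β => v * β) '' {β | β ∈ A.T₁ ∧ u * β ∈ fresh A E N} := by
        rintro w ⟨u, hu, v, hv, β, hβ, -, hf, -, rfl⟩
        exact Set.mem_biUnion hu (Set.mem_biUnion hv ⟨β, ⟨hβ, hf⟩, rfl⟩)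
      refine (ih.biUnion fun u hu => ih.biUnion fun v hv => Set.Finite.image _ ?_).subset this
      refine Set.Finite.of_injOn (f := fun β => u * β) (fun β hβ => hβ.2) ?_ hfresh
      intro β hβ β' hβ' h
      exact mul_left_cancel_T₁ (hT u hu) hβ.1 hβ'.1
        (ne_zero_of_mem_T₁ (fresh_subset hE hβ.2)) h
    refine ((ih.union hfresh).union hswap).subset ?_
    rintro g ⟨hg, hgN⟩
    rcases Nat.lt_succ_iff_lt_or_eq.1 hgN with h | h
    · exact Or.inl (Or.inl ⟨hg, h⟩)
    · rcases hg.mem_fresh_or_swapped hE with h' | h'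
      · exact Or.inl (Or.inr (h ▸ h'))
      · exact Or.inr (h ▸ h')

end PrefixClosure

/-- Every finite subset of `T₁` is contained in a finite subset which is closed under minimal
common extensions and under exchange of prefixes of equal degree. -/
theorem exists_prefixClosed {E : Set (Unitization ℂ X)} (hE : E ⊆ A.T₁) (hfin : E.Finite) :
    ∃ G : Finset (Unitization ℂ X), E ⊆ G ∧ (∀ g ∈ G, g ∈ A.T₁) ∧
      (∀ s ∈ G, ∀ t ∈ G, ∀ a ∈ A.ext s t, s * a.1 ∈ G) ∧
      ∀ s ∈ G, ∀ t ∈ G, ∀ α ∈ A.T₁, s * α ∈ G → A.d s = A.d t → t * α ≠ 0 → t * α ∈ G := by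
  have hB : ∃ B : k →₀ ℕ, ∀ e ∈ E, A.d e ≤ B :=
    ⟨hfin.toFinset.sum A.d, fun e he =>
      Finset.single_le_sum (f := A.d) (fun _ _ => zero_le) (hfin.mem_toFinset.2 he)⟩
  obtain ⟨B, hB⟩ := hB
  have hG : {g | A.PrefixClosure E g}.Finite := by
    -- All degrees stay below B, so every element of the closure has length at most |B|, hence less
    -- than |B| + 1.
    refine (PrefixClosure.finite_shorter hE hfin (B.degree + 1)).subset fun g hg => ⟨hg, ?_⟩
    have hle : A.d g ≤ B := PrefixClosure.d_le hE hB hg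
    obtain ⟨c, hc⟩ := exists_add_of_le hle
    rw [hc, map_add]
    exact Nat.lt_succ_of_le (Nat.le_add_right _ _)
  refine ⟨hG.toFinset, ?_, ?_, ?_, ?_⟩
  · intro e he
    simpa using PrefixClosure.base e he
  · intro g hg
    exact PrefixClosure.mem_T₁ hE (hG.mem_toFinset.1 hg)
  · intro s hs t ht a ha
    exact hG.mem_toFinset.2
      (PrefixClosure.join s t a (hG.mem_toFinset.1 hs) (hG.mem_toFinset.1 ht) ha)
  · intro s hs t ht α hα h hd h0
    exact hG.mem_toFinset.2 (PrefixClosure.swap s t α (hG.mem_toFinset.1 hs)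
      (hG.mem_toFinset.1 ht) (hG.mem_toFinset.1 h) hα hd h0)

end SemigraphAlgebra

namespace SemigraphAlgebra

variable {k X : Type*} [NonUnitalRing X] [StarRing X] [Module ℂ X] [IsScalarTower ℂ X X]
  [SMulCommClass ℂ X X] [StarModule ℂ X] {A : SemigraphAlgebra k X}

/-! ### Finite-dimensional subalgebras of the core -/

/-- Idempotents are roots of X² - X, and integral elements form a subalgebra. Hence finitely many
elements of the diagonal algebra generate a finite-dimensional algebra. -/
theorem _root_.isIntegral_of_mem_adjoin_idempotents {R : Type*} [CommRing R] [Algebra ℂ R] {E : Set R}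
    (hE : ∀ e ∈ E, e * e = e) {a : R} (ha : a ∈ Algebra.adjoin ℂ E) : IsIntegral ℂ a := by
  have h : Algebra.adjoin ℂ E ≤ integralClosure ℂ R := by
    refine Algebra.adjoin_le fun e he => ⟨Polynomial.X ^ 2 - Polynomial.X, ?_, ?_⟩
    · exact Polynomial.monic_X_pow_sub (by rw [Polynomial.degree_X]; norm_num)
    · simp [sq, hE e he]
  exact h ha

/-- A finite subset of the diagonal algebra lies in a finite-dimensional multiplicatively closed
subspace. -/
theorem exists_finite_subspace {S : Set (Unitization ℂ X)} (hS : S.Finite)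
    (hSA : S ⊆ A.diagAlg) :
    ∃ C : Submodule ℂ (Unitization ℂ X), S ⊆ C ∧ FiniteDimensional ℂ C ∧
      ∀ a ∈ C, ∀ b ∈ C, a * b ∈ C := by
  let S' : Set A.diagAlg := Subtype.val ⁻¹' S
  have hS' : S'.Finite := hS.preimage Subtype.val_injective.injOn
  have hint : ∀ x ∈ S', IsIntegral ℂ x := fun x _ => by
    refine isIntegral_of_mem_adjoin_idempotents (E := (Subtype.val ⁻¹' A.diag : Set A.diagAlg))
      (fun e he => Subtype.ext (diag_idem he)) ?_
    have h : Algebra.adjoin ℂ (Subtype.val ⁻¹' A.diag : Set A.diagAlg) = ⊤ :=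
      Algebra.adjoin_adjoin_coe_preimage
    rw [h]
    trivial
  have hfd := fg_adjoin_of_finite hS' hint
  refine ⟨(Subalgebra.toSubmodule (Algebra.adjoin ℂ S')).map A.diagAlg.val.toLinearMap,
    fun s hs => ⟨⟨s, hSA hs⟩, Algebra.subset_adjoin hs, rfl⟩, ?_, ?_⟩
  · exact Module.Finite.iff_fg.2 (hfd.map _)
  · rintro _ ⟨a, ha, rfl⟩ _ ⟨b, hb, rfl⟩
    exact ⟨a * b, (Algebra.adjoin ℂ S').mul_mem ha hb, rfl⟩

/-- Because t t* commutes with the diagonal, a ↦ t* a t is multiplicative there, and generators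
suffice. For z p z*, multiply by t t* first: each term of the product begins with t, which
conjugation by t removes. -/
theorem conj_mem_diagAlg {t a : Unitization ℂ X} (ht : t ∈ A.T₁) (ha : a ∈ A.diagAlg) :
    star t * a * t ∈ A.diagAlg := by
  have htt : star t * t ∈ A.diagAlg :=
    diag_subset_diagAlg (mem_diag_of_mem_P₁ (star_mul_self_mem_P₁ ht))
  have hTT : t * star t ∈ A.diagAlg := diag_subset_diagAlg (mul_star_mem_diag ht)
  induction ha using Algebra.adjoin_induction with
  | algebraMap c =>
    rw [Algebra.algebraMap_eq_smul_one, mul_smul_comm, mul_one, smul_mul_assoc]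
    exact Subalgebra.smul_mem _ htt c
  | add x y _ _ hx hy => rw [mul_add, add_mul]; exact add_mem hx hy
  | mul x y hx' hy' hx hy =>
    have : star t * (x * y) * t = star t * x * t * (star t * y * t) := by
      calc star t * (x * y) * t = star t * t * star t * (x * y) * t := by
            rw [star_mul_isometry ht]
        _ = star t * ((t * star t) * x) * y * t := by simp only [mul_assoc]
        _ = _ := by rw [diagAlg_comm hTT hx']; simp only [mul_assoc]
    rw [this]
    exact mul_mem hx hy
  | mem e he =>
    obtain ⟨z, hz, p, hp, rfl⟩ := he
    obtain ⟨r, hr, h⟩ := diag_mul_expand ht hz one_mem_P₁ hp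
    rw [mul_one] at h
    have : star t * (z * p * star z) * t =
        ∑ a ∈ extFinset ht hz, star t * (t * a.1 * r a * star (t * a.1)) * t := by
      rw [← Finset.sum_mul, ← Finset.mul_sum, ← h]
      calc star t * (z * p * star z) * t = star t * t * star t * (z * p * star z) * t := by
            rw [star_mul_isometry ht]
        _ = _ := by simp only [mul_assoc]
    rw [this]
    refine sum_mem fun a ha => diag_subset_diagAlg ?_
    have ha' := mem_extFinset.1 ha
    obtain ⟨p', hp', -, h1, h2⟩ := skip_star ha'.1 (star_mul_self_mem_P₁ ht)
    refine ⟨a.1, ha'.1, p' * (r a * p'), P₁_mul hp' (P₁_mul (hr a ha).1 hp'), ?_⟩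
    calc star t * (t * a.1 * r a * star (t * a.1)) * t
        = (star t * t * a.1) * r a * (star a.1 * (star t * t)) := by
          simp only [star_mul, mul_assoc]
      _ = _ := by rw [h1, h2]; simp only [mul_assoc]

/-! ### The partition of unity of a finite set closed under minimal common extensions. -/

open Classical in
/-- The range projection of an element of `T₁`, as an element of the diagonal algebra. -/
noncomputable def rangeProj (A : SemigraphAlgebra k X) (g : Unitization ℂ X) : A.diagAlg :=
  if h : g ∈ A.T₁ then ⟨g * star g, diag_subset_diagAlg (mul_star_mem_diag h)⟩ else 0

theorem coe_rangeProj {g : Unitization ℂ X} (hg : g ∈ A.T₁) :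
    (A.rangeProj g : Unitization ℂ X) = g * star g := by
  rw [rangeProj, dif_pos hg]

theorem rangeProj_idem (g : Unitization ℂ X) :
    A.rangeProj g * A.rangeProj g = A.rangeProj g := by
  by_cases hg : g ∈ A.T₁
  · apply Subtype.ext
    rw [MulMemClass.coe_mul, coe_rangeProj hg, diag_idem (mul_star_mem_diag hg)]
  · simp [rangeProj, hg]

theorem rangeProj_star (g : Unitization ℂ X) :
    star (A.rangeProj g : Unitization ℂ X) = A.rangeProj g := by
  by_cases hg : g ∈ A.T₁
  · rw [coe_rangeProj hg, diag_star (mul_star_mem_diag hg)]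
  · simp [rangeProj, hg]

/-- The product of the two range projections is a sum of diagonal projections, each lying below the
range of a minimal common extension. -/
theorem mul_rangeProj_mul_eq_zero {c : A.diagAlg} {s t : Unitization ℂ X} (hs : s ∈ A.T₁)
    (ht : t ∈ A.T₁) (h : ∀ a ∈ A.ext s t, c * A.rangeProj (s * a.1) = 0) :
    c * (A.rangeProj s * A.rangeProj t) = 0 := by
  obtain ⟨r, hr, he⟩ := diag_mul_expand hs ht one_mem_P₁ one_mem_P₁
  rw [mul_one, mul_one] at he
  apply Subtype.ext
  rw [MulMemClass.coe_mul, MulMemClass.coe_mul, coe_rangeProj hs, coe_rangeProj ht, he,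
    Finset.mul_sum]
  refine Finset.sum_eq_zero fun a ha => ?_
  have ha' := mem_extFinset.1 ha
  have hm := ext_mul_mem hs ha'
  have h1 := congrArg Subtype.val (h a ha')
  rw [MulMemClass.coe_mul, coe_rangeProj hm] at h1
  have h2 : s * a.1 * r a * star (s * a.1) =
      s * a.1 * star (s * a.1) * (s * a.1 * r a * star (s * a.1)) := by
    rw [← mul_assoc, ← mul_assoc, T₁_isometry hm]
  rw [h2, ← mul_assoc, h1]
  simp

/-- `z` properly extends `s`. -/
def Extends (A : SemigraphAlgebra k X) (s z : Unitization ℂ X) : Prop :=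
  z ≠ s ∧ ∃ α ∈ A.T₁, z = s * α

open Classical in
/-- The projection onto the part of the range of `s` outside of the ranges of the proper extensions
of `s` in `G`. -/
noncomputable def piece (A : SemigraphAlgebra k X) (G : Finset (Unitization ℂ X))
    (s : Unitization ℂ X) : A.diagAlg :=
  A.rangeProj s * ∏ z ∈ G.filter (A.Extends s), (1 - A.rangeProj z)

theorem prod_one_sub_idem (F : Finset (Unitization ℂ X)) :
    (∏ z ∈ F, (1 - A.rangeProj z)) * ∏ z ∈ F, (1 - A.rangeProj z) =
      ∏ z ∈ F, (1 - A.rangeProj z) := by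
  rw [← Finset.prod_mul_distrib]
  exact Finset.prod_congr rfl fun z _ => by linear_combination A.rangeProj_idem z

theorem piece_mul_rangeProj (G : Finset (Unitization ℂ X)) (s : Unitization ℂ X) :
    A.piece G s * A.rangeProj s = A.piece G s := by
  rw [piece, mul_right_comm, rangeProj_idem]

theorem piece_idem (G : Finset (Unitization ℂ X)) (s : Unitization ℂ X) :
    A.piece G s * A.piece G s = A.piece G s := by
  rw [piece, mul_mul_mul_comm, rangeProj_idem, prod_one_sub_idem]

theorem piece_star (G : Finset (Unitization ℂ X)) (s : Unitization ℂ X) :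
    star (A.piece G s : Unitization ℂ X) = A.piece G s := by
  classical
  have hmul : ∀ a b : A.diagAlg, star (a : Unitization ℂ X) = a → star (b : Unitization ℂ X) = b →
      star ((a * b : A.diagAlg) : Unitization ℂ X) = (a * b : A.diagAlg) := fun a b ha hb => by
    rw [MulMemClass.coe_mul, star_mul, ha, hb, diagAlg_comm b.2 a.2]
  refine hmul _ _ (rangeProj_star s) ?_
  refine Finset.prod_induction _ (fun a : A.diagAlg => star (a : Unitization ℂ X) = a) hmul ?_ ?_
  · simp
  · intro z _
    change star (1 - (A.rangeProj z : Unitization ℂ X)) = 1 - (A.rangeProj z : Unitization ℂ X)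
    rw [star_sub, star_one, rangeProj_star]

theorem piece_mul_rangeProj_eq_zero {G : Finset (Unitization ℂ X)} {s z : Unitization ℂ X}
    (hz : z ∈ G) (h : A.Extends s z) : A.piece G s * A.rangeProj z = 0 := by
  classical
  rw [piece, ← Finset.mul_prod_erase _ _ (Finset.mem_filter.2 ⟨hz, h⟩)]
  linear_combination (-A.rangeProj s *
    ∏ x ∈ (G.filter (A.Extends s)).erase z, (1 - A.rangeProj x)) * A.rangeProj_idem z

variable {G : Finset (Unitization ℂ X)}

/-- If t is not a prefix of s, every minimal common extension of s and t extends s properly, and the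
piece of s kills its range. -/
theorem piece_mul_rangeProj_of_not_prefix (hT : ∀ g ∈ G, g ∈ A.T₁)
    (hj : ∀ s ∈ G, ∀ t ∈ G, ∀ a ∈ A.ext s t, s * a.1 ∈ G) {s t : Unitization ℂ X} (hs : s ∈ G)
    (ht : t ∈ G) (h : ¬ ∃ α ∈ A.T₁, s = t * α) : A.piece G s * A.rangeProj t = 0 := by
  rw [← piece_mul_rangeProj, mul_assoc]
  refine mul_rangeProj_mul_eq_zero (hT s hs) (hT t ht) fun a ha => ?_
  refine piece_mul_rangeProj_eq_zero (hj s hs t ht a ha) ⟨fun h' => h ⟨a.2, ha.2.1, ?_⟩, a.1,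
    ha.1, rfl⟩
  rw [← ext_eq ha, h']

/-- A minimal common extension either extends s properly, and is killed by the piece of s, or equals
s ≠ t, extends t properly, and is killed by the piece of t. -/
theorem piece_mul_piece (hT : ∀ g ∈ G, g ∈ A.T₁)
    (hj : ∀ s ∈ G, ∀ t ∈ G, ∀ a ∈ A.ext s t, s * a.1 ∈ G) {s t : Unitization ℂ X} (hs : s ∈ G)
    (ht : t ∈ G) (hne : s ≠ t) : A.piece G s * A.piece G t = 0 := by
  have h : A.piece G s * A.piece G t * (A.rangeProj s * A.rangeProj t) = 0 := by
    refine mul_rangeProj_mul_eq_zero (hT s hs) (hT t ht) fun a ha => ?_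
    by_cases h : s * a.1 = s
    · have h1 : A.Extends t (s * a.1) := ⟨by rwa [h], a.2, ha.2.1, ext_eq ha⟩
      rw [mul_assoc, piece_mul_rangeProj_eq_zero (hj s hs t ht a ha) h1, mul_zero]
    · rw [mul_right_comm, piece_mul_rangeProj_eq_zero (hj s hs t ht a ha) ⟨h, a.1, ha.1, rfl⟩,
        zero_mul]
  rwa [mul_mul_mul_comm, piece_mul_rangeProj, piece_mul_rangeProj] at h

theorem sum_piece (hT : ∀ g ∈ G, g ∈ A.T₁)
    (hj : ∀ s ∈ G, ∀ t ∈ G, ∀ a ∈ A.ext s t, s * a.1 ∈ G) (h1 : (1 : Unitization ℂ X) ∈ G) :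
    ∑ s ∈ G, A.piece G s = 1 := by
  classical
  set R := 1 - ∑ s ∈ G, A.piece G s with hR
  -- Induction from the longest elements downwards: if the remainder R kills the ranges of all
  -- proper extensions of s in G, then R s s* is R times the piece of s, which is zero. The case s =
  -- 1 gives R = 0.
  have key : ∀ n, ∀ s ∈ G, G.sup A.len - A.len s ≤ n → R * A.rangeProj s = 0 := by
    intro n
    induction n using Nat.strong_induction_on with
    | _ n ih =>
      intro s hs hn
      have hz : ∀ z ∈ G.filter (A.Extends s), R * A.rangeProj z = 0 := by
        intro z hz
        obtain ⟨hzG, hne, α, hα, rfl⟩ := Finset.mem_filter.1 hz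
        have h2 := len_mul (hT s hs) hα (ne_zero_of_mem_T₁ (hT _ hzG))
        have h3 : A.len α ≠ 0 := fun h => hne (by rw [eq_one_of_len hα h, mul_one])
        have h4 : A.len (s * α) ≤ G.sup A.len := Finset.le_sup hzG
        exact ih (G.sup A.len - A.len (s * α)) (by omega) _ hzG le_rfl
      have hprod : ∀ F ⊆ G.filter (A.Extends s), R * ∏ z ∈ F, (1 - A.rangeProj z) = R := by
        intro F
        induction F using Finset.induction_on with
        | empty => simp
        | insert z F hzF ihF =>
          intro hF
          rw [Finset.prod_insert hzF, mul_left_comm, ihF fun x hx => hF (Finset.mem_insert_of_mem hx),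
            sub_mul, one_mul, mul_comm, hz z (hF (Finset.mem_insert_self _ _)), sub_zero]
      have h5 : R * A.rangeProj s = R * A.piece G s := by
        rw [piece, mul_left_comm, hprod _ (Finset.Subset.refl _), mul_comm]
      rw [h5, hR, sub_mul, one_mul, Finset.sum_mul, Finset.sum_eq_single s, piece_idem, sub_self]
      · exact fun t ht hts => piece_mul_piece hT hj ht hs hts
      · exact fun h => absurd hs h
  have h0 := key _ 1 h1 le_rfl
  have h1' : A.rangeProj 1 = 1 := Subtype.ext (by rw [coe_rangeProj one_mem_T₁]; simp)
  rw [h1', mul_one, hR, sub_eq_zero] at h0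
  exact h0.symm

theorem piece_mul_of_not_prefix (hT : ∀ g ∈ G, g ∈ A.T₁)
    (hj : ∀ s ∈ G, ∀ t ∈ G, ∀ a ∈ A.ext s t, s * a.1 ∈ G) {s t : Unitization ℂ X} (hs : s ∈ G)
    (ht : t ∈ G) (h : ¬ ∃ α ∈ A.T₁, s = t * α) : (A.piece G s : Unitization ℂ X) * t = 0 := by
  have h1 := congrArg Subtype.val (piece_mul_rangeProj_of_not_prefix hT hj hs ht h)
  rw [MulMemClass.coe_mul, coe_rangeProj (hT t ht)] at h1
  rw [← T₁_isometry (hT t ht), ← mul_assoc, h1]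
  simp

/-- The piece of s α lies below the range of s α, and (sα)(sα)* s = s α α* by `star_mul_ext`. -/
theorem piece_mul_of_prefix {s α : Unitization ℂ X} (hs : s ∈ A.T₁) (hα : α ∈ A.T₁)
    (hsα : s * α ∈ A.T₁) : (A.piece G (s * α) : Unitization ℂ X) * s =
      A.piece G (s * α) * (s * α) * star α := by
  have h1 := congrArg Subtype.val (A.piece_mul_rangeProj G (s * α))
  rw [MulMemClass.coe_mul, coe_rangeProj hsα] at h1
  have h2 : s * α * star (s * α) * s = s * α * star α := by
    calc s * α * star (s * α) * s = star (star s * (s * α * star (s * α))) := by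
          simp only [star_mul, star_star, mul_assoc]
      _ = _ := by rw [star_mul_ext hs hα]; simp only [star_mul, star_star]
  calc (A.piece G (s * α) : Unitization ℂ X) * s
      = A.piece G (s * α) * (s * α * star (s * α) * s) := by
        rw [← mul_assoc, h1]
    _ = _ := by rw [h2]; simp only [mul_assoc]

/-- Moving p past α* exhibits the adjoint of (piece of t β) · t α as a factor. Closure under
exchange of prefixes puts a nonzero t α into G, so this factor vanishes unless t α is a prefix of t
β. -/
theorem corner_eq_zero_or (hT : ∀ g ∈ G, g ∈ A.T₁)
    (hj : ∀ s ∈ G, ∀ t ∈ G, ∀ a ∈ A.ext s t, s * a.1 ∈ G)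
    (hsw : ∀ s ∈ G, ∀ t ∈ G, ∀ α ∈ A.T₁, s * α ∈ G → A.d s = A.d t → t * α ≠ 0 → t * α ∈ G)
    {s t p α β : Unitization ℂ X} (hs : s ∈ G) (ht : t ∈ G) (hd : A.d s = A.d t) (hp : p ∈ A.P₁)
    (hα : α ∈ A.T₁) (hβ : β ∈ A.T₁) (hsα : s * α ∈ G) (htβ : t * β ∈ G) :
    (A.piece G (s * α) : Unitization ℂ X) * (s * p * star t) * A.piece G (t * β) = 0 ∨
      ∃ γ ∈ A.T₁, β = α * γ := by
  obtain ⟨p', hp', -, -, h1⟩ := skip_star hα hp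
  have e : (A.piece G (s * α) : Unitization ℂ X) * (s * p * star t) * A.piece G (t * β) =
      A.piece G (s * α) * (s * α) * p' * star ((A.piece G (t * β) : Unitization ℂ X) * (t * α)) := by
    calc (A.piece G (s * α) : Unitization ℂ X) * (s * p * star t) * A.piece G (t * β)
        = (A.piece G (s * α) : Unitization ℂ X) * s * p * star t * A.piece G (t * β) := by
          simp only [mul_assoc]
      _ = A.piece G (s * α) * (s * α) * (star α * p) * star t * A.piece G (t * β) := by
          rw [piece_mul_of_prefix (hT s hs) hα (hT _ hsα)]; simp only [mul_assoc]
      _ = _ := by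
          rw [h1, star_mul, star_mul, piece_star]; simp only [mul_assoc]
  rw [e]
  by_cases h0 : t * α = 0
  · left; rw [h0]; simp
  have htα := hsw s hs t ht α hα hsα hd h0
  by_cases hpre : ∃ γ ∈ A.T₁, t * β = t * α * γ
  · obtain ⟨γ, hγ, h⟩ := hpre
    have hne := ne_zero_of_mem_T₁ (hT _ htβ)
    rw [mul_assoc] at h
    have hαγ : α * γ ≠ 0 := fun h' => hne (by rw [h, h', mul_zero])
    exact Or.inr ⟨γ, hγ, mul_left_cancel_T₁ (hT t ht) hβ (mul_mem_T₁ hα hγ hαγ) hne h⟩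
  · left
    rw [piece_mul_of_not_prefix hT hj htβ htα hpre]
    simp

/-- A corner of a standard word of degree zero has the form `Q s a t* Q'` with `a` in the diagonal
algebra. -/
theorem exists_corner (hT : ∀ g ∈ G, g ∈ A.T₁)
    (hj : ∀ s ∈ G, ∀ t ∈ G, ∀ a ∈ A.ext s t, s * a.1 ∈ G)
    (hsw : ∀ s ∈ G, ∀ t ∈ G, ∀ α ∈ A.T₁, s * α ∈ G → A.d s = A.d t → t * α ≠ 0 → t * α ∈ G)
    {s t p : Unitization ℂ X} (hs : s ∈ G) (ht : t ∈ G) (hd : A.d s = A.d t) (hp : p ∈ A.P₁)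
    {u v : Unitization ℂ X} (hu : u ∈ G) (hv : v ∈ G) : ∃ a : A.diagAlg,
      (A.piece G u : Unitization ℂ X) * (s * p * star t) * A.piece G v =
        A.piece G u * u * a * star v * A.piece G v := by
  have hzero : (A.piece G u : Unitization ℂ X) * (s * p * star t) * A.piece G v = 0 →
      ∃ a : A.diagAlg, (A.piece G u : Unitization ℂ X) * (s * p * star t) * A.piece G v =
        A.piece G u * u * a * star v * A.piece G v := fun h => ⟨0, by rw [h]; simp⟩
  have hstar : star (A.piece G u * (s * p * star t) * A.piece G v : Unitization ℂ X) =
      A.piece G v * (t * p * star s) * A.piece G u := by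
    simp only [star_mul, star_star, piece_star, P₁_star hp, mul_assoc]
  by_cases h1 : ∃ α ∈ A.T₁, u = s * α
  swap
  · refine hzero ?_
    have := piece_mul_of_not_prefix hT hj hu hs h1
    rw [← mul_assoc, ← mul_assoc, this]; simp
  by_cases h2 : ∃ β ∈ A.T₁, v = t * β
  swap
  · refine hzero (star_eq_zero.1 ?_)
    have := piece_mul_of_not_prefix hT hj hv ht h2
    rw [hstar, ← mul_assoc, ← mul_assoc, this]; simp
  obtain ⟨α, hα, rfl⟩ := h1
  obtain ⟨β, hβ, rfl⟩ := h2
  rcases corner_eq_zero_or hT hj hsw hs ht hd hp hα hβ hu hv with h | ⟨γ, hγ, h⟩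
  · exact hzero h
  rcases corner_eq_zero_or hT hj hsw ht hs hd.symm hp hβ hα hv hu with h' | ⟨γ', hγ', h'⟩
  · exact hzero (star_eq_zero.1 (hstar.trans h'))
  -- The alternative, applied to the corner and to its adjoint, makes each of α and β a prefix of
  -- the other.
  have hαβ : α = β := by
    have l1 := len_mul hα hγ (by rw [← h]; exact ne_zero_of_mem_T₁ hβ)
    have l2 := len_mul hβ hγ' (by rw [← h']; exact ne_zero_of_mem_T₁ hα)
    rw [← h] at l1
    rw [← h'] at l2
    rw [h, eq_one_of_len hγ (by omega), mul_one]
  subst hαβ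
  obtain ⟨p', hp', -, h3, -⟩ := skip_star hα hp
  have hmem : star α * p * α ∈ A.diagAlg := by
    rw [mul_assoc, h3, ← mul_assoc]
    exact diag_subset_diagAlg (mem_diag_of_mem_P₁ (P₁_mul (star_mul_self_mem_P₁ hα) hp'))
  refine ⟨⟨_, hmem⟩, ?_⟩
  have e1 := piece_mul_of_prefix (G := G) (hT s hs) hα (hT _ hu)
  have e2 := congrArg star (piece_mul_of_prefix (G := G) (hT t ht) hα (hT _ hv))
  rw [star_mul, star_mul, star_star, piece_star, star_mul (A.piece G (t * α) : Unitization ℂ X),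
    piece_star] at e2
  calc (A.piece G (s * α) : Unitization ℂ X) * (s * p * star t) * A.piece G (t * α)
      = (A.piece G (s * α) * s) * p * (star t * A.piece G (t * α)) := by simp only [mul_assoc]
    _ = _ := by rw [e1, e2]; simp only [mul_assoc]

/-- The linear map `a ↦ Q_s s a t* Q_t`. -/
noncomputable def cornerMap (A : SemigraphAlgebra k X) (G : Finset (Unitization ℂ X))
    (s t : Unitization ℂ X) : Unitization ℂ X →ₗ[ℂ] Unitization ℂ X :=
  LinearMap.mulLeft ℂ (A.piece G s * s) ∘ₗ LinearMap.mulRight ℂ (star t * A.piece G t)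

theorem cornerMap_apply (s t a : Unitization ℂ X) :
    A.cornerMap G s t a = A.piece G s * s * a * star t * A.piece G t := by
  simp [cornerMap, mul_assoc]

/-- The span of the corners `Q_s s a t* Q_t` with `s, t ∈ G` and `a ∈ C`. -/
noncomputable def cornerSpan (A : SemigraphAlgebra k X) (G : Finset (Unitization ℂ X))
    (C : Submodule ℂ (Unitization ℂ X)) : Submodule ℂ (Unitization ℂ X) :=
  ⨆ i : G × G, C.map (A.cornerMap G i.1 i.2)

theorem cornerMap_mem {C : Submodule ℂ (Unitization ℂ X)} {s t a : Unitization ℂ X} (hs : s ∈ G)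
    (ht : t ∈ G) (ha : a ∈ C) : A.cornerMap G s t a ∈ A.cornerSpan G C :=
  Submodule.mem_iSup_of_mem (p := fun i : G × G => C.map (A.cornerMap G i.1 i.2))
    (⟨s, hs⟩, ⟨t, ht⟩) ⟨a, ha, rfl⟩

/-- Distinct pieces are orthogonal, so a product of corners survives only when the inner indices
agree; the middle factor u* Q_u u then lies in C, where Q_u is the piece of u. -/
theorem cornerSpan_mul (hT : ∀ g ∈ G, g ∈ A.T₁)
    (hj : ∀ s ∈ G, ∀ t ∈ G, ∀ a ∈ A.ext s t, s * a.1 ∈ G) {C : Submodule ℂ (Unitization ℂ X)}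
    (hmul : ∀ a ∈ C, ∀ b ∈ C, a * b ∈ C) (hC : ∀ g ∈ G, star g * A.piece G g * g ∈ C) :
    A.cornerSpan G C * A.cornerSpan G C ≤ A.cornerSpan G C := by
  conv_lhs => rw [cornerSpan, Submodule.iSup_mul]
  refine iSup_le fun i => ?_
  rw [Submodule.mul_iSup]
  refine iSup_le fun j => Submodule.mul_le.2 ?_
  rintro _ ⟨a, ha, rfl⟩ _ ⟨b, hb, rfl⟩
  obtain ⟨⟨s, hs⟩, ⟨u, hu⟩⟩ := i
  obtain ⟨⟨v, hv⟩, ⟨t, ht⟩⟩ := j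
  simp only [cornerMap_apply]
  by_cases huv : u = v
  · subst huv
    have h1 := congrArg Subtype.val (A.piece_idem G u)
    rw [MulMemClass.coe_mul] at h1
    have h2 := cornerMap_mem (A := A) hs ht
      (hmul _ (hmul _ ha _ (hC u hu)) _ hb)
    rw [cornerMap_apply] at h2
    convert h2 using 1
    conv_rhs => rw [← h1]
    simp only [mul_assoc]
  · have h1 := congrArg Subtype.val (piece_mul_piece hT hj hu hv huv)
    rw [MulMemClass.coe_mul] at h1
    convert zero_mem (A.cornerSpan G C) using 1
    calc _ = (A.piece G s : Unitization ℂ X) * s * a * star u *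
          ((A.piece G u : Unitization ℂ X) * A.piece G v) * (v * b * star t * A.piece G t) := by
          simp only [mul_assoc]
      _ = 0 := by rw [h1]; simp

/-- Each element of the core lies in a finite-dimensional multiplicatively closed subspace of the
core. -/
theorem exists_finiteDimensional_of_mem_core {x : X} (hx : x ∈ A.gr 0) :
    ∃ V : Submodule ℂ X, x ∈ V ∧ V ≤ A.gr 0 ∧ FiniteDimensional ℂ V ∧
      ∀ a ∈ V, ∀ b ∈ V, a * b ∈ V := by
  obtain ⟨W, hW, hxW⟩ := Submodule.mem_span_finite_of_mem_span (gr_le_stdWords 0 hx)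
  have hdec : ∀ w ∈ W, ∃ s ∈ A.T₁, ∃ p ∈ A.P₁, ∃ t ∈ A.T₁,
      (w : Unitization ℂ X) = s * p * star t ∧ A.d s = A.d t := fun w hw => by
    obtain ⟨s, hs, p, hp, t, ht, h, hd⟩ := hW hw
    exact ⟨s, hs, p, Pinr_subset_P₁ hp, t, ht, h, intDeg_injective (sub_eq_zero.1 hd)⟩
  choose! s hs p hp t ht hw hd using hdec
  -- The unit is included so that the pieces sum to 1.
  obtain ⟨G, hEG, hT, hj, hsw⟩ := exists_prefixClosed (A := A)
    (E := insert 1 (s '' W ∪ t '' W)) (by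
      rintro _ (rfl | ⟨w, hw, rfl⟩ | ⟨w, hw, rfl⟩)
      exacts [one_mem_T₁, hs w hw, ht w hw])
    (((W.finite_toSet.image s).union (W.finite_toSet.image t)).insert 1)
  have h1G : (1 : Unitization ℂ X) ∈ G := hEG (Set.mem_insert _ _)
  have hcor : ∀ w ∈ W, ∀ u ∈ G, ∀ v ∈ G, ∃ a ∈ A.diagAlg,
      (A.piece G u : Unitization ℂ X) * w * A.piece G v = A.cornerMap G u v a :=
    fun w hwW u hu v hv => by
      obtain ⟨a, ha⟩ := exists_corner hT hj hsw (hEG (Or.inr (Or.inl ⟨w, hwW, rfl⟩)))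
        (hEG (Or.inr (Or.inr ⟨w, hwW, rfl⟩))) (hd w hwW) (hp w hwW) hu hv
      exact ⟨a, a.2, by rw [hw w hwW, ha, cornerMap_apply]⟩
  choose! a ha hcor using hcor
  -- C must contain the coefficients of all corners of the words in W, and the elements g* Q_g g
  -- which arise when corners are multiplied.
  obtain ⟨C, hSC, hCfd, hCmul⟩ := exists_finite_subspace (A := A)
    (S := (fun i : X × Unitization ℂ X × Unitization ℂ X => a i.1 i.2.1 i.2.2) ''
        ((W ×ˢ (G ×ˢ G) : Finset _) : Set _) ∪ (fun g => star g * A.piece G g * g) '' G)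
    (((Finset.finite_toSet _).image _).union (G.finite_toSet.image _)) (by
      rintro _ (⟨⟨w, u, v⟩, hi, rfl⟩ | ⟨g, hg, rfl⟩)
      · simp only [Finset.coe_product, Set.mem_prod, Finset.mem_coe] at hi
        exact ha w hi.1 u hi.2.1 v hi.2.2
      · exact conj_mem_diagAlg (hT g hg) (A.piece G g).2)
  have hmul := cornerSpan_mul hT hj hCmul fun g hg => hSC (Or.inr ⟨g, hg, rfl⟩)
  have hfd : FiniteDimensional ℂ (A.cornerSpan G C) := by
    unfold cornerSpan
    infer_instance
  let ι : X →ₗ[ℂ] Unitization ℂ X := (Unitization.inrNonUnitalAlgHom ℂ X : X →ₗ[ℂ] Unitization ℂ X)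
  have hι : Function.Injective ι := fun _ _ h => Unitization.inr_injective h
  -- The span of corners may leave X, as C lies in the unitization; pulling back to X and
  -- intersecting with degree zero keeps finite dimension and multiplicative closure.
  refine ⟨(A.cornerSpan G C).comap ι ⊓ A.gr 0, ⟨?_, hx⟩, inf_le_right, ?_, ?_⟩
  · have hWle : Submodule.span ℂ (W : Set X) ≤ (A.cornerSpan G C).comap ι := by
      refine Submodule.span_le.2 fun w hwW => ?_
      have h : ι w = ∑ u ∈ G, ∑ v ∈ G, (A.piece G u : Unitization ℂ X) * w * A.piece G v := by
        have h1 := congrArg Subtype.val (sum_piece hT hj h1G)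
        rw [AddSubmonoidClass.coe_finsetSum] at h1
        simp only [← Finset.mul_sum, ← Finset.sum_mul, h1]
        simp [ι]
      change ι w ∈ A.cornerSpan G C
      rw [h]
      refine sum_mem fun u hu => sum_mem fun v hv => ?_
      rw [hcor w hwW u hu v hv]
      refine cornerMap_mem hu hv (hSC (Or.inl ⟨(w, u, v), ?_, rfl⟩))
      simp only [Finset.coe_product, Set.mem_prod, Finset.mem_coe]
      exact ⟨hwW, hu, hv⟩
    exact hWle hxW
  · have : FiniteDimensional ℂ ((A.cornerSpan G C).comap ι) :=
      FiniteDimensional.of_injective (ι.restrict (p := (A.cornerSpan G C).comap ι) (q := A.cornerSpan G C) fun _ h => h)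
        fun a b h => Subtype.ext (hι (congrArg Subtype.val h))
    exact Submodule.finiteDimensional_inf_left _ _
  · rintro a ⟨ha, ha'⟩ b ⟨hb, hb'⟩
    refine ⟨?_, by simpa using gr_mul ha' hb'⟩
    have := hmul (Submodule.mul_mem_mul ha hb)
    change ι (a * b) ∈ A.cornerSpan G C
    rwa [show ι (a * b) = ι a * ι b from Unitization.inr_mul _ _ _]

end SemigraphAlgebra

/-! ### The power trick -/

/-- If a > b > 0, then (a/b)^n outgrows every C n^j along n = 2^m. For b = 0 the case m = 0 already
gives a ≤ 0. -/
theorem le_of_pow_le_mul_pow {a b C : ℝ} (hb : 0 ≤ b) (j : ℕ)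
    (h : ∀ m : ℕ, a ^ 2 ^ m ≤ C * ((2 ^ m : ℕ) : ℝ) ^ j * b ^ 2 ^ m) : a ≤ b := by
  by_contra! hlt
  rcases hb.eq_or_lt with rfl | hb
  · have := h 0
    simp at this
    linarith
  have hr : 1 < a / b := (one_lt_div hb).2 hlt
  have ht := (tendsto_pow_const_div_const_pow_of_one_lt j hr).const_mul C
  rw [mul_zero] at ht
  have ht' := ht.comp (tendsto_pow_atTop_atTop_of_one_lt (one_lt_two (α := ℕ)))
  obtain ⟨m, hm⟩ := (ht'.eventually (gt_mem_nhds one_pos)).exists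
  have hpos : 0 < (a / b) ^ 2 ^ m := by positivity
  have hbp : 0 < b ^ 2 ^ m := by positivity
  have h1 := h m
  simp only [Function.comp_apply] at hm
  rw [← mul_div_assoc, div_lt_one hpos, div_pow, lt_div_iff₀ hbp] at hm
  exact absurd hm (not_lt.2 h1)

/-! ### Iterated squares, suprema and finite-dimensional comparison of C*-seminorms. -/

namespace CStarSeminorm

variable {X : Type*} [NonUnitalRing X] [StarRing X] [Module ℂ X]

theorem star_iterate_sq {h : X} (hh : star h = h) (m : ℕ) :
    star ((fun x : X => x * x)^[m] h) = (fun x : X => x * x)^[m] h := by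
  induction m with
  | zero => exact hh
  | succ m ih => rw [Function.iterate_succ_apply', star_mul, ih]

/-- The C*-identity for a selfadjoint element is N(x x) = N(x)², and squares of selfadjoint elements
remain selfadjoint. -/
theorem iterate_sq (N : CStarSeminorm X) {h : X} (hh : star h = h) (m : ℕ) :
    N ((fun x : X => x * x)^[m] h) = N h ^ 2 ^ m := by
  induction m with
  | zero => simp
  | succ m ih =>
    rw [Function.iterate_succ_apply', pow_succ, pow_mul, ← ih, sq, ← N.star_mul_self,
      star_iterate_sq hh]

theorem le_of_star_mul_self_le {N M : CStarSeminorm X} {y : X}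
    (h : N (star y * y) ≤ M (star y * y)) : N y ≤ M y := by
  rw [N.star_mul_self, M.star_mul_self] at h
  exact (mul_self_le_mul_self_iff (N.nonneg y) (M.nonneg y)).2 h

theorem sum_le (N : CStarSeminorm X) {ι : Type*} (s : Finset ι) (f : ι → X) :
    N (∑ i ∈ s, f i) ≤ ∑ i ∈ s, N (f i) :=
  Finset.le_sum_of_subadditive (fun x => N x) N.map_zero.le N.add_le s f

/-- The pointwise supremum of a pointwise bounded family of C*-seminorms. -/
noncomputable def sup {ι : Type*} (f : ι → CStarSeminorm X)
    (h : ∀ x : X, BddAbove (Set.range fun i => f i x)) : CStarSeminorm X :=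
  have hle : ∀ i x, f i x ≤ ⨆ i, f i x := fun i x => le_ciSup (h x) i
  have h0 : ∀ x, 0 ≤ ⨆ i, f i x := fun x => Real.iSup_nonneg fun i => (f i).nonneg x
  { toFun := fun x => ⨆ i, f i x
    map_zero' := by simp [CStarSeminorm.map_zero]
    -- The index type may be empty, and the real supremum is then 0; hence the bounds are given
    -- through `Real.iSup_le` with a nonnegative right side.
    add_le' := fun x y => Real.iSup_le (fun i =>
      ((f i).add_le x y).trans (add_le_add (hle i x) (hle i y))) (add_nonneg (h0 x) (h0 y))
    neg' := fun x => by simp only [CStarSeminorm.map_neg]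
    smul' := fun c x => by
      simp only [CStarSeminorm.smul_eq]
      exact (Real.mul_iSup_of_nonneg (norm_nonneg c) _).symm
    mul_le' := fun x y => Real.iSup_le (fun i =>
      ((f i).mul_le x y).trans (mul_le_mul (hle i x) (hle i y) ((f i).nonneg y) (h0 x)))
        (mul_nonneg (h0 x) (h0 y))
    star_mul_self' := fun x => by
      refine le_antisymm (Real.iSup_le (fun i => ?_) (mul_nonneg (h0 x) (h0 x))) ?_
      · rw [(f i).star_mul_self]
        exact mul_le_mul (hle i x) (hle i x) ((f i).nonneg x) (h0 x)
      · have hs : (⨆ i, f i x) ≤ Real.sqrt (⨆ i, f i (star x * x)) :=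
          Real.iSup_le (fun i => Real.le_sqrt_of_sq_le (by
            rw [sq, ← (f i).star_mul_self]; exact hle i _)) (Real.sqrt_nonneg _)
        calc (⨆ i, f i x) * (⨆ i, f i x)
            ≤ Real.sqrt (⨆ i, f i (star x * x)) * Real.sqrt (⨆ i, f i (star x * x)) :=
                mul_le_mul hs hs (h0 x) (Real.sqrt_nonneg _)
          _ = _ := Real.mul_self_sqrt (h0 _) }

theorem le_sup {ι : Type*} (f : ι → CStarSeminorm X)
    (h : ∀ x : X, BddAbove (Set.range fun i => f i x)) (i : ι) (x : X) : f i x ≤ sup f h x :=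
  le_ciSup (h x) i

theorem sup_le {ι : Type*} (f : ι → CStarSeminorm X)
    (h : ∀ x : X, BddAbove (Set.range fun i => f i x)) {x : X} {C : ℝ} (hC : 0 ≤ C)
    (hf : ∀ i, f i x ≤ C) : sup f h x ≤ C :=
  Real.iSup_le hf hC

/-- A seminorm on a finite-dimensional space is bounded by a multiple of any norm. -/
theorem exists_le_mul_of_finiteDimensional (N M : CStarSeminorm X) (V : Submodule ℂ X)
    [FiniteDimensional ℂ V] (hM : ∀ x ∈ V, M x = 0 → x = 0) :
    ∃ C : ℝ, ∀ x ∈ V, N x ≤ C * M x := by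
  let _ : NormedAddCommGroup V := AddGroupNorm.toNormedAddCommGroup
    { toFun := fun x => M (x : X)
      map_zero' := M.map_zero
      add_le' := fun x y => M.add_le x y
      neg' := fun x => M.map_neg x
      eq_zero_of_map_eq_zero' := fun x hx => Subtype.ext (hM x x.2 hx) }
  let _ : NormedSpace ℂ V := ⟨fun c x => (M.smul_eq c (x : X)).le⟩
  let b := Module.finBasis ℂ V
  refine ⟨∑ i, ‖(LinearMap.toContinuousLinearMap (b.coord i))‖ * N (b i : X), fun x hx => ?_⟩
  have h : x = ∑ i, b.coord i ⟨x, hx⟩ • (b i : X) := by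
    have := congrArg (Subtype.val) (b.sum_repr ⟨x, hx⟩)
    rw [AddSubmonoidClass.coe_finsetSum] at this
    exact this.symm
  calc N x = N (∑ i, b.coord i ⟨x, hx⟩ • (b i : X)) := by rw [← h]
    _ ≤ ∑ i, N (b.coord i ⟨x, hx⟩ • (b i : X)) := N.sum_le _ _
    _ ≤ ∑ i, ‖(LinearMap.toContinuousLinearMap (b.coord i))‖ * N (b i : X) * M x := by
      refine Finset.sum_le_sum fun i _ => ?_
      rw [N.smul_eq, mul_right_comm]
      exact mul_le_mul_of_nonneg_right
        ((LinearMap.toContinuousLinearMap (b.coord i)).le_opNorm ⟨x, hx⟩) (N.nonneg _)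
    _ = _ := (Finset.sum_mul _ _ _).symm

end CStarSeminorm

/-! ### The supremum of the filter seminorms is the universal seminorm. -/

namespace SemigraphAlgebra

variable {k X : Type*} [NonUnitalRing X] [StarRing X] [Module ℂ X] [IsScalarTower ℂ X X]
  [SMulCommClass ℂ X X] [StarModule ℂ X] {A : SemigraphAlgebra k X}

open Pointwise in
theorem support_dec_mul [DecidableEq (k →₀ ℤ)] (x y : X) :
    (A.dec (x * y)).support ⊆ (A.dec x).support + (A.dec y).support := by
  intro g hg
  by_contra hne
  refine (Finsupp.mem_support_iff.1 hg) ?_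
  have h : x * y = ∑ a ∈ (A.dec x).support, ∑ b ∈ (A.dec y).support, A.dec x a * A.dec y b := by
    conv_lhs => rw [← A.dec_sum x, ← A.dec_sum y]
    rw [Finsupp.sum, Finsupp.sum, Finset.sum_mul_sum]
  rw [h, map_sum, Finsupp.finsetSum_apply]
  refine Finset.sum_eq_zero fun a ha => ?_
  rw [map_sum, Finsupp.finsetSum_apply]
  refine Finset.sum_eq_zero fun b hb => ?_
  rw [dec_of_mem_gr (gr_mul (A.dec_mem x a) (A.dec_mem y b)), Finsupp.single_apply, if_neg]
  rintro rfl
  exact hne (Finset.add_mem_add ha hb)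

/-- The number of degrees which occur in `h ^ (2 ^ m)` is polynomially bounded in `2 ^ m`. -/
theorem card_support_dec_iterate_sq (h : X) (m : ℕ) :
    (A.dec ((fun x : X => x * x)^[m] h)).support.card ≤
      (2 ^ m + 1) ^ (A.dec h).support.card := by
  classical
  let F := (A.dec h).support
  -- T(n) consists of the combinations ∑ c_s s of the degrees s of h with 0 ≤ c_s ≤ n. As degrees
  -- commute, products of n factors h stay in it, and its size is at most (n + 1)^|F|.
  let T : ℕ → Finset (k →₀ ℤ) := fun n =>
    (Fintype.piFinset fun _ : F => Finset.range (n + 1)).image fun c => ∑ s : F, c s • (s : k →₀ ℤ)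
  have hsub : ∀ m, (A.dec ((fun x : X => x * x)^[m] h)).support ⊆ T (2 ^ m) := by
    intro m
    induction m with
    | zero =>
      intro s hs
      refine Finset.mem_image.2 ⟨fun t => if t = ⟨s, hs⟩ then 1 else 0, ?_, ?_⟩
      · rw [Fintype.mem_piFinset]
        intro t
        rw [Finset.mem_range]
        split_ifs <;> simp
      · rw [Finset.sum_eq_single ⟨s, hs⟩] <;> simp +contextual
    | succ m ih =>
      rw [Function.iterate_succ_apply']
      intro g hg
      obtain ⟨a, ha, b, hb, rfl⟩ := Finset.mem_add.1 (support_dec_mul _ _ hg)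
      obtain ⟨c, hc, rfl⟩ := Finset.mem_image.1 (ih ha)
      obtain ⟨c', hc', rfl⟩ := Finset.mem_image.1 (ih hb)
      rw [Fintype.mem_piFinset] at hc hc'
      refine Finset.mem_image.2 ⟨c + c', Fintype.mem_piFinset.2 fun s => ?_, ?_⟩
      · have h1 := Finset.mem_range.1 (hc s)
        have h2 := Finset.mem_range.1 (hc' s)
        rw [Finset.mem_range, Pi.add_apply, pow_succ]
        omega
      · simp only [Pi.add_apply, add_smul, Finset.sum_add_distrib]
  refine (Finset.card_le_card (hsub m)).trans (Finset.card_image_le.trans ?_)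
  simp [Fintype.card_piFinset, F]

/-- The supremum of the C*-seminorms of all standard filters. -/
noncomputable def filterSeminorm (A : SemigraphAlgebra k X) : CStarSeminorm X :=
  CStarSeminorm.sup (fun S : A.StdFilter => S.seminorm) fun x =>
    (A.bddAbove_cstarSeminorm x).mono
      (by rintro _ ⟨S, rfl⟩; exact Set.mem_range_self (f := fun N : CStarSeminorm X => N x) S.seminorm)

theorem StdFilter.seminorm_le_filterSeminorm (S : A.StdFilter) (x : X) :
    S.seminorm x ≤ A.filterSeminorm x :=
  CStarSeminorm.le_sup (fun S : A.StdFilter => S.seminorm) _ S x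

theorem filterSeminorm_dec_le (x : X) (n : k →₀ ℤ) :
    A.filterSeminorm (A.dec x n) ≤ A.filterSeminorm x :=
  CStarSeminorm.sup_le _ _ (A.filterSeminorm.nonneg x) fun S =>
    (S.seminorm_dec_le x n).trans (S.seminorm_le_filterSeminorm x)

/-- Vanishing in every filter seminorm gives, for homogeneous x, an annihilating member of every
filter, and such an element is zero. -/
theorem eq_zero_of_filterSeminorm {n : k →₀ ℤ} {x : X} (hx : x ∈ A.gr n)
    (h : A.filterSeminorm x = 0) : x = 0 :=
  eq_zero_of_forall_stdFilter x fun S => S.exists_mul_eq_zero hx <|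
    le_antisymm ((S.seminorm_le_filterSeminorm x).trans h.le) (S.seminorm.nonneg x)

theorem IsCancelling.filterSeminorm_le (hA : A.IsCancelling) (M : CStarSeminorm X)
    (hM : ∀ p : X, (p : Unitization ℂ X) ∈ A.stdProj → p ≠ 0 → M p ≠ 0) (x : X) :
    A.filterSeminorm x ≤ M x :=
  CStarSeminorm.sup_le _ _ (M.nonneg x) fun S => hA.seminorm_le S M hM x

theorem filterSeminorm_ne_zero {p : X} (hp : (p : Unitization ℂ X) ∈ A.stdProj) (h0 : p ≠ 0) :
    A.filterSeminorm p ≠ 0 := by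
  obtain ⟨S, hS⟩ := A.exists_stdFilter hp (fun h => h0 (Unitization.inr_injective h))
  exact ((lt_of_le_of_ne (S.seminorm.nonneg p) (S.seminorm_ne_zero hS).symm).trans_le
    (S.seminorm_le_filterSeminorm p)).ne'

/-- On homogeneous elements, every C*-seminorm is bounded by `filterSeminorm`. -/
theorem le_filterSeminorm_of_mem_gr (N : CStarSeminorm X) {n : k →₀ ℤ} {y : X} (hy : y ∈ A.gr n) :
    N y ≤ A.filterSeminorm y := by
  refine CStarSeminorm.le_of_star_mul_self_le ?_
  have hh : star (star y * y) = star y * y := by simp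
  have hc : star y * y ∈ A.gr 0 := by simpa using gr_mul (gr_star hy) hy
  generalize star y * y = h at hh hc
  obtain ⟨V, hV, hle, hfd, hmul⟩ := exists_finiteDimensional_of_mem_core hc
  obtain ⟨C, hC⟩ := N.exists_le_mul_of_finiteDimensional A.filterSeminorm V
    fun x hx => eq_zero_of_filterSeminorm (hle hx)
  -- The iterated squares of h stay in V, so a single constant C serves for all m, without
  -- polynomial growth.
  refine le_of_pow_le_mul_pow (A.filterSeminorm.nonneg h) 0 (C := C) fun m => ?_
  rw [pow_zero, mul_one, ← N.iterate_sq hh, ← A.filterSeminorm.iterate_sq hh]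
  refine hC _ ?_
  induction m with
  | zero => exact hV
  | succ m ih => rw [Function.iterate_succ_apply']; exact hmul _ ih _ ih

/-- Summing the homogeneous estimate over components costs the number of degrees as a factor. For
iterated squares of h this factor is polynomial in 2^m, so the power trick removes it. -/
theorem le_filterSeminorm (N : CStarSeminorm X) (y : X) : N y ≤ A.filterSeminorm y := by
  refine CStarSeminorm.le_of_star_mul_self_le ?_
  have hh : star (star y * y) = star y * y := by simp
  generalize star y * y = h at hh
  have key : ∀ z : X, N z ≤ (A.dec z).support.card * A.filterSeminorm z := fun z => by
    calc N z = N (∑ g ∈ (A.dec z).support, A.dec z g) := congrArg N (A.dec_sum z).symm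
      _ ≤ ∑ g ∈ (A.dec z).support, N (A.dec z g) := N.sum_le _ _
      _ ≤ ∑ g ∈ (A.dec z).support, A.filterSeminorm z := Finset.sum_le_sum fun g _ =>
        (le_filterSeminorm_of_mem_gr N (A.dec_mem z g)).trans (filterSeminorm_dec_le z g)
      _ = _ := by rw [Finset.sum_const, nsmul_eq_mul]
  refine le_of_pow_le_mul_pow (A.filterSeminorm.nonneg h) (A.dec h).support.card
    (C := 2 ^ (A.dec h).support.card) fun m => ?_
  rw [← N.iterate_sq hh, ← A.filterSeminorm.iterate_sq hh]
  refine (key _).trans (mul_le_mul_of_nonneg_right ?_ (A.filterSeminorm.nonneg _))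
  rw [← mul_pow]
  have h1 := card_support_dec_iterate_sq (A := A) h m
  have h2 : (2 ^ m + 1) ^ (A.dec h).support.card ≤ (2 * 2 ^ m) ^ (A.dec h).support.card :=
    Nat.pow_le_pow_left (by have := Nat.one_le_two_pow (n := m); omega) _
  exact_mod_cast h1.trans h2

theorem universalSeminorm_le (x : X) : A.universalSeminorm x ≤ A.filterSeminorm x :=
  le_filterSeminorm _ x

theorem filterSeminorm_le_universalSeminorm (x : X) :
    A.filterSeminorm x ≤ A.universalSeminorm x :=
  CStarSeminorm.le_maximal A.bddAbove_cstarSeminorm _ x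

theorem norm_universalRep (x : X) : ‖A.universalRep x‖ = A.universalSeminorm x :=
  A.universalSeminorm.norm_coe x

end SemigraphAlgebra

/-! ### The uniqueness theorem. -/

/-- An isometric *-homomorphism with dense range from a C*-algebra is surjective. -/
theorem NonUnitalStarAlgHom.bijective_of_denseRange {B C : Type*} [NonUnitalCStarAlgebra B]
    [NonUnitalCStarAlgebra C] (φ : B →⋆ₙₐ[ℂ] C) (hφ : Isometry φ) (hd : DenseRange φ) :
    Function.Bijective φ :=
  ⟨hφ.injective, Set.range_eq_univ.1 (hφ.isClosedEmbedding.isClosed_range.closure_eq ▸ hd.closure_eq)⟩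

theorem theorem7p2 {k X : Type*} [NonUnitalRing X] [StarRing X] [Module ℂ X] [IsScalarTower ℂ X X]
    [SMulCommClass ℂ X X] [StarModule ℂ X] (A : SemigraphAlgebra k X) (hA : A.IsCancelling) :
    -- the universal representation is injective on the core
    Set.InjOn A.universalRep A.core ∧
    -- it has dense image and is non-vanishing on nonzero standard projections
    DenseRange A.universalRep ∧
    (∀ p : X, A.IsStandardProjection p → p ≠ 0 → A.universalRep p ≠ 0) ∧
    -- up to isomorphism there is no other such representation
    ∀ (B : Type*) [NonUnitalCStarAlgebra B] (ρ : X →⋆ₙₐ[ℂ] B), DenseRange ρ →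
      (∀ p : X, A.IsStandardProjection p → p ≠ 0 → ρ p ≠ 0) →
      ∃ φ : A.CStar ≃⋆ₐ[ℂ] B, ∀ x : X, φ (A.universalRep x) = ρ x := by
  have hdense : DenseRange A.universalRep := A.universalSeminorm.denseRange_coe
  refine ⟨fun x hx y hy hxy => ?_, hdense, fun p hp h0 h => ?_, fun B _ ρ hρ hnv => ?_⟩
  · have h : A.universalSeminorm (x - y) = 0 := by
      rw [← A.norm_universalRep, map_sub, hxy, sub_self, norm_zero]
    exact sub_eq_zero.1 (SemigraphAlgebra.eq_zero_of_filterSeminorm (n := 0)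
      (sub_mem hx hy : x - y ∈ A.gr 0) (le_antisymm
        ((A.filterSeminorm_le_universalSeminorm _).trans h.le) (A.filterSeminorm.nonneg _)))
  · have h1 : A.universalSeminorm p = 0 := by rw [← A.norm_universalRep, h, norm_zero]
    exact SemigraphAlgebra.filterSeminorm_ne_zero (A.isStandardProjection_iff.1 hp) h0
      (le_antisymm ((A.filterSeminorm_le_universalSeminorm _).trans h1.le)
        (A.filterSeminorm.nonneg _))
  · obtain ⟨φ, hφ, -⟩ := A.universal ρ
    have hnorm : ∀ x, ‖ρ x‖ = ‖A.universalRep x‖ := fun x => by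
      rw [A.norm_universalRep]
      -- The seminorms are sandwiched: ‖ρ x‖ ≤ universal ≤ `filterSeminorm` ≤ ‖ρ x‖, the last by
      -- cancellation.
      refine le_antisymm (CStarSeminorm.le_maximal A.bddAbove_cstarSeminorm
        (CStarSeminorm.ofHom ρ) x) ((A.universalSeminorm_le x).trans ?_)
      exact hA.filterSeminorm_le (CStarSeminorm.ofHom ρ)
        (fun p hp h0 => norm_ne_zero_iff.2 (hnv p (A.isStandardProjection_iff.2 hp) h0)) x
    have hc : Continuous φ := AddMonoidHomClass.continuous_of_bound φ 1 fun a => by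
      simpa using NonUnitalStarAlgHom.norm_apply_le φ a
    have hiso : Isometry φ := AddMonoidHomClass.isometry_of_norm φ fun a =>
      hdense.induction_on (p := fun a => ‖φ a‖ = ‖a‖) a
        (isClosed_eq hc.norm continuous_norm) fun x => by rw [hφ, hnorm]
    have hd : DenseRange φ := hρ.mono (Set.range_subset_iff.2 fun x => ⟨_, hφ x⟩)
    exact ⟨StarAlgEquiv.ofBijective φ (φ.bijective_of_denseRange hiso hd), hφ⟩
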